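/- Notation. Let $\varphi_j=\sqrt2\sin(j\pi\,\cdot)$ and $\lambda_j=(j\pi)^2$, $j\ge 1$, be the eigenfunctions and eigenvalues of $A=-\frac{d^2}{dx^2}$ on $L^2((0,1),\mathbb C)$ with domain $H^2\cap H^1_0(0,1)$, and let $e^{-iAt}\varphi=\sum_{j\ge1}e^{-i\lambda_jt}\langle\varphi,\varphi_j\rangle\varphi_j$. For $s>0$ let $H^s_{(0)}=D(A^{s/2})$ be the space of the $\varphi\in L^2(0,1)$ with $\|\varphi\|_{H^s_{(0)}}:=\big(\sum_{j\ge1}|j^s\langle\varphi,\varphi_j\rangle|^2\big)^{1/2}<\infty$. The space $H^{2p+3}\cap H^{2p+1}_{(0)}$ of complex-valued functions on $(0,1)$ carries the intersection norm $\max(\|\cdot\|_{H^{2p+3}},\|\cdot\|_{H^{2p+1}_{(0)}})$. For a Banach space $X$, $H^k_0((0,T),X)$ is the closure of $C^\infty_c((0,T),X)$ in $H^k((0,T),X)$, and for $u\in H^k_0((0,T),\mathbb R)$ we put $\|u\|_{H^k_0}=\|u^{(k)}\|_{L^2(0,T)}$. Theorem 2.1. Let $T>0$, $p,k\in\mathbb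 N=\{0,1,2,\dots\}$, and let $\mu\in H^{2(p+k)+3}((0,1),\mathbb R)$ satisfy $\mu^{(2n+1)}(0)=\mu^{(2n+1)}(1)=0$ for all $n=0,\dots,p-1$ (no condition if $p=0$). Let $u\in H^k_0((0,T),\mathbb R)$, $\psi_0\in H^{2(p+k)+3}_{(0)}$ and $f\in H^k_0\big((0,T),H^{2p+3}\cap H^{2p+1}_{(0)}\big)$. Then the Schrödinger equation $$i\partial_t\psi=-\partial_x^2\psi-u(t)\mu(x)\psi-f(t,x)\ \text{ on }(0,T)\times(0,1),\qquad \psi(t,0)=\psi(t,1)=0,\qquad \psi(0,\cdot)=\psi_0,$$ has a unique mild solution, that is, there is a unique function $\psi\in C^k([0,T],H^{2p+3}_{(0)})$ such that, in $H^{2p+3}_{(0)}$ and for every $t\in[0,T]$, $$\psi(t)=e^{-iAt}\psi_0+i\int_0^te^{-iA(t-\tau)}\big(u(\tau)\mu\psi(\tau)+f(\tau)\big)\,d\tau .$$ Moreover, for every $R>0$ there is a constant $C>0$, depending only on $p$, $k$, $T$, $\mu$ and $R$, such that for all $u$, $\psi_0$, $f$ as above with $\|u\|_{H^k_0}<R$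 this solution satisfies $$\|\psi\|_{C^k([0,T],H^{2p+3}_{(0)})}\le C\Big(\|\psi_0\|_{H^{2(p+k)+3}_{(0)}}+\|f\|_{H^k((0,T),H^{2p+3}\cap H^{2p+1}_{(0)})}\Big),$$ where $\|\psi\|_{C^k([0,T],Y)}=\max_{0\le n\le k}\sup_{t\in[0,T]}\|\psi^{(n)}(t)\|_Y$. -/

import Mathlib

open MeasureTheory Set Filter Topology
open scoped ContDiff ENNReal

noncomputable section

namespace BilinearSchrodinger

/-- `L²((a,b), E)`. -/
abbrev L2 (E : Type*) [NormedAddCommGroup E] (a b : ℝ) : Type _ :=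
  Lp E 2 (volume.restrict (Ioo a b))

/-- The function `x ↦ √2 sin(jπx)`. -/
def sineFun (j : ℕ+) (x : ℝ) : ℂ := ((Real.sqrt 2 * Real.sin (j * Real.pi * x) : ℝ) : ℂ)

theorem memLp_sineFun (j : ℕ+) : MemLp (sineFun j) 2 (volume.restrict (Ioo (0:ℝ) 1)) := by
  refine MemLp.of_bound (Continuous.aestronglyMeasurable ?_) (Real.sqrt 2)
    (Eventually.of_forall fun x => ?_)
  · unfold sineFun; fun_prop
  · rw [sineFun, Complex.norm_real, norm_mul, Real.norm_of_nonneg (Real.sqrt_nonneg 2)]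
    exact mul_le_of_le_one_right (Real.sqrt_nonneg 2) (Real.abs_sin_le_one _)

/-- The eigenvector `φ_j = √2 sin(jπ·)` of the Dirichlet Laplacian, in `L²((0,1), ℂ)`. -/
def eigVec (j : ℕ+) : L2 ℂ 0 1 := (memLp_sineFun j).toLp (sineFun j)

/-- The eigenvalue `λ_j = (jπ)²`. -/
def eigVal (j : ℕ+) : ℝ := (j * Real.pi) ^ 2

theorem inner_eigVec (j : ℕ+) (g : L2 ℂ 0 1) :
    inner ℂ (eigVec j) g = ∫ x in Ioo (0:ℝ) 1, sineFun j x * g x := by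
  rw [L2.inner_def]
  refine integral_congr_ae ?_
  filter_upwards [(memLp_sineFun j).coeFn_toLp] with x hx
  rw [eigVec, hx]
  simp only [RCLike.inner_apply, sineFun, Complex.conj_ofReal]
  ring

theorem integral_cos_int (n : ℤ) :
    ∫ x in (0:ℝ)..1, Real.cos (n * Real.pi * x) = if n = 0 then 1 else 0 := by
  split_ifs with h
  · simp [h]
  · have hn : (n : ℝ) * Real.pi ≠ 0 := mul_ne_zero (by exact_mod_cast h) Real.pi_ne_zero
    rw [intervalIntegral.integral_comp_mul_left (fun x => Real.cos x) hn]
    simp [Real.sin_int_mul_pi]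

theorem integral_sineFun_mul (i j : ℕ+) :
    ∫ x in Ioo (0:ℝ) 1, sineFun i x * sineFun j x = if i = j then 1 else 0 := by
  have h1 : ∀ x, sineFun i x * sineFun j x =
      ((Real.cos (((i : ℤ) - (j : ℤ) : ℤ) * Real.pi * x)
        - Real.cos (((i : ℤ) + (j : ℤ) : ℤ) * Real.pi * x) : ℝ) : ℂ) := by
    intro x
    rw [sineFun, sineFun, ← Complex.ofReal_mul]
    congr 1
    have e1 : (((i : ℤ) - (j : ℤ) : ℤ) : ℝ) * Real.pi * x = i * Real.pi * x - j * Real.pi * x := by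
      push_cast; ring
    have e2 : (((i : ℤ) + (j : ℤ) : ℤ) : ℝ) * Real.pi * x = i * Real.pi * x + j * Real.pi * x := by
      push_cast; ring
    rw [e1, e2, Real.cos_sub, Real.cos_add]
    have := Real.mul_self_sqrt (show (0:ℝ) ≤ 2 by norm_num)
    linear_combination (Real.sin (i * Real.pi * x) * Real.sin (j * Real.pi * x)) * this
  simp_rw [h1]
  rw [integral_complex_ofReal, ← integral_Ioc_eq_integral_Ioo,
    ← intervalIntegral.integral_of_le zero_le_one,
    intervalIntegral.integral_sub (Continuous.intervalIntegrable (by fun_prop) _ _)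
      (Continuous.intervalIntegrable (by fun_prop) _ _), integral_cos_int, integral_cos_int]
  have hi := i.pos
  have hj := j.pos
  have h2 : ((i : ℤ) + (j : ℤ)) ≠ 0 := by omega
  have h3 : ((i : ℤ) - (j : ℤ) = 0) ↔ i = j := by
    rw [sub_eq_zero]; exact_mod_cast Iff.rfl
  rw [if_neg h2]
  simp only [h3]
  split_ifs <;> simp

theorem orthonormal_eigVec : Orthonormal ℂ eigVec := by
  rw [orthonormal_iff_ite]
  intro i j
  rw [inner_eigVec, ← integral_sineFun_mul]
  refine integral_congr_ae ?_
  filter_upwards [(memLp_sineFun j).coeFn_toLp] with x hx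
  rw [eigVec, hx]

theorem integral_sin_mul_cos_pow (g : L2 ℂ 0 1) (hg : ∀ j, inner ℂ (eigVec j) g = 0) (n : ℕ) :
    ∀ j : ℕ, ∫ x in Ioo (0:ℝ) 1, ((Real.sin (j * Real.pi * x) *
      Real.cos (Real.pi * x) ^ n : ℝ) : ℂ) * g x = 0 := by
  have hgi : Integrable g (volume.restrict (Ioo (0:ℝ) 1)) := (Lp.memLp g).integrable (by norm_num)
  have hint : ∀ (j n : ℕ), Integrable (fun x => ((Real.sin (j * Real.pi * x) *
      Real.cos (Real.pi * x) ^ n : ℝ) : ℂ) * g x) (volume.restrict (Ioo (0:ℝ) 1)) := by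
    intro j n
    refine hgi.bdd_mul (c := 1) (Continuous.aestronglyMeasurable (by fun_prop))
      (Eventually.of_forall fun x => ?_)
    rw [Complex.norm_real, norm_mul, norm_pow]
    exact mul_le_one₀ (Real.abs_sin_le_one _) (by positivity)
      (pow_le_one₀ (abs_nonneg _) (Real.abs_cos_le_one _))
  induction n with
  | zero =>
    intro j
    rcases Nat.eq_zero_or_pos j with rfl | hj
    · simp
    · have h := (inner_eigVec ⟨j, hj⟩ g).symm.trans (hg _)
      have h2 : ∀ x, sineFun ⟨j, hj⟩ x * g x = (Real.sqrt 2 : ℂ) *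
          (((Real.sin (j * Real.pi * x) * Real.cos (Real.pi * x) ^ 0 : ℝ) : ℂ) * g x) := by
        intro x; simp [sineFun, mul_assoc]
      simp_rw [h2] at h
      rw [integral_const_mul] at h
      exact (mul_eq_zero.1 h).resolve_left (by norm_num)
  | succ n ih =>
    intro j
    rcases Nat.eq_zero_or_pos j with rfl | hj
    · simp
    obtain ⟨m, rfl⟩ : ∃ m, j = m + 1 := ⟨j - 1, by omega⟩
    have h2 : ∀ x, ((Real.sin ((m + 1 : ℕ) * Real.pi * x) *
          Real.cos (Real.pi * x) ^ (n + 1) : ℝ) : ℂ) * g x =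
        (1 / 2 : ℂ) * (((Real.sin ((m + 2 : ℕ) * Real.pi * x) *
          Real.cos (Real.pi * x) ^ n : ℝ) : ℂ) * g x) +
        (1 / 2 : ℂ) * (((Real.sin (m * Real.pi * x) *
          Real.cos (Real.pi * x) ^ n : ℝ) : ℂ) * g x) := by
      intro x
      have h3 : Real.sin ((m + 1 : ℕ) * Real.pi * x) * Real.cos (Real.pi * x) =
          1 / 2 * Real.sin ((m + 2 : ℕ) * Real.pi * x) + 1 / 2 * Real.sin (m * Real.pi * x) := by
        have e1 : ((m + 2 : ℕ) : ℝ) * Real.pi * x = (m + 1 : ℕ) * Real.pi * x + Real.pi * x := by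
          push_cast; ring
        have e2 : (m : ℝ) * Real.pi * x = (m + 1 : ℕ) * Real.pi * x - Real.pi * x := by
          push_cast; ring
        rw [e1, e2, Real.sin_add, Real.sin_sub]; ring
      rw [pow_succ', ← mul_assoc, h3]
      push_cast; ring
    simp_rw [h2]
    rw [integral_add ((hint _ _).const_mul _) ((hint _ _).const_mul _), integral_const_mul,
      integral_const_mul, ih, ih]
    simp

theorem eq_zero_of_inner_eigVec (g : L2 ℂ 0 1) (hg : ∀ j, inner ℂ (eigVec j) g = 0) : g = 0 := by
  have hgi : Integrable g (volume.restrict (Ioo (0:ℝ) 1)) := (Lp.memLp g).integrable (by norm_num)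
  set h : ℝ → ℂ := fun x => (Real.sin (Real.pi * x) : ℂ) * g x with hh
  have hhi : Integrable h (volume.restrict (Ioo (0:ℝ) 1)) := by
    refine hgi.bdd_mul (c := 1) (Continuous.aestronglyMeasurable (by fun_prop))
      (Eventually.of_forall fun x => ?_)
    rw [Complex.norm_real]; exact Real.abs_sin_le_one _
  have hbd : ∀ (q : ℝ → ℝ) (c : ℝ), Continuous q → (∀ x ∈ Ioo (0:ℝ) 1, |q x| ≤ c) →
      Integrable (fun x => q x • h x) (volume.restrict (Ioo (0:ℝ) 1)) := by
    intro q c hq hc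
    refine hhi.bdd_smul c hq.aestronglyMeasurable ?_
    filter_upwards [self_mem_ae_restrict measurableSet_Ioo] with x hx using hc x hx
  have hmon : ∀ n : ℕ, Integrable (fun x => (Real.cos (Real.pi * x) ^ n) • h x)
      (volume.restrict (Ioo (0:ℝ) 1)) := fun n =>
    hbd _ 1 (by fun_prop) fun x _ => by
      rw [abs_pow]; exact pow_le_one₀ (abs_nonneg _) (Real.abs_cos_le_one _)
  have hpoly : ∀ P : Polynomial ℝ, Integrable (fun x => (P.eval (Real.cos (Real.pi * x))) • h x)
      (volume.restrict (Ioo (0:ℝ) 1)) ∧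
      ∫ x in Ioo (0:ℝ) 1, (P.eval (Real.cos (Real.pi * x))) • h x = 0 := by
    intro P
    induction P using Polynomial.induction_on' with
    | add p q hp hq =>
      simp only [Polynomial.eval_add, add_smul]
      refine ⟨hp.1.add hq.1, ?_⟩
      rw [integral_add hp.1 hq.1, hp.2, hq.2, add_zero]
    | monomial n a =>
      simp only [Polynomial.eval_monomial, mul_smul]
      refine ⟨(hmon n).smul a, ?_⟩
      rw [integral_smul]
      have := integral_sin_mul_cos_pow g hg n 1
      have h4 : ∀ x, ((Real.sin ((1 : ℕ) * Real.pi * x) * Real.cos (Real.pi * x) ^ n : ℝ) : ℂ) * g x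
          = (Real.cos (Real.pi * x) ^ n) • h x := by
        intro x
        rw [hh, Complex.real_smul]; push_cast; ring_nf
      simp_rw [h4] at this
      rw [this, smul_zero]
  have hae := isOpen_Ioo.ae_eq_zero_of_integral_contDiff_smul_eq_zero (E := ℝ)
    (U := Ioo (0:ℝ) 1) (f := h) (μ := volume.restrict (Ioo (0:ℝ) 1))
    (hhi.locallyIntegrable.locallyIntegrableOn _) (by
      intro q hq hqc _
      obtain ⟨c, hc⟩ := hq.continuous.bounded_above_of_compact_support hqc
      have hqi := hbd q c hq.continuous fun x _ => hc x
      by_contra hne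
      set N := ∫ x in Ioo (0:ℝ) 1, ‖h x‖ with hN
      have hN0 : 0 ≤ N := integral_nonneg fun x => norm_nonneg _
      have hpos : 0 < ‖∫ x in Ioo (0:ℝ) 1, q x • h x‖ := norm_pos_iff.2 hne
      set ε := ‖∫ x in Ioo (0:ℝ) 1, q x • h x‖ / (N + 1) with hε
      have hε0 : 0 < ε := by positivity
      obtain ⟨P, hP⟩ := exists_polynomial_near_of_continuousOn (-1) 1
        (fun y => q (Real.arccos y / Real.pi))
        ((hq.continuous.comp (Real.continuous_arccos.div_const _)).continuousOn) ε hε0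
      have hle : ‖∫ x in Ioo (0:ℝ) 1, q x • h x‖ ≤ ε * N := by
        have e1 : ∫ x in Ioo (0:ℝ) 1, q x • h x =
            ∫ x in Ioo (0:ℝ) 1, (q x • h x - (P.eval (Real.cos (Real.pi * x))) • h x) := by
          rw [integral_sub hqi (hpoly P).1, (hpoly P).2, sub_zero]
        rw [e1, hN, ← integral_const_mul]
        refine norm_integral_le_of_norm_le (hhi.norm.const_mul _) ?_
        filter_upwards [self_mem_ae_restrict measurableSet_Ioo] with x hx
        rw [← sub_smul, norm_smul]
        refine mul_le_mul_of_nonneg_right ?_ (norm_nonneg _)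
        have h5 := hP (Real.cos (Real.pi * x)) ⟨Real.neg_one_le_cos _, Real.cos_le_one _⟩
        rw [Real.arccos_cos (by have := hx.1; positivity)
          (mul_le_of_le_one_right Real.pi_pos.le hx.2.le),
          mul_div_cancel_left₀ _ Real.pi_ne_zero, abs_sub_comm] at h5
        exact h5.le
      have : ε * (N + 1) = ‖∫ x in Ioo (0:ℝ) 1, q x • h x‖ := by
        rw [hε]; field_simp
      nlinarith)
  rw [Lp.eq_zero_iff_ae_eq_zero]
  filter_upwards [hae, self_mem_ae_restrict measurableSet_Ioo] with x hx hx1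
  have h6 := hx hx1
  rw [hh] at h6
  refine (mul_eq_zero.1 h6).resolve_left ?_
  exact_mod_cast (Real.sin_pos_of_pos_of_lt_pi (mul_pos Real.pi_pos hx1.1)
    (by nlinarith [Real.pi_pos, hx1.2])).ne'

/-- The orthonormal basis `(φ_j)` of `L²((0,1), ℂ)`. -/
def eigBasis : HilbertBasis ℕ+ ℂ (L2 ℂ 0 1) :=
  HilbertBasis.mkOfOrthogonalEqBot orthonormal_eigVec (by
    rw [Submodule.eq_bot_iff]
    intro g hg
    refine eq_zero_of_inner_eigVec g fun j => ?_
    exact (Submodule.mem_orthogonal _ _).1 hg _ (Submodule.subset_span ⟨j, rfl⟩))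

theorem eigBasis_apply (j : ℕ+) : eigBasis j = eigVec j := by
  simp [eigBasis]

/-! ### The group `e^{-iAt}` and the spaces `H^s_{(0)}(0,1) = D(A^{s/2})` -/

/-- `e^{-iAt} φ = ∑_j e^{-i λ_j t} ⟨φ, φ_j⟩ φ_j`; the series converges in `L²` by
`hasSum_schrodingerGroup`. (`inner ℂ` is conjugate-linear in its first argument, so that
`inner ℂ (eigVec j) φ` is the coefficient `⟨φ, φ_j⟩`.) -/
def schrodingerGroup (t : ℝ) (φ : L2 ℂ 0 1) : L2 ℂ 0 1 :=
  ∑' j : ℕ+, (Complex.exp (-Complex.I * eigVal j * t) * inner ℂ (eigVec j) φ) • eigVec j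

theorem hasSum_schrodingerGroup (t : ℝ) (φ : L2 ℂ 0 1) :
    HasSum (fun j : ℕ+ =>
      (Complex.exp (-Complex.I * eigVal j * t) * inner ℂ (eigVec j) φ) • eigVec j)
      (schrodingerGroup t φ) := by
  have hmem : Memℓp (fun j : ℕ+ =>
      Complex.exp (-Complex.I * eigVal j * t) * inner ℂ (eigVec j) φ) 2 := by
    have h := lp.memℓp (eigBasis.repr φ)
    rw [memℓp_gen_iff (by norm_num)] at h ⊢
    convert h using 3 with j
    rw [norm_mul, Complex.norm_exp, HilbertBasis.repr_apply_apply, eigBasis_apply]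
    simp
  have h := eigBasis.hasSum_repr_symm ⟨_, hmem⟩
  simp only [eigBasis_apply] at h
  exact h.summable.hasSum

/-- The functions `φ ∈ L²((0,1), ℂ)` with `(j^s ⟨φ, φ_j⟩)_j ∈ ℓ²`, that is `D(A^{s/2})`. -/
def hZeroSubmodule (s : ℕ) : Submodule ℂ (L2 ℂ 0 1) where
  carrier := {φ | Memℓp (fun j : ℕ+ => (j : ℂ) ^ s * inner ℂ (eigVec j) φ) 2}
  zero_mem' := by
    show Memℓp _ 2
    simp only [inner_zero_right, mul_zero]
    exact zero_memℓp
  add_mem' := by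
    intro f g hf hg
    have := Memℓp.add hf hg
    show Memℓp _ 2
    simp only [inner_add_right, mul_add]
    exact this
  smul_mem' := by
    intro c f hf
    have := Memℓp.const_mul hf c
    show Memℓp _ 2
    simp only [inner_smul_right, mul_left_comm _ c]
    exact this

/-- The space `H^s_{(0)}(0,1)`, with the norm `‖(j^s ⟨φ, φ_j⟩)_j‖_{ℓ²}`
(and not the norm of `L²`). -/
def HZero (s : ℕ) : Type := hZeroSubmodule s

instance (s : ℕ) : AddCommGroup (HZero s) := inferInstanceAs (AddCommGroup (hZeroSubmodule s))

instance (s : ℕ) : Module ℂ (HZero s) := inferInstanceAs (Module ℂ (hZeroSubmodule s))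

/-- The inclusion of `H^s_{(0)}(0,1)` in `L²((0,1), ℂ)`. -/
def HZero.toL2 {s : ℕ} : HZero s →ₗ[ℂ] L2 ℂ 0 1 := (hZeroSubmodule s).subtype

/-- `φ ↦ (j^s ⟨φ, φ_j⟩)_j`. -/
def HZero.coeffs (s : ℕ) : HZero s →ₗ[ℂ] lp (fun _ : ℕ+ => ℂ) 2 where
  toFun φ := ⟨fun j => (j : ℂ) ^ s * inner ℂ (eigVec j) φ.toL2, φ.2⟩
  map_add' f g := by
    ext j
    simp only [map_add, inner_add_right, mul_add]
    rfl
  map_smul' c f := by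
    ext j
    simp [inner_smul_right]
    ring

theorem HZero.toL2_injective {s : ℕ} : Function.Injective (HZero.toL2 (s := s)) :=
  Subtype.val_injective

theorem HZero.coeffs_injective (s : ℕ) : Function.Injective (HZero.coeffs s) := by
  rw [injective_iff_map_eq_zero]
  intro φ h
  apply HZero.toL2_injective
  rw [map_zero]
  refine eq_zero_of_inner_eigVec _ fun j => ?_
  have h1 : (j : ℂ) ^ s * inner ℂ (eigVec j) φ.toL2 = 0 :=
    congrArg (fun v : lp (fun _ : ℕ+ => ℂ) 2 => v j) h
  refine (mul_eq_zero.1 h1).resolve_left (pow_ne_zero _ ?_)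
  exact_mod_cast j.ne_zero

theorem HZero.coeffs_surjective (s : ℕ) : Function.Surjective (HZero.coeffs s) := by
  intro a
  have hmem : Memℓp (fun j : ℕ+ => ((j : ℂ) ^ s)⁻¹ * a j) 2 := by
    have h := lp.memℓp a
    rw [memℓp_gen_iff (by norm_num)] at h ⊢
    refine Summable.of_nonneg_of_le (fun j => by positivity) (fun j => ?_) h
    refine Real.rpow_le_rpow (norm_nonneg _) ?_ (by norm_num)
    rw [norm_mul, norm_inv, norm_pow]
    refine mul_le_of_le_one_left (norm_nonneg _) (inv_le_one_of_one_le₀ (one_le_pow₀ ?_))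
    rw [show ((j : ℂ)) = ((j : ℕ) : ℂ) from rfl, Complex.norm_natCast]
    exact_mod_cast (one_le (a := j))
  have hc : ∀ j, inner ℂ (eigVec j) (eigBasis.repr.symm ⟨_, hmem⟩) = ((j : ℂ) ^ s)⁻¹ * a j := by
    intro j
    rw [← eigBasis_apply, ← HilbertBasis.repr_apply_apply, LinearIsometryEquiv.apply_symm_apply]
  have hj : ∀ j : ℕ+, (j : ℂ) ^ s * inner ℂ (eigVec j) (eigBasis.repr.symm ⟨_, hmem⟩) = a j := by
    intro j
    rw [hc, mul_inv_cancel_left₀ (pow_ne_zero _ (by exact_mod_cast j.ne_zero))]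
  refine ⟨⟨eigBasis.repr.symm ⟨_, hmem⟩, ?_⟩, ?_⟩
  · show Memℓp _ 2
    simp_rw [hj]
    exact lp.memℓp a
  · ext j
    exact hj j

instance (s : ℕ) : NormedAddCommGroup (HZero s) :=
  NormedAddCommGroup.induced (HZero s) (lp (fun _ : ℕ+ => ℂ) 2) (HZero.coeffs s)
    (HZero.coeffs_injective s)

instance (s : ℕ) : NormedSpace ℂ (HZero s) :=
  NormedSpace.induced ℂ (HZero s) (lp (fun _ : ℕ+ => ℂ) 2) (HZero.coeffs s)

instance (s : ℕ) : CompleteSpace (HZero s) := by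
  let e : HZero s ≃ₗᵢ[ℂ] lp (fun _ : ℕ+ => ℂ) 2 :=
    ⟨LinearEquiv.ofBijective (HZero.coeffs s) ⟨HZero.coeffs_injective s, HZero.coeffs_surjective s⟩,
      fun _ => rfl⟩
  exact e.toIsometryEquiv.completeSpace

theorem HZero.norm_toL2_le {s : ℕ} (φ : HZero s) : ‖φ.toL2‖ ≤ ‖φ‖ := by
  rw [← eigBasis.repr.norm_map, show ‖φ‖ = ‖HZero.coeffs s φ‖ from rfl]
  rw [lp.norm_eq_tsum_rpow (by norm_num), lp.norm_eq_tsum_rpow (by norm_num)]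
  refine Real.rpow_le_rpow (tsum_nonneg fun j => by positivity) ?_ (by norm_num)
  refine Summable.tsum_le_tsum (fun j => ?_) ((memℓp_gen_iff (by norm_num)).1 (lp.memℓp _))
    ((memℓp_gen_iff (by norm_num)).1 (lp.memℓp _))
  refine Real.rpow_le_rpow (norm_nonneg _) ?_ (by norm_num)
  rw [HilbertBasis.repr_apply_apply, eigBasis_apply]
  show _ ≤ ‖(j : ℂ) ^ s * inner ℂ (eigVec j) φ.toL2‖
  rw [norm_mul, norm_pow]
  refine le_mul_of_one_le_left (norm_nonneg _) (one_le_pow₀ ?_)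
  rw [show ((j : ℂ)) = ((j : ℕ) : ℂ) from rfl, Complex.norm_natCast]
  exact_mod_cast (one_le (a := j))

/-! ### Sobolev spaces of functions on an interval with values in a Banach space -/

section Sobolev

variable {E : Type*} [NormedAddCommGroup E] [NormedSpace ℝ E] {a b : ℝ}

/-- `φ ∈ C_c^∞((a,b), E)`. -/
def IsTestFun (E : Type*) [NormedAddCommGroup E] [NormedSpace ℝ E] (a b : ℝ) (φ : ℝ → E) : Prop :=
  ContDiff ℝ ∞ φ ∧ HasCompactSupport φ ∧ tsupport φ ⊆ Ioo a b

/-- `g'` is the weak derivative of `g` on `(a,b)`. -/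
def IsWeakDeriv (g g' : L2 E a b) : Prop :=
  ∀ φ : ℝ → ℝ, IsTestFun ℝ a b φ →
    ∫ x in Ioo a b, deriv φ x • g x = -∫ x in Ioo a b, φ x • g' x

theorem integrable_smul_L2 {q : ℝ → ℝ} (hq : Continuous q) (hc : HasCompactSupport q)
    (g : L2 E a b) : Integrable (fun x => q x • g x) (volume.restrict (Ioo a b)) := by
  obtain ⟨c, hc⟩ := hq.bounded_above_of_compact_support hc
  exact ((Lp.memLp g).integrable (by norm_num)).bdd_smul c hq.aestronglyMeasurable
    (Eventually.of_forall hc)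

theorem continuous_integral_smul_L2 {q : ℝ → ℝ} (hq : Continuous q) (hc : HasCompactSupport q) :
    Continuous fun g : L2 E a b => ∫ x in Ioo a b, q x • g x := by
  obtain ⟨c, hcb⟩ := hq.bounded_above_of_compact_support hc
  have hq2 : MemLp q ∞ (volume.restrict (Ioo a b)) :=
    memLp_top_of_bound hq.aestronglyMeasurable c (Eventually.of_forall hcb)
  have hq3 : MemLp q 2 (volume.restrict (Ioo a b)) := hq2.mono_exponent le_top
  have hlip : LipschitzWith (eLpNorm q 2 (volume.restrict (Ioo a b))).toNNReal
      fun g : L2 E a b => ∫ x in Ioo a b, q x • g x := by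
    intro g h
    rw [edist_eq_enorm_sub, ← integral_sub (integrable_smul_L2 hq hc g) (integrable_smul_L2 hq hc h),
      ENNReal.coe_toNNReal hq3.eLpNorm_ne_top, Lp.edist_def]
    refine (enorm_integral_le_lintegral_enorm _).trans ?_
    rw [← eLpNorm_one_eq_lintegral_enorm]
    have := eLpNorm_smul_le_mul_eLpNorm (p := 2) (q := 2) (r := 1)
      ((Lp.aestronglyMeasurable g).sub (Lp.aestronglyMeasurable h)) hq3.aestronglyMeasurable
    refine le_trans (le_of_eq ?_) this
    congr 1
    ext x
    simp [smul_sub]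
  exact hlip.continuous

theorem IsTestFun.deriv_props {φ : ℝ → ℝ} (h : IsTestFun ℝ a b φ) :
    Continuous (deriv φ) ∧ HasCompactSupport (deriv φ) :=
  ⟨h.1.continuous_deriv (by simp), h.2.1.deriv⟩

/-- The tuples `(g, g', …, g^{(m)})` of an `L²` function and its weak derivatives in `L²`. -/
def sobolevSubmodule (E : Type*) [NormedAddCommGroup E] [NormedSpace ℝ E] (a b : ℝ) (m : ℕ) :
    Submodule ℝ (PiLp 2 fun _ : Fin (m + 1) => L2 E a b) where
  carrier := {w | ∀ i : Fin m, IsWeakDeriv (w i.castSucc) (w i.succ)}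
  zero_mem' := by
    intro i φ _
    have h1 : ∀ q : ℝ → ℝ, ∫ x in Ioo a b, q x • (0 : L2 E a b) x = 0 := fun q => by
      rw [integral_eq_zero_of_ae]
      filter_upwards [Lp.coeFn_zero E 2 (volume.restrict (Ioo a b))] with x hx
      rw [hx, Pi.zero_apply, smul_zero]
    rw [PiLp.zero_apply, PiLp.zero_apply, h1, h1, neg_zero]
  add_mem' := by
    intro v w hv hw i φ hφ
    have h1 : ∀ q : ℝ → ℝ, Continuous q → HasCompactSupport q → ∀ g h : L2 E a b,
        ∫ x in Ioo a b, q x • (g + h) x =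
          (∫ x in Ioo a b, q x • g x) + ∫ x in Ioo a b, q x • h x := by
      intro q hq hc g h
      rw [← integral_add (integrable_smul_L2 hq hc g) (integrable_smul_L2 hq hc h)]
      refine integral_congr_ae ?_
      filter_upwards [Lp.coeFn_add g h] with x hx
      rw [hx, Pi.add_apply, smul_add]
    rw [PiLp.add_apply, PiLp.add_apply, h1 _ hφ.deriv_props.1 hφ.deriv_props.2,
      h1 _ hφ.1.continuous hφ.2.1, hv i φ hφ, hw i φ hφ, neg_add]
  smul_mem' := by
    intro c w hw i φ hφ
    have h1 : ∀ q : ℝ → ℝ, ∀ g : L2 E a b,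
        ∫ x in Ioo a b, q x • (c • g) x = c • ∫ x in Ioo a b, q x • g x := by
      intro q g
      rw [← integral_smul]
      refine integral_congr_ae ?_
      filter_upwards [Lp.coeFn_smul c g] with x hx
      rw [hx, Pi.smul_apply, smul_comm]
    rw [PiLp.smul_apply, PiLp.smul_apply, h1, h1, hw i φ hφ, smul_neg]

/-- The Sobolev space `H^m((a,b), E)`. An element is stored together with its weak derivatives
(which it determines), and the norm is `(∑_{i ≤ m} ‖g^{(i)}‖²_{L²})^{1/2}`. -/
abbrev Sobolev (E : Type*) [NormedAddCommGroup E] [NormedSpace ℝ E] (a b : ℝ) (m : ℕ) : Type _ :=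
  sobolevSubmodule E a b m

instance [CompleteSpace E] (m : ℕ) : CompleteSpace (Sobolev E a b m) := by
  have hcl : IsClosed (sobolevSubmodule E a b m : Set (PiLp 2 fun _ : Fin (m + 1) => L2 E a b)) := by
    have : (sobolevSubmodule E a b m : Set (PiLp 2 fun _ : Fin (m + 1) => L2 E a b)) =
        ⋂ (i : Fin m) (φ : ℝ → ℝ) (_ : IsTestFun ℝ a b φ),
          {w | ∫ x in Ioo a b, deriv φ x • w i.castSucc x
            = -∫ x in Ioo a b, φ x • w i.succ x} := by
      ext w
      simp only [mem_iInter]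
      rfl
    rw [this]
    refine isClosed_iInter fun i => isClosed_iInter fun φ => isClosed_iInter fun hφ => ?_
    have h1 := (continuous_integral_smul_L2 (E := E) (a := a) (b := b)
      hφ.deriv_props.1 hφ.deriv_props.2).comp
        (PiLp.continuous_apply 2 (fun _ : Fin (m + 1) => L2 E a b) i.castSucc)
    have h2 := (continuous_integral_smul_L2 (E := E) (a := a) (b := b)
      hφ.1.continuous hφ.2.1).comp
        (PiLp.continuous_apply 2 (fun _ : Fin (m + 1) => L2 E a b) i.succ)
    exact isClosed_eq h1 h2.neg
  exact hcl.completeSpace_coe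

/-- The `i`-th weak derivative of an element of `H^m((a,b), E)`, for `i ≤ m`. -/
def Sobolev.der {m : ℕ} (w : Sobolev E a b m) (i : Fin (m + 1)) : L2 E a b := w.1 i

/-- The element of `L²((a,b), E)` underlying an element of `H^m((a,b), E)`. -/
def Sobolev.fn {m : ℕ} (w : Sobolev E a b m) : L2 E a b := w.der 0

/-- `H^m_0((a,b), E)`: the closure of `C_c^∞((a,b), E)` in `H^m((a,b), E)`. -/
def sobolevZero (E : Type*) [NormedAddCommGroup E] [NormedSpace ℝ E] (a b : ℝ) (m : ℕ) :
    Set (Sobolev E a b m) :=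
  closure {w | ∃ φ : ℝ → E, IsTestFun E a b φ ∧
    ∀ i : Fin (m + 1), w.der i =ᵐ[volume.restrict (Ioo a b)] iteratedDeriv i φ}

/-- The norm `‖u^{(m)}‖_{L²(a,b)}` used on `H^m_0((a,b), E)`. -/
def sobolevZeroNorm {m : ℕ} (w : Sobolev E a b m) : ℝ := ‖w.der (Fin.last m)‖

/-- The continuous representative on `[a,b]` of `g` vanishes at `a` and `b`. -/
def VanishesAtEnds (g : L2 E a b) : Prop :=
  ∃ h : ℝ → E, ContinuousOn h (Icc a b) ∧ g =ᵐ[volume.restrict (Ioo a b)] h ∧ h a = 0 ∧ h b = 0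

end Sobolev

/-! ### The space `H^m ∩ H^s_{(0)}(0,1)` -/

/-- Pairs consisting of an element of `H^m((0,1), ℂ)` and an element of `H^s_{(0)}(0,1)` with the
same underlying function. -/
def interSubmodule (m s : ℕ) : Submodule ℝ (Sobolev ℂ 0 1 m × HZero s) where
  carrier := {z | z.1.fn = z.2.toL2}
  zero_mem' := by
    show (0 : L2 ℂ 0 1) = HZero.toL2 0
    rw [map_zero]
  add_mem' := by
    intro y z hy hz
    show y.1.fn + z.1.fn = HZero.toL2 (y.2 + z.2)
    rw [map_add, ← hy, ← hz]
  smul_mem' := by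
    intro c z hz
    show c • z.1.fn = HZero.toL2 ((c : ℂ) • z.2)
    rw [map_smul, ← hz]
    rfl

/-- The space `H^m ∩ H^s_{(0)}(0,1)`, with the norm `max (‖g‖_{H^m}) (‖g‖_{H^s_{(0)}})`. -/
def InterSpace (m s : ℕ) : Type := interSubmodule m s

instance (m s : ℕ) : NormedAddCommGroup (InterSpace m s) :=
  inferInstanceAs (NormedAddCommGroup (interSubmodule m s))

instance (m s : ℕ) : NormedSpace ℝ (InterSpace m s) :=
  inferInstanceAs (NormedSpace ℝ (interSubmodule m s))

instance (m s : ℕ) : CompleteSpace (InterSpace m s) := by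
  have hcl : IsClosed (interSubmodule m s : Set (Sobolev ℂ 0 1 m × HZero s)) := by
    refine isClosed_eq (f := fun z : Sobolev ℂ 0 1 m × HZero s => z.1.fn)
      (g := fun z => z.2.toL2) ?_ ?_
    · exact (PiLp.continuous_apply 2 _ _).comp (continuous_subtype_val.comp continuous_fst)
    · have : Continuous (HZero.toL2 (s := s)) :=
        (HZero.toL2.mkContinuous 1 fun φ => by simpa using HZero.norm_toL2_le φ).continuous
      exact this.comp continuous_snd
  exact hcl.completeSpace_coe

/-- The element of `L²((0,1), ℂ)` underlying an element of `H^m ∩ H^s_{(0)}(0,1)`. -/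
def InterSpace.toL2 {m s : ℕ} (g : InterSpace m s) : L2 ℂ 0 1 := g.1.1.fn

/-! ### Mild solutions -/

/-- The norm `max_{n ≤ k} sup_{t ∈ [0,T]} ‖ψ^{(n)}(t)‖` of `C^k([0,T], Y)`, in `[0,∞]`. -/
def ckNorm {Y : Type*} [NormedAddCommGroup Y] [NormedSpace ℝ Y] (T : ℝ) (k : ℕ) (ψ : ℝ → Y) :
    ℝ≥0∞ :=
  ⨆ (n : ℕ) (_ : n ≤ k) (t : ℝ) (_ : t ∈ Icc 0 T), ‖iteratedDerivWithin n ψ (Icc 0 T) t‖ₑ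

/-- `ψ ∈ C^k([0,T], H^{2p+3}_{(0)})` and, for all `t ∈ [0,T]`,
`ψ(t) = e^{-iAt} ψ₀ + i ∫₀ᵗ e^{-iA(t-τ)} (u(τ) μ ψ(τ) + f(τ)) dτ`.
Here `F(τ) = u(τ) μ ψ(τ) + f(τ)`, as an integrable function of `τ` with values in `L²(0,1)`.
All terms are compared as elements of `L²(0,1)`; since `ψ(t)` and `e^{-iAt} ψ₀` lie in
`H^{2p+3}_{(0)}`, so does the integral, and the identity is one in `H^{2p+3}_{(0)}`.
The values of `ψ` outside `[0,T]` are irrelevant. -/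
structure IsMildSolution (T : ℝ) (p k : ℕ) {m s : ℕ} (μ : Sobolev ℝ 0 1 m) (u : Sobolev ℝ 0 T k)
    (f : Sobolev (InterSpace (2 * p + 3) (2 * p + 1)) 0 T k) (ψ₀ : HZero s)
    (ψ : ℝ → HZero (2 * p + 3)) : Prop where
  contDiffOn : ContDiffOn ℝ k ψ (Icc 0 T)
  duhamel : ∃ F : ℝ → L2 ℂ 0 1, IntervalIntegrable F volume 0 T ∧
    (∀ᵐ τ ∂(volume.restrict (Ioo 0 T)), F τ =ᵐ[volume.restrict (Ioo (0:ℝ) 1)] fun x =>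
      (u.fn τ : ℂ) * (μ.fn x : ℂ) * (ψ τ).toL2 x + (f.fn τ).toL2 x) ∧
    ∀ t ∈ Icc 0 T, (ψ t).toL2 = schrodingerGroup t ψ₀.toL2 +
      Complex.I • ∫ τ in (0:ℝ)..t, schrodingerGroup (t - τ) (F τ)

end BilinearSchrodinger
end

open BilinearSchrodinger

/-! The unknown of the fixed-point problem is not ψ but its last time derivative g = ∂_t^k ψ. Since
u and f vanish at t = 0 together with their time derivatives of order less than k, differentiating
the Duhamel formula k times leaves no boundary term of the source. Hence ψ^{(n)}(0) = (-iA)^n ψ₀ for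
n ≤ k, and g(t) = e^{-iAt} (-iA)^k ψ₀ + i ∫₀ᵗ e^{-iA(t-τ)} ∂_τ^k (u μ ψ + f)(τ) dτ, where ψ is the
k-fold primitive of g with these initial values. For continuous g the k-th derivative of the source
is square integrable in time with values in X = H^{2p+3} ∩ H^{2p+1}_{(0)}. Conversely
`coef_iterPrim_eq` undoes the differentiation, coefficient by coefficient.

Two facts about space make the right-hand side continuous with values in H^{2p+3}_{(0)}. First,
multiplication by μ is bounded from H^{2p+3}_{(0)} to X (`exists_mulCLM`): in the Leibniz formula
for an even derivative at an endpoint, each term contains an even derivative of the factor in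
H^{2p+3}_{(0)} or an odd derivative of μ, and both vanish there up to the order needed. Second, the
Duhamel integral gains what X lacks (`sum_sq_norm_duhamel_le`). Integrating by parts, (jπ)^{2p+3}
⟨F, φ_j⟩ is, up to sign, a cosine coefficient of ∂_x^{2p+3} F plus the boundary contribution √2
(F^{(2p+2)}(0) - (-1)^j F^{(2p+2)}(1)). The cosine part is square summable at each time by Bessel's
inequality in x. The boundary part does not decay in j at a fixed time, but its integrals against
e^{iλ_j τ} do: the numbers λ_i - λ_j are integer multiples of π², so these exponentials are
orthogonal over a common period and Bessel's inequality in time applies.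

The smoothing estimate bounds the squared norm of a Duhamel term by the integral of the squared norm
of the source. The fixed-point map is therefore of Volterra type with an integrable weight m
(`IsVolterra`), and it contracts by 3/4 in the norm sup_t e^{-∫₀ᵗ m} ‖·‖ on the whole interval,
without any smallness of T or u. This gives existence and, because the integral of m is controlled
by ‖u^{(k)}‖_{L²}, a bound uniform for ‖u‖_{H^k_0} < R. Uniqueness comes from the same argument
applied to the undifferentiated equation. -/

noncomputable section

namespace BilinearSchrodinger

/-! ### Calculus of absolutely continuous functions with values in a Banach space. -/

section Primitive

variable {E : Type*} [NormedAddCommGroup E] [NormedSpace ℝ E] {a b : ℝ}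

/-- On `[a,b]`, the function `G` is an indefinite integral of the integrable function `g`. -/
structure IsPrimitive (a b : ℝ) (G g : ℝ → E) : Prop where
  integrable : IntervalIntegrable g volume a b
  eq : ∀ x ∈ Icc a b, G x = G a + ∫ t in a..x, g t

omit [NormedSpace ℝ E] in
theorem intervalIntegrable_mono_Icc {g : ℝ → E} (h : IntervalIntegrable g volume a b)
    {c d : ℝ} (hc : c ∈ Icc a b) (hd : d ∈ Icc a b) : IntervalIntegrable g volume c d :=
  h.mono_set (uIcc_subset_uIcc (by rwa [uIcc_of_le (hc.1.trans hc.2)])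
    (by rwa [uIcc_of_le (hc.1.trans hc.2)]))

theorem IsPrimitive.sub_eq {G g : ℝ → E} (h : IsPrimitive a b G g) {c d : ℝ}
    (hc : c ∈ Icc a b) (hd : d ∈ Icc a b) : G d - G c = ∫ t in c..d, g t := by
  have ha : a ∈ Icc a b := ⟨le_rfl, hc.1.trans hc.2⟩
  rw [h.eq c hc, h.eq d hd, add_sub_add_left_eq_sub,
    intervalIntegral.integral_interval_sub_left (intervalIntegrable_mono_Icc h.integrable ha hd)
      (intervalIntegrable_mono_Icc h.integrable ha hc)]

/-- An increment of G is bounded in norm by the increment of the real primitive of ‖g‖, whose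
absolute continuity therefore passes to G. -/
theorem IsPrimitive.absolutelyContinuous {G g : ℝ → E} (h : IsPrimitive a b G g) (hab : a ≤ b) :
    AbsolutelyContinuousOnInterval G a b := by
  have hn := (IntervalIntegrable.absolutelyContinuousOnInterval_intervalIntegral
    h.integrable.norm (c := a) left_mem_uIcc)
  rw [absolutelyContinuousOnInterval_iff] at hn ⊢
  intro ε hε
  obtain ⟨δ, hδ, H⟩ := hn ε hε
  refine ⟨δ, hδ, fun S hS hlt => lt_of_le_of_lt (Finset.sum_le_sum fun i hi => ?_) (H S hS hlt)⟩
  have hm := hS.1 i hi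
  rw [uIcc_of_le hab] at hm
  have ha : a ∈ Icc a b := ⟨le_rfl, hab⟩
  rw [dist_comm, dist_eq_norm, h.sub_eq hm.1 hm.2, dist_comm, Real.dist_eq,
    intervalIntegral.integral_interval_sub_left
      (intervalIntegrable_mono_Icc h.integrable.norm ha hm.2)
      (intervalIntegrable_mono_Icc h.integrable.norm ha hm.1)]
  exact intervalIntegral.norm_integral_le_abs_integral_norm

theorem IsPrimitive.continuousOn {G g : ℝ → E} (h : IsPrimitive a b G g) (hab : a ≤ b) :
    ContinuousOn G (Icc a b) := by
  have := (h.absolutelyContinuous hab).continuousOn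
  rwa [uIcc_of_le hab] at this

theorem IsPrimitive.ae_hasDerivAt [CompleteSpace E] {G g : ℝ → E} (h : IsPrimitive a b G g)
    (hab : a ≤ b) : ∀ᵐ x, x ∈ Icc a b → HasDerivAt G (g x) x := by
  have h1 : ∀ᵐ x : ℝ, x ≠ a := by simp [ae_iff, measure_singleton]
  have h2 : ∀ᵐ x : ℝ, x ≠ b := by simp [ae_iff, measure_singleton]
  filter_upwards [h.integrable.ae_hasDerivAt_integral, h1, h2] with x hx hxa hxb hxm
  rw [uIcc_of_le hab] at hx
  have h3 := (hx hxm a ⟨le_rfl, hab⟩).const_add (G a)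
  refine h3.congr_of_eventuallyEq ?_
  filter_upwards [Icc_mem_nhds (lt_of_le_of_ne hxm.1 (Ne.symm hxa)) (lt_of_le_of_ne hxm.2 hxb)]
    with y hy using h.eq y hy

theorem IsPrimitive.of_integral {g : ℝ → E} (c : E) (h : IntervalIntegrable g volume a b) :
    IsPrimitive a b (fun x => c + ∫ t in a..x, g t) g :=
  ⟨h, fun x _ => by simp⟩

/-- The difference between G and the primitive of g is absolutely continuous with zero derivative
almost everywhere, hence constant. This is what turns the almost-everywhere product rule into an
integral identity. -/
theorem AbsolutelyContinuousOnInterval.isPrimitive [CompleteSpace E] {G g : ℝ → E} (hab : a ≤ b)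
    (hG : AbsolutelyContinuousOnInterval G a b) (hg : IntervalIntegrable g volume a b)
    (h : ∀ᵐ x, x ∈ Icc a b → HasDerivAt G (g x) x) : IsPrimitive a b G g := by
  refine ⟨hg, fun x hx => ?_⟩
  have hI : IsPrimitive a b (fun x => 0 + ∫ t in a..x, g t) g := IsPrimitive.of_integral 0 hg
  have hd := hG.sub (hI.absolutelyContinuous hab)
  obtain ⟨C, hC⟩ := hd.const_of_ae_hasDerivAt_zero (by
    filter_upwards [h, hI.ae_hasDerivAt hab] with y hy hy2 hym
    rw [uIcc_of_le hab] at hym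
    simpa using (hy hym).sub (hy2 hym))
  rw [uIcc_of_le hab] at hC
  have h1 := hC x hx
  have h2 := hC a ⟨le_rfl, hab⟩
  simp only [Pi.sub_apply, zero_add, intervalIntegral.integral_same, sub_zero] at h1 h2
  rw [h2, ← h1]; abel

theorem IsPrimitive.smul {𝕜 : Type*} [RCLike 𝕜] [NormedSpace 𝕜 E] [IsScalarTower ℝ 𝕜 E]
    [CompleteSpace E] {F f : ℝ → 𝕜} {G g : ℝ → E} (hab : a ≤ b)
    (hF : IsPrimitive a b F f) (hG : IsPrimitive a b G g) :
    IsPrimitive a b (fun x => F x • G x) (fun x => F x • g x + f x • G x) := by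
  refine AbsolutelyContinuousOnInterval.isPrimitive hab
    ((hF.absolutelyContinuous hab).smul (hG.absolutelyContinuous hab)) ?_ ?_
  · have h1 : ContinuousOn F (uIcc a b) := by rw [uIcc_of_le hab]; exact hF.continuousOn hab
    have h2 : ContinuousOn G (uIcc a b) := by rw [uIcc_of_le hab]; exact hG.continuousOn hab
    exact (hG.integrable.continuousOn_smul h1).add (hF.integrable.smul_continuousOn h2)
  · filter_upwards [hF.ae_hasDerivAt hab, hG.ae_hasDerivAt hab] with x h1 h2 hx
    exact (h1 hx).smul (h2 hx)

/-- Integration by parts: `IsPrimitive.smul` read at the right end. -/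
theorem IsPrimitive.integral_smul_eq {𝕜 : Type*} [RCLike 𝕜] [NormedSpace 𝕜 E] [IsScalarTower ℝ 𝕜 E]
    [CompleteSpace E] {F f : ℝ → 𝕜} {G g : ℝ → E} (hab : a ≤ b)
    (hF : IsPrimitive a b F f) (hG : IsPrimitive a b G g) :
    ∫ x in a..b, F x • g x = F b • G b - F a • G a - ∫ x in a..b, f x • G x := by
  have h := (hF.smul hab hG).eq b ⟨hab, le_rfl⟩
  have h1 : ContinuousOn F (uIcc a b) := by rw [uIcc_of_le hab]; exact hF.continuousOn hab
  have h2 : ContinuousOn G (uIcc a b) := by rw [uIcc_of_le hab]; exact hG.continuousOn hab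
  rw [intervalIntegral.integral_add (hG.integrable.continuousOn_smul h1)
    (hF.integrable.smul_continuousOn h2)] at h
  rw [h]; abel

theorem isPrimitive_of_hasDerivAt [CompleteSpace E] {G g : ℝ → E}
    (h : ∀ x, HasDerivAt G (g x) x) (hg : Continuous g) : IsPrimitive a b G g := by
  refine ⟨hg.intervalIntegrable _ _, fun x _ => ?_⟩
  rw [intervalIntegral.integral_eq_sub_of_hasDerivAt (fun y _ => h y) (hg.intervalIntegrable _ _)]
  abel

theorem IsPrimitive.clm_comp [CompleteSpace E] {E' : Type*} [NormedAddCommGroup E']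
    [NormedSpace ℝ E'] [CompleteSpace E']
    (L : E →L[ℝ] E') {G g : ℝ → E} (h : IsPrimitive a b G g) :
    IsPrimitive a b (fun x => L (G x)) (fun x => L (g x)) := by
  refine ⟨?_, fun x hx => ?_⟩
  · rw [intervalIntegrable_iff]
    exact L.integrable_comp (intervalIntegrable_iff.1 h.integrable)
  · have ha : a ∈ Icc a b := ⟨le_rfl, hx.1.trans hx.2⟩
    rw [L.intervalIntegral_comp_comm (intervalIntegrable_mono_Icc h.integrable ha hx),
      h.eq x hx, map_add]

theorem IsPrimitive.congr_ae {G g g' : ℝ → E} (h : IsPrimitive a b G g) (hab : a ≤ b)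
    (hg : g =ᵐ[volume.restrict (Ioo a b)] g') : IsPrimitive a b G g' := by
  have h1 : g =ᵐ[volume.restrict (Ioc a b)] g' := by
    rwa [restrict_Ioo_eq_restrict_Ioc] at hg
  refine ⟨h.integrable.congr_ae (by rwa [uIoc_of_le hab]), fun x hx => ?_⟩
  rw [h.eq x hx]
  congr 1
  refine intervalIntegral.integral_congr_ae ?_
  rw [EventuallyEq, ae_restrict_iff' measurableSet_Ioc] at h1
  filter_upwards [h1] with y hy hym
  rw [uIoc_of_le hx.1] at hym
  exact hy ⟨hym.1, hym.2.trans hx.2⟩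

theorem IsPrimitive.congr {G G' g : ℝ → E} (h : IsPrimitive a b G g) (hab : a ≤ b)
    (hG : EqOn G' G (Icc a b)) : IsPrimitive a b G' g :=
  ⟨h.integrable, fun x hx => by rw [hG hx, hG ⟨le_rfl, hab⟩, h.eq x hx]⟩

theorem IsPrimitive.add {F f G g : ℝ → E} (hF : IsPrimitive a b F f) (hG : IsPrimitive a b G g) :
    IsPrimitive a b (fun x => F x + G x) (fun x => f x + g x) := by
  refine ⟨hF.integrable.add hG.integrable, fun x hx => ?_⟩
  have ha : a ∈ Icc a b := ⟨le_rfl, hx.1.trans hx.2⟩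
  rw [intervalIntegral.integral_add (intervalIntegrable_mono_Icc hF.integrable ha hx)
    (intervalIntegrable_mono_Icc hG.integrable ha hx), hF.eq x hx, hG.eq x hx]
  abel

theorem IsPrimitive.zero : IsPrimitive a b (fun _ => (0 : E)) (fun _ => 0) :=
  ⟨by simp, fun x _ => by simp⟩

theorem IsPrimitive.sum {ι : Type*} (s : Finset ι) {G g : ι → ℝ → E}
    (h : ∀ i ∈ s, IsPrimitive a b (G i) (g i)) :
    IsPrimitive a b (fun x => ∑ i ∈ s, G i x) (fun x => ∑ i ∈ s, g i x) := by
  classical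
  induction s using Finset.induction_on with
  | empty => simpa using IsPrimitive.zero
  | insert i s hi ih =>
    simp only [Finset.sum_insert hi]
    exact (h i (Finset.mem_insert_self _ _)).add
      (ih fun k hk => h k (Finset.mem_insert_of_mem hk))

theorem IsPrimitive.const_smul (c : ℝ) {G g : ℝ → E} (h : IsPrimitive a b G g) :
    IsPrimitive a b (fun x => c • G x) (fun x => c • g x) := by
  refine ⟨h.integrable.smul c, fun x hx => ?_⟩
  rw [intervalIntegral.integral_smul, h.eq x hx, smul_add]

/-- On `[a,b]`, each `G i` with `i < m` is an indefinite integral of `G (i + 1)`. -/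
def IsJet (a b : ℝ) (m : ℕ) (G : ℕ → ℝ → E) : Prop :=
  ∀ i < m, IsPrimitive a b (G i) (G (i + 1))

/-- The sequence of derivatives of a product given by the Leibniz formula. -/
def leibnizProd {𝕜 : Type*} [SMul 𝕜 E] (F : ℕ → ℝ → 𝕜) (G : ℕ → ℝ → E) (n : ℕ) (x : ℝ) : E :=
  ∑ ij ∈ Finset.HasAntidiagonal.antidiagonal n, n.choose ij.1 • (F ij.1 x • G ij.2 x)

omit [NormedSpace ℝ E] in
-- Pascal's rule, arranged so that each summand of order n is replaced by its own derivative.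
theorem leibnizProd_succ {𝕜 : Type*} [SMul 𝕜 E] (F : ℕ → ℝ → 𝕜) (G : ℕ → ℝ → E) (n : ℕ) (x : ℝ) :
    leibnizProd F G (n + 1) x = ∑ ij ∈ Finset.HasAntidiagonal.antidiagonal n,
      n.choose ij.1 • (F ij.1 x • G (ij.2 + 1) x + F (ij.1 + 1) x • G ij.2 x) := by
  rw [leibnizProd, Finset.sum_antidiagonal_choose_succ_nsmul (fun i j => F i x • G j x)]
  simp only [nsmul_add, Finset.sum_add_distrib]
  congr 1
  refine Finset.sum_congr rfl fun ij hij => ?_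
  rw [Nat.choose_symm_of_eq_add (Finset.HasAntidiagonal.mem_antidiagonal.1 hij).symm]

theorem IsJet.leibnizProd {𝕜 : Type*} [RCLike 𝕜] [NormedSpace 𝕜 E] [IsScalarTower ℝ 𝕜 E]
    [CompleteSpace E] {m : ℕ} {F : ℕ → ℝ → 𝕜} {G : ℕ → ℝ → E} (hab : a ≤ b)
    (hF : IsJet a b m F) (hG : IsJet a b m G) : IsJet a b m (leibnizProd F G) := by
  intro n hn
  rw [funext (leibnizProd_succ F G n)]
  have := IsPrimitive.sum (Finset.HasAntidiagonal.antidiagonal n)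
    (G := fun ij x => (n.choose ij.1 : ℝ) • (F ij.1 x • G ij.2 x))
    (g := fun ij x => (n.choose ij.1 : ℝ) • (F ij.1 x • G (ij.2 + 1) x + F (ij.1 + 1) x • G ij.2 x))
    fun ij hij => by
      have := Finset.HasAntidiagonal.mem_antidiagonal.1 hij
      exact ((hF ij.1 (by omega)).smul hab (hG ij.2 (by omega))).const_smul _
  simp only [Nat.cast_smul_eq_nsmul] at this
  exact this

end Primitive

/-! ### Weak derivatives on an interval and indefinite integrals. -/

section Weak

variable {E : Type*} [NormedAddCommGroup E] [NormedSpace ℝ E] {a b : ℝ}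

theorem integral_Ioo_eq_interval (hab : a ≤ b) (g : ℝ → E) :
    ∫ x in Ioo a b, g x = ∫ x in a..b, g x := by
  rw [intervalIntegral.integral_of_le hab, integral_Ioc_eq_integral_Ioo]

omit [NormedSpace ℝ E] in
theorem intervalIntegrable_of_integrable_Ioo (hab : a ≤ b) {g : ℝ → E}
    (h : Integrable g (volume.restrict (Ioo a b))) : IntervalIntegrable g volume a b :=
  (intervalIntegrable_iff_integrableOn_Ioo_of_le hab).2 h

omit [NormedSpace ℝ E] in
theorem L2.intervalIntegrable (hab : a ≤ b) (g : L2 E a b) : IntervalIntegrable g volume a b :=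
  intervalIntegrable_of_integrable_Ioo hab ((Lp.memLp g).integrable (by norm_num))

theorem IsTestFun.isPrimitive [CompleteSpace E] {φ : ℝ → E} (h : IsTestFun E a b φ) :
    IsPrimitive a b φ (deriv φ) :=
  isPrimitive_of_hasDerivAt
    (fun x => (h.1.differentiable (by simp)).differentiableAt.hasDerivAt)
    (h.1.continuous_deriv (by simp))

theorem IsTestFun.eq_zero {φ : ℝ → E} (h : IsTestFun E a b φ) {x : ℝ} (hx : x ∉ Ioo a b) :
    φ x = 0 :=
  image_eq_zero_of_notMem_tsupport fun hx' => hx (h.2.2 hx')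

theorem IsPrimitive.integral_deriv_smul [CompleteSpace E] (hab : a ≤ b) {G g : ℝ → E}
    (hG : IsPrimitive a b G g) {φ : ℝ → ℝ} (hφ : IsTestFun ℝ a b φ) :
    ∫ x in Ioo a b, deriv φ x • G x = -∫ x in Ioo a b, φ x • g x := by
  rw [integral_Ioo_eq_interval hab, integral_Ioo_eq_interval hab,
    hφ.isPrimitive.integral_smul_eq hab hG, hφ.eq_zero (fun h => lt_irrefl _ h.1),
    hφ.eq_zero (fun h => lt_irrefl _ h.2)]
  simp

/-- A function with primitive relation in `L²` satisfies the weak derivative relation. -/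
theorem IsPrimitive.isWeakDeriv [CompleteSpace E] (hab : a ≤ b) {G g : ℝ → E}
    (hG : IsPrimitive a b G g) {v w : L2 E a b} (hv : v =ᵐ[volume.restrict (Ioo a b)] G)
    (hw : w =ᵐ[volume.restrict (Ioo a b)] g) : IsWeakDeriv v w := by
  intro φ hφ
  have h := hG.integral_deriv_smul hab hφ
  rw [integral_congr_ae (g := fun x => deriv φ x • G x), h,
    integral_congr_ae (f := fun x => φ x • w x) (g := fun x => φ x • g x)]
  · filter_upwards [hw] with x hx; rw [hx]
  · filter_upwards [hv] with x hx; rw [hx]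

theorem exists_isTestFun_integral_eq_one (hab : a < b) :
    ∃ η : ℝ → ℝ, IsTestFun ℝ a b η ∧ ∫ x in a..b, η x = 1 := by
  let f : ContDiffBump ((a + b) / 2) := ⟨(b - a) / 8, (b - a) / 4, by linarith, by linarith⟩
  have hs : tsupport (f.normed volume) ⊆ Ioo a b := by
    rw [f.tsupport_normed_eq]
    intro x hx
    rw [Metric.mem_closedBall, Real.dist_eq, abs_le] at hx
    have : f.rOut = (b - a) / 4 := rfl
    constructor <;> linarith [hx.1, hx.2]
  refine ⟨f.normed volume, ⟨f.contDiff_normed, f.hasCompactSupport_normed, hs⟩, ?_⟩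
  rw [← integral_Ioo_eq_interval hab.le, setIntegral_eq_integral_of_forall_compl_eq_zero]
  · exact f.integral_normed
  · intro x hx
    exact image_eq_zero_of_notMem_tsupport fun hx' => hx (hs hx')

/-- The zero mean makes the primitive vanish to the right of the support of φ as well as to its
left, so it lives between the extreme points c and d of that support. -/
theorem IsTestFun.integral_isTestFun {φ : ℝ → ℝ} (h : IsTestFun ℝ a b φ)
    (h0 : ∫ x in a..b, φ x = 0) :
    IsTestFun ℝ a b (fun x => ∫ t in a..x, φ t) ∧ deriv (fun x => ∫ t in a..x, φ t) = φ := by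
  have hd : ∀ x, HasDerivAt (fun x => ∫ t in a..x, φ t) (φ x) x := fun x =>
    intervalIntegral.integral_hasDerivAt_right (h.1.continuous.intervalIntegrable _ _)
      (h.1.continuous.stronglyMeasurableAtFilter _ _) h.1.continuous.continuousAt
  have hd' : deriv (fun x => ∫ t in a..x, φ t) = φ := funext fun x => (hd x).deriv
  refine ⟨⟨contDiff_infty_iff_deriv.2 ⟨fun x => (hd x).differentiableAt, by rw [hd']; exact h.1⟩,
    ?_⟩, hd'⟩
  rcases (tsupport φ).eq_empty_or_nonempty with he | hne
  · have : φ = 0 := by rwa [tsupport_eq_empty_iff] at he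
    subst this
    have : (fun x => ∫ t in a..x, (0 : ℝ → ℝ) t) = 0 := by ext x; simp
    rw [this]
    exact ⟨HasCompactSupport.zero, by simp⟩
  obtain ⟨c, hc, hcm⟩ := h.2.1.exists_isLeast hne
  obtain ⟨d, hd, hdm⟩ := h.2.1.exists_isGreatest hne
  have hz : ∀ x, x ∉ Icc c d → φ x = 0 := fun x hx =>
    image_eq_zero_of_notMem_tsupport fun hx' => hx ⟨hcm hx', hdm hx'⟩
  have hsub : Function.support (fun x => ∫ t in a..x, φ t) ⊆ Icc c d := by
    intro x hx
    by_contra hxm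
    refine hx ?_
    have hca := (h.2.2 hc).1
    have hdb := (h.2.2 hd).2
    rcases lt_or_ge x c with hlt | hge
    · refine (intervalIntegral.integral_congr (g := fun _ => (0:ℝ)) fun t ht => ?_).trans (by simp)
      refine hz t fun htm => ?_
      have := (ordConnected_Iio.uIcc_subset (mem_Iio.2 hca) (mem_Iio.2 hlt) : uIcc a x ⊆ Iio c) ht
      exact absurd htm.1 (not_le.2 this)
    · have hlt : d < x := by
        by_contra hh; exact hxm ⟨hge, not_lt.1 hh⟩
      show ∫ t in a..x, φ t = 0
      rw [← intervalIntegral.integral_add_adjacent_intervals (b := b)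
        (h.1.continuous.intervalIntegrable _ _) (h.1.continuous.intervalIntegrable _ _), h0, zero_add]
      refine (intervalIntegral.integral_congr (g := fun _ => (0:ℝ)) fun t ht => ?_).trans (by simp)
      refine hz t fun htm => ?_
      have := (ordConnected_Ioi.uIcc_subset (mem_Ioi.2 hdb) (mem_Ioi.2 hlt) : uIcc b x ⊆ Ioi d) ht
      exact absurd htm.2 (not_le.2 this)
  have hts : tsupport (fun x => ∫ t in a..x, φ t) ⊆ Icc c d := closure_minimal hsub isClosed_Icc
  exact ⟨HasCompactSupport.of_support_subset_isCompact isCompact_Icc hsub,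
    hts.trans (Icc_subset_Ioo (h.2.2 hc).1 (h.2.2 hd).2)⟩

/-- A weakly differentiable function on an interval is an indefinite integral of its weak
derivative. -/
theorem IsWeakDeriv.exists_eq_integral [CompleteSpace E] (hab : a < b) {g g' : L2 E a b}
    (h : IsWeakDeriv g g') :
    ∃ c : E, g =ᵐ[volume.restrict (Ioo a b)] fun x => c + ∫ t in a..x, g' t := by
  have hP : IsPrimitive a b (fun x => (0 : E) + ∫ t in a..x, g' t) g' :=
    IsPrimitive.of_integral 0 (L2.intervalIntegrable hab.le g')
  set P : ℝ → E := fun x => (0 : E) + ∫ t in a..x, g' t with hPdef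
  have hPi : Integrable P (volume.restrict (Ioo a b)) :=
    ((hP.continuousOn hab.le).integrableOn_Icc).mono_set Ioo_subset_Icc_self
  have hgi : Integrable g (volume.restrict (Ioo a b)) := (Lp.memLp g).integrable (by norm_num)
  -- The argument of du Bois-Reymond: r has zero weak derivative, and it is to be shown constant.
  set r : ℝ → E := fun x => g x - P x with hr
  have hri : Integrable r (volume.restrict (Ioo a b)) := hgi.sub hPi
  have hbd : ∀ q : ℝ → ℝ, Continuous q → HasCompactSupport q → ∀ v : ℝ → E,
      Integrable v (volume.restrict (Ioo a b)) →
      Integrable (fun x => q x • v x) (volume.restrict (Ioo a b)) := by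
    intro q hq hc v hv
    obtain ⟨C, hC⟩ := hq.bounded_above_of_compact_support hc
    exact hv.bdd_smul C hq.aestronglyMeasurable (Eventually.of_forall hC)
  have h0 : ∀ φ, IsTestFun ℝ a b φ → ∫ x in Ioo a b, deriv φ x • r x = 0 := by
    intro φ hφ
    simp only [hr, smul_sub]
    rw [integral_sub (hbd _ hφ.deriv_props.1 hφ.deriv_props.2 _ hgi)
      (hbd _ hφ.deriv_props.1 hφ.deriv_props.2 _ hPi), h φ hφ, hP.integral_deriv_smul hab.le hφ,
      sub_self]
  obtain ⟨η, hη, hη1⟩ := exists_isTestFun_integral_eq_one hab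
  set c : E := ∫ x in Ioo a b, η x • r x with hc
  have hae := isOpen_Ioo.ae_eq_zero_of_integral_contDiff_smul_eq_zero
    (U := Ioo a b) (f := fun x => r x - c) (μ := volume.restrict (Ioo a b))
    ((hri.sub (integrable_const c)).locallyIntegrable.locallyIntegrableOn _) (by
      intro φ hφ hφc hφs
      set I : ℝ := ∫ x in a..b, φ x with hI
      -- Since η has integral 1, this function has zero mean. It is then the derivative of a test
      -- function, so its integral against r vanishes, and ∫ φ r = I c.
      have ht : IsTestFun ℝ a b (fun x => φ x - I * η x) := by
        refine ⟨hφ.sub (contDiff_const.mul hη.1), hφc.sub (hη.2.1.mul_left), ?_⟩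
        refine (tsupport_sub _ _).trans (union_subset hφs ?_)
        exact (tsupport_mul_subset_right).trans hη.2.2
      have hti : ∫ x in a..b, (φ x - I * η x) = 0 := by
        rw [intervalIntegral.integral_sub (hφ.continuous.intervalIntegrable _ _)
          ((hη.1.continuous.intervalIntegrable _ _).const_mul _),
          intervalIntegral.integral_const_mul, hη1, mul_one, ← hI, sub_self]
      obtain ⟨h1, h2⟩ := ht.integral_isTestFun hti
      have h3 := h0 _ h1
      rw [h2] at h3
      simp only [sub_smul, mul_smul] at h3
      have e1 := hbd _ hφ.continuous hφc _ hri
      have e2 := hbd _ hη.1.continuous hη.2.1 _ hri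
      have e3 : Integrable (fun x => I • η x • r x) (volume.restrict (Ioo a b)) := e2.smul I
      rw [integral_sub e1 e3, integral_smul, ← hc] at h3
      simp only [smul_sub]
      rw [integral_sub e1 (hbd _ hφ.continuous hφc _ (integrable_const c)), integral_smul_const,
        integral_Ioo_eq_interval hab.le φ, ← hI, h3])
  refine ⟨c, ?_⟩
  filter_upwards [hae, self_mem_ae_restrict measurableSet_Ioo] with x hx hx1
  have := hx hx1
  simp only [hr, hPdef, zero_add] at this
  rw [sub_sub, sub_eq_zero] at this
  rw [this, add_comm]

end Weak

/-! ### Absolutely continuous representatives of Sobolev functions, and traces. -/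

section Jets

variable {E : Type*} [NormedAddCommGroup E] [NormedSpace ℝ E] {a b : ℝ}

theorem integrable_smul_L2_of_memLp {q : ℝ → ℝ} (hq : MemLp q 2 (volume.restrict (Ioo a b)))
    (g : L2 E a b) : Integrable (fun x => q x • g x) (volume.restrict (Ioo a b)) :=
  memLp_one_iff_integrable.1 ((Lp.memLp g).smul (r := 1) hq)

/-- The functional `g ↦ ∫ q g` on `L²((a,b), E)` for `q ∈ L²(a,b)`. -/
def integralSMul (E : Type*) [NormedAddCommGroup E] [NormedSpace ℝ E] {q : ℝ → ℝ}
    (hq : MemLp q 2 (volume.restrict (Ioo a b))) : L2 E a b →L[ℝ] E :=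
  LinearMap.mkContinuous
    { toFun := fun g => ∫ x in Ioo a b, q x • g x
      map_add' := fun g h => by
        rw [← integral_add (integrable_smul_L2_of_memLp hq g) (integrable_smul_L2_of_memLp hq h)]
        refine integral_congr_ae ?_
        filter_upwards [Lp.coeFn_add g h] with x hx
        rw [hx, Pi.add_apply, smul_add]
      map_smul' := fun c g => by
        rw [RingHom.id_apply, ← integral_smul]
        refine integral_congr_ae ?_
        filter_upwards [Lp.coeFn_smul c g] with x hx
        rw [hx, Pi.smul_apply, smul_comm] }
    (eLpNorm q 2 (volume.restrict (Ioo a b))).toReal fun g => by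
      show ‖∫ x in Ioo a b, q x • g x‖ ≤ _
      have h1 : ‖∫ x in Ioo a b, q x • g x‖ₑ ≤
          eLpNorm q 2 (volume.restrict (Ioo a b)) * eLpNorm g 2 (volume.restrict (Ioo a b)) := by
        refine (enorm_integral_le_lintegral_enorm _).trans ?_
        rw [← eLpNorm_one_eq_lintegral_enorm]
        exact eLpNorm_smul_le_mul_eLpNorm (p := 2) (q := 2) (r := 1)
          (Lp.aestronglyMeasurable g) hq.aestronglyMeasurable
      rw [Lp.norm_def, ← ENNReal.toReal_mul, ← toReal_enorm]
      exact ENNReal.toReal_mono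
        (ENNReal.mul_ne_top hq.eLpNorm_ne_top (Lp.memLp g).eLpNorm_ne_top) h1

theorem integralSMul_apply {q : ℝ → ℝ} (hq : MemLp q 2 (volume.restrict (Ioo a b)))
    (g : L2 E a b) : integralSMul E hq g = ∫ x in Ioo a b, q x • g x := rfl

omit [NormedSpace ℝ E] in
theorem memLp_Ioo_of_continuousOn {q : ℝ → E} (hq : ContinuousOn q (Icc a b)) (r : ℝ≥0∞) :
    MemLp q r (volume.restrict (Ioo a b)) := by
  obtain ⟨C, hC⟩ := isCompact_Icc.exists_bound_of_continuousOn hq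
  refine MemLp.of_bound ?_ C ?_
  · exact (hq.mono Ioo_subset_Icc_self).aestronglyMeasurable measurableSet_Ioo
  · filter_upwards [self_mem_ae_restrict measurableSet_Ioo] with x hx
    exact hC x (Ioo_subset_Icc_self hx)

theorem Sobolev.isWeakDeriv {m : ℕ} (w : Sobolev E a b m) (i : ℕ) (hi : i < m) :
    IsWeakDeriv (w.der ⟨i, by omega⟩) (w.der ⟨i + 1, by omega⟩) :=
  w.2 ⟨i, hi⟩

/-- `G` is a jet of absolutely continuous representatives of `w` and its derivatives. -/
structure IsRepJet {m : ℕ} (w : Sobolev E a b m) (G : ℕ → ℝ → E) : Prop where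
  jet : IsJet a b m G
  ae_eq : ∀ (i : ℕ) (hi : i < m + 1), w.der ⟨i, hi⟩ =ᵐ[volume.restrict (Ioo a b)] G i

theorem Sobolev.exists_isRepJet [CompleteSpace E] (hab : a < b) {m : ℕ} (w : Sobolev E a b m) :
    ∃ G : ℕ → ℝ → E, IsRepJet w G := by
  have h : ∀ i : ℕ, ∃ g : ℝ → E, (∀ hi : i < m + 1,
      w.der ⟨i, hi⟩ =ᵐ[volume.restrict (Ioo a b)] g) ∧
      ∀ hi : i < m, IsPrimitive a b g (w.der ⟨i + 1, by omega⟩) := by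
    intro i
    by_cases hi : i < m
    · obtain ⟨c, hc⟩ := (w.isWeakDeriv i hi).exists_eq_integral hab
      exact ⟨_, fun _ => hc, fun _ => IsPrimitive.of_integral c (L2.intervalIntegrable hab.le _)⟩
    · by_cases hi' : i < m + 1
      · exact ⟨w.der ⟨i, hi'⟩, fun _ => EventuallyEq.rfl, fun h => absurd h hi⟩
      · exact ⟨0, fun h => absurd h hi', fun h => absurd h hi⟩
  choose G hG1 hG2 using h
  exact ⟨G, fun i hi => (hG2 i hi).congr_ae hab.le (hG1 (i + 1) (by omega)), hG1⟩

theorem exists_sobolev_of_isJet [CompleteSpace E] (hab : a ≤ b) {m : ℕ} {G : ℕ → ℝ → E}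
    (hG : IsJet a b m G) (hm : MemLp (G m) 2 (volume.restrict (Ioo a b))) :
    ∃ w : Sobolev E a b m, IsRepJet w G := by
  have hmem : ∀ i : ℕ, i < m + 1 → MemLp (G i) 2 (volume.restrict (Ioo a b)) := by
    intro i hi
    rcases Nat.lt_succ_iff_lt_or_eq.1 hi with h | rfl
    · exact memLp_Ioo_of_continuousOn ((hG i h).continuousOn hab) 2
    · exact hm
  let v : PiLp 2 fun _ : Fin (m + 1) => L2 E a b :=
    WithLp.toLp 2 fun i => (hmem i i.2).toLp (G i)
  have hv : ∀ i : Fin (m + 1), v i =ᵐ[volume.restrict (Ioo a b)] G i :=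
    fun i => (hmem i i.2).coeFn_toLp
  exact ⟨⟨v, fun i => (hG i i.2).isWeakDeriv hab (hv i.castSucc) (hv i.succ)⟩, hG,
    fun i hi => hv ⟨i, hi⟩⟩

theorem IsRepJet.continuousOn {m : ℕ} {w : Sobolev E a b m} {G : ℕ → ℝ → E} (h : IsRepJet w G)
    (hab : a ≤ b) {i : ℕ} (hi : i < m) : ContinuousOn (G i) (Icc a b) :=
  (h.jet i hi).continuousOn hab

theorem IsRepJet.memLp {m : ℕ} {w : Sobolev E a b m} {G : ℕ → ℝ → E} (h : IsRepJet w G)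
    {i : ℕ} (hi : i < m + 1) : MemLp (G i) 2 (volume.restrict (Ioo a b)) :=
  (memLp_congr_ae (h.ae_eq i hi)).1 (Lp.memLp _)

omit [NormedSpace ℝ E] in
theorem eqOn_Icc_of_ae_eq_Ioo (hab : a < b) {g h : ℝ → E} (hg : ContinuousOn g (Icc a b))
    (hh : ContinuousOn h (Icc a b)) (he : g =ᵐ[volume.restrict (Ioo a b)] h) :
    EqOn g h (Icc a b) := by
  rw [restrict_Ioo_eq_restrict_Icc] at he
  exact Measure.eqOn_Icc_of_ae_eq volume hab.ne he hg hh

-- Continuous functions on [a,b] that agree almost everywhere agree at the ends too, so the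
-- condition can be read on any continuous representative.
omit [NormedSpace ℝ E] in
theorem VanishesAtEnds.eq_zero {g : L2 E a b} (hv : VanishesAtEnds g) (hab : a < b) {h : ℝ → E}
    (hh : ContinuousOn h (Icc a b)) (he : g =ᵐ[volume.restrict (Ioo a b)] h) :
    h a = 0 ∧ h b = 0 := by
  obtain ⟨h', hc, he', ha, hb⟩ := hv
  have := eqOn_Icc_of_ae_eq_Ioo hab hh hc (he.symm.trans he')
  rw [this ⟨le_rfl, hab.le⟩, this ⟨hab.le, le_rfl⟩]
  exact ⟨ha, hb⟩

theorem memLp_const_sub (a b c : ℝ) : MemLp (fun x : ℝ => c - x) 2 (volume.restrict (Ioo a b)) :=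
  memLp_Ioo_of_continuousOn (by fun_prop) 2

theorem memLp_one_Ioo (a b : ℝ) : MemLp (fun _ : ℝ => (1 : ℝ)) 2 (volume.restrict (Ioo a b)) :=
  memLp_const 1

/-- The value at the left end of a primitive, from the `L²` classes. -/
theorem IsPrimitive.smul_left_end [CompleteSpace E] (hab : a ≤ b) {G g : ℝ → E}
    (h : IsPrimitive a b G g) {v w : L2 E a b} (hv : v =ᵐ[volume.restrict (Ioo a b)] G)
    (hw : w =ᵐ[volume.restrict (Ioo a b)] g) :
    integralSMul E (memLp_one_Ioo a b) v - integralSMul E (memLp_const_sub a b b) w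
      = (b - a) • G a := by
  -- Integrating by parts against b - x, which vanishes at b, isolates the value at a. The trace
  -- thus becomes a bounded functional of the two L² classes.
  have hF : IsPrimitive a b (fun x => b - x) (fun _ => (-1 : ℝ)) :=
    isPrimitive_of_hasDerivAt (fun x => by simpa using (hasDerivAt_id x).const_sub b)
      continuous_const
  have e := hF.integral_smul_eq hab h
  rw [integralSMul_apply, integralSMul_apply,
    integral_congr_ae (f := fun x => (1 : ℝ) • v x) (g := G)
      (by filter_upwards [hv] with x hx; simp [hx]),
    integral_congr_ae (f := fun x => (b - x) • w x) (g := fun x => (b - x) • g x)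
      (by filter_upwards [hw] with x hx; simp [hx]),
    integral_Ioo_eq_interval hab, integral_Ioo_eq_interval hab, e]
  simp

/-- The value at the right end of a primitive, from the `L²` classes. -/
theorem IsPrimitive.smul_right_end [CompleteSpace E] (hab : a ≤ b) {G g : ℝ → E}
    (h : IsPrimitive a b G g) {v w : L2 E a b} (hv : v =ᵐ[volume.restrict (Ioo a b)] G)
    (hw : w =ᵐ[volume.restrict (Ioo a b)] g) :
    integralSMul E (memLp_one_Ioo a b) v - integralSMul E (memLp_const_sub a b a) w
      = (b - a) • G b := by
  have hF : IsPrimitive a b (fun x => a - x) (fun _ => (-1 : ℝ)) :=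
    isPrimitive_of_hasDerivAt (fun x => by simpa using (hasDerivAt_id x).const_sub a)
      continuous_const
  have e := hF.integral_smul_eq hab h
  rw [integralSMul_apply, integralSMul_apply,
    integral_congr_ae (f := fun x => (1 : ℝ) • v x) (g := G)
      (by filter_upwards [hv] with x hx; simp [hx]),
    integral_congr_ae (f := fun x => (a - x) • w x) (g := fun x => (a - x) • g x)
      (by filter_upwards [hw] with x hx; simp [hx]),
    integral_Ioo_eq_interval hab, integral_Ioo_eq_interval hab, e]
  simp [sub_smul]

theorem Sobolev.continuous_der (m : ℕ) (i : Fin (m + 1)) :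
    Continuous fun w : Sobolev E a b m => w.der i :=
  (PiLp.continuous_apply 2 _ _).comp continuous_subtype_val

theorem IsTestFun.iteratedDeriv {φ : ℝ → E} (h : IsTestFun E a b φ) (n : ℕ) :
    IsTestFun E a b (iteratedDeriv n φ) := by
  induction n with
  | zero => simpa using h
  | succ n ih =>
    rw [iteratedDeriv_succ]
    exact ⟨(contDiff_infty_iff_deriv.1 ih.1).2, ih.2.1.deriv,
      (tsupport_deriv_subset (𝕜 := ℝ)).trans ih.2.2⟩

/-- By `IsPrimitive.smul_left_end` a multiple of the trace at a is a continuous functional on H^m.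
It vanishes on test functions, hence on their closure. -/
theorem IsRepJet.left_end_eq_zero [CompleteSpace E] (hab : a < b) {m : ℕ} {w : Sobolev E a b m}
    (hw : w ∈ sobolevZero E a b m) {G : ℕ → ℝ → E} (hG : IsRepJet w G) {i : ℕ} (hi : i < m) :
    G i a = 0 := by
  let Λ : Sobolev E a b m → E := fun w =>
    integralSMul E (memLp_one_Ioo a b) (w.der ⟨i, by omega⟩)
      - integralSMul E (memLp_const_sub a b b) (w.der ⟨i + 1, by omega⟩)
  have hΛ : Continuous Λ :=
    ((integralSMul E (memLp_one_Ioo a b)).continuous.comp (Sobolev.continuous_der m _)).sub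
      ((integralSMul E (memLp_const_sub a b b)).continuous.comp (Sobolev.continuous_der m _))
  have h0 : Λ w = 0 := by
    refine closure_minimal (s := {w : Sobolev E a b m | ∃ φ : ℝ → E, IsTestFun E a b φ ∧
      ∀ i : Fin (m + 1), w.der i =ᵐ[volume.restrict (Ioo a b)] iteratedDeriv i φ})
      (t := {w | Λ w = 0}) ?_ (isClosed_eq hΛ continuous_const) hw
    rintro v ⟨φ, hφ, hv⟩
    have hp : IsPrimitive a b (_root_.iteratedDeriv i φ) (_root_.iteratedDeriv (i + 1) φ) := by
      rw [iteratedDeriv_succ]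
      exact (hφ.iteratedDeriv i).isPrimitive
    refine (hp.smul_left_end hab.le (hv ⟨i, by omega⟩) (hv ⟨i + 1, by omega⟩)).trans ?_
    rw [(hφ.iteratedDeriv i).eq_zero (fun h => lt_irrefl _ h.1), smul_zero]
  have := (hG.jet i hi).smul_left_end hab.le (hG.ae_eq i (by omega)) (hG.ae_eq (i + 1) (by omega))
  have h1 : (b - a) • G i a = 0 := this.symm.trans h0
  exact (smul_eq_zero.1 h1).resolve_left (sub_pos.2 hab).ne'

end Jets

/-! ### Sine and cosine coefficients, and what their decay says about boundary values. -/

section Trig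

/-- The function `x ↦ √2 sin(jπx + rπ/2)`. -/
def trigFun (r : ℕ) (j : ℕ+) (x : ℝ) : ℝ :=
  Real.sqrt 2 * Real.sin (j * Real.pi * x + r * (Real.pi / 2))

theorem continuous_trigFun (r : ℕ) (j : ℕ+) : Continuous (trigFun r j) := by
  unfold trigFun; fun_prop

theorem hasDerivAt_trigFun (r : ℕ) (j : ℕ+) (x : ℝ) :
    HasDerivAt (trigFun r j) (j * Real.pi * trigFun (r + 1) j x) x := by
  have h1 : HasDerivAt (fun x : ℝ => j * Real.pi * x + r * (Real.pi / 2)) (j * Real.pi) x := by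
    simpa using ((hasDerivAt_id x).const_mul (j * Real.pi)).add_const (r * (Real.pi / 2))
  have h2 := (h1.sin).const_mul (Real.sqrt 2)
  refine h2.congr_deriv ?_
  have : (j : ℝ) * Real.pi * x + ((r + 1 : ℕ) : ℝ) * (Real.pi / 2) =
      j * Real.pi * x + r * (Real.pi / 2) + Real.pi / 2 := by push_cast; ring
  rw [trigFun, this, Real.sin_add_pi_div_two]
  ring

theorem trigFun_add_two (r : ℕ) (j : ℕ+) (x : ℝ) : trigFun (r + 2) j x = -trigFun r j x := by
  have : (j : ℝ) * Real.pi * x + ((r + 2 : ℕ) : ℝ) * (Real.pi / 2) =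
      j * Real.pi * x + r * (Real.pi / 2) + Real.pi := by push_cast; ring
  rw [trigFun, trigFun, this, Real.sin_add_pi]
  ring

theorem sineFun_eq (j : ℕ+) (x : ℝ) : sineFun j x = (trigFun 0 j x : ℂ) := by
  simp [sineFun, trigFun]

theorem trigFun_zero_left (j : ℕ+) : trigFun 0 j 0 = 0 := by simp [trigFun]

theorem trigFun_zero_right (j : ℕ+) : trigFun 0 j 1 = 0 := by simp [trigFun]

theorem trigFun_one_left (j : ℕ+) : trigFun 1 j 0 = Real.sqrt 2 := by simp [trigFun]

theorem trigFun_one_right (j : ℕ+) : trigFun 1 j 1 = Real.sqrt 2 * (-1) ^ (j : ℕ) := by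
  simp [trigFun, Real.sin_add_pi_div_two, Real.cos_nat_mul_pi]

theorem memLp_trigFun (r : ℕ) (j : ℕ+) :
    MemLp (fun x => (trigFun r j x : ℂ)) 2 (volume.restrict (Ioo (0:ℝ) 1)) :=
  memLp_Ioo_of_continuousOn
    (Complex.continuous_ofReal.comp (continuous_trigFun r j)).continuousOn 2

/-- The function `√2 sin(jπx + rπ/2)` as an element of `L²((0,1), ℂ)`. -/
def trigVec (r : ℕ) (j : ℕ+) : L2 ℂ 0 1 := (memLp_trigFun r j).toLp _

theorem trigVec_ae_eq (r : ℕ) (j : ℕ+) :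
    trigVec r j =ᵐ[volume.restrict (Ioo (0:ℝ) 1)] fun x => (trigFun r j x : ℂ) :=
  (memLp_trigFun r j).coeFn_toLp

theorem trigVec_zero (j : ℕ+) : trigVec 0 j = eigVec j := by
  refine Lp.ext ?_
  refine (trigVec_ae_eq 0 j).trans (EventuallyEq.trans ?_ (memLp_sineFun j).coeFn_toLp.symm)
  exact Eventually.of_forall fun x => (sineFun_eq j x).symm

/-- The coefficient of `g` along `√2 sin(jπx + rπ/2)`. -/
def trigCoef (r : ℕ) (j : ℕ+) (g : ℝ → ℂ) : ℂ := ∫ x in (0:ℝ)..1, trigFun r j x • g x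

theorem inner_trigVec (r : ℕ) (j : ℕ+) (g : L2 ℂ 0 1) {G : ℝ → ℂ}
    (hg : g =ᵐ[volume.restrict (Ioo (0:ℝ) 1)] G) :
    inner ℂ (trigVec r j) g = trigCoef r j G := by
  rw [L2.inner_def, trigCoef, ← integral_Ioo_eq_interval zero_le_one]
  refine integral_congr_ae ?_
  filter_upwards [trigVec_ae_eq r j, hg] with x hx hx2
  rw [hx, hx2, RCLike.inner_apply, Complex.conj_ofReal, Complex.real_smul, mul_comm]

theorem inner_eigVec_eq_trigCoef (j : ℕ+) (g : L2 ℂ 0 1) {G : ℝ → ℂ}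
    (hg : g =ᵐ[volume.restrict (Ioo (0:ℝ) 1)] G) :
    inner ℂ (eigVec j) g = trigCoef 0 j G := by
  rw [← trigVec_zero, inner_trigVec 0 j g hg]

theorem integral_cos_int_add (n : ℤ) (r : ℕ) :
    ∫ x in (0:ℝ)..1, Real.cos (n * Real.pi * x + r * Real.pi) = if n = 0 then (-1) ^ r else 0 := by
  simp_rw [Real.cos_add_nat_mul_pi]
  rw [intervalIntegral.integral_const_mul, integral_cos_int]
  split_ifs <;> simp

/-- Product-to-sum formula: the common phase cancels in the cosine of the difference and only shifts
the cosine of the sum, whose frequency i + j is nonzero and which integrates to zero. -/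
theorem integral_trigFun_mul (r : ℕ) (i j : ℕ+) :
    ∫ x in (0:ℝ)..1, trigFun r i x * trigFun r j x = if i = j then 1 else 0 := by
  have h1 : ∀ x, trigFun r i x * trigFun r j x =
      Real.cos (((i : ℤ) - (j : ℤ) : ℤ) * Real.pi * x)
        - Real.cos (((i : ℤ) + (j : ℤ) : ℤ) * Real.pi * x + r * Real.pi) := by
    intro x
    have e1 : (((i : ℤ) - (j : ℤ) : ℤ) : ℝ) * Real.pi * x =
        (i * Real.pi * x + r * (Real.pi / 2)) - (j * Real.pi * x + r * (Real.pi / 2)) := by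
      push_cast; ring
    have e2 : (((i : ℤ) + (j : ℤ) : ℤ) : ℝ) * Real.pi * x + r * Real.pi =
        (i * Real.pi * x + r * (Real.pi / 2)) + (j * Real.pi * x + r * (Real.pi / 2)) := by
      push_cast; ring
    rw [e1, e2, trigFun, trigFun]
    generalize (i : ℝ) * Real.pi * x + r * (Real.pi / 2) = α
    generalize (j : ℝ) * Real.pi * x + r * (Real.pi / 2) = β
    rw [Real.cos_sub, Real.cos_add]
    have := Real.mul_self_sqrt (show (0:ℝ) ≤ 2 by norm_num)
    linear_combination (Real.sin α * Real.sin β) * this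
  simp_rw [h1]
  rw [intervalIntegral.integral_sub (Continuous.intervalIntegrable (by fun_prop) _ _)
      (Continuous.intervalIntegrable (by fun_prop) _ _), integral_cos_int, integral_cos_int_add]
  have hi := i.pos
  have hj := j.pos
  have h2 : ((i : ℤ) + (j : ℤ)) ≠ 0 := by omega
  have h3 : ((i : ℤ) - (j : ℤ) = 0) ↔ i = j := by
    rw [sub_eq_zero]; exact_mod_cast Iff.rfl
  rw [if_neg h2]
  simp only [h3, sub_zero]

theorem orthonormal_trigVec (r : ℕ) : Orthonormal ℂ (trigVec r) := by
  rw [orthonormal_iff_ite]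
  intro i j
  rw [inner_trigVec r i _ (trigVec_ae_eq r j), trigCoef]
  simp_rw [Complex.real_smul, ← Complex.ofReal_mul]
  rw [intervalIntegral.integral_ofReal, integral_trigFun_mul]
  split_ifs <;> simp

theorem trigCoef_of_isPrimitive (r : ℕ) (j : ℕ+) {G g : ℝ → ℂ} (h : IsPrimitive 0 1 G g) :
    trigCoef r j g = trigFun r j 1 • G 1 - trigFun r j 0 • G 0
      - (j * Real.pi : ℝ) • trigCoef (r + 1) j G := by
  have hF : IsPrimitive 0 1 (trigFun r j) (fun x => j * Real.pi * trigFun (r + 1) j x) :=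
    isPrimitive_of_hasDerivAt (hasDerivAt_trigFun r j)
      (continuous_const.mul (continuous_trigFun (r + 1) j))
  rw [trigCoef, hF.integral_smul_eq zero_le_one h, trigCoef, ← intervalIntegral.integral_smul]
  simp only [mul_smul]

/-- Integration by parts against a cosine, which is ±√2 at the ends: this is where boundary values
of G enter. -/
theorem trigCoef_one_of_isPrimitive (j : ℕ+) {G g : ℝ → ℂ} (h : IsPrimitive 0 1 G g) :
    (j * Real.pi : ℂ) * trigCoef 0 j G =
      trigCoef 1 j g + (Real.sqrt 2 : ℂ) * (G 0 - (-1) ^ (j : ℕ) * G 1) := by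
  have h2 : trigCoef 2 j G = -trigCoef 0 j G := by
    rw [trigCoef, trigCoef, ← intervalIntegral.integral_neg]
    congr 1; ext x
    rw [show 2 = 0 + 2 from rfl, trigFun_add_two, neg_smul]
  rw [trigCoef_of_isPrimitive 1 j h, trigFun_one_left, trigFun_one_right, h2]
  simp only [Complex.real_smul]
  push_cast
  ring

/-- Integration by parts against a sine, which vanishes at both ends and leaves no boundary term. -/
theorem trigCoef_zero_of_isPrimitive (j : ℕ+) {G g : ℝ → ℂ} (h : IsPrimitive 0 1 G g) :
    trigCoef 0 j g = -((j * Real.pi : ℂ) * trigCoef 1 j G) := by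
  rw [trigCoef_of_isPrimitive 0 j h, trigFun_zero_left, trigFun_zero_right]
  simp

/-- Each step is a cosine and a sine integration by parts, so that only boundary values of even
derivatives appear. -/
theorem trigCoef_iterate (j : ℕ+) {m n : ℕ} {G : ℕ → ℝ → ℂ} (hG : IsJet 0 1 m G)
    (hn : 2 * n ≤ m) (h0 : ∀ i < n, G (2 * i) 0 = 0 ∧ G (2 * i) 1 = 0) :
    (j * Real.pi : ℂ) ^ (2 * n) * trigCoef 0 j (G 0) = (-1) ^ n * trigCoef 0 j (G (2 * n)) := by
  induction n with
  | zero => simp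
  | succ n ih =>
    have e1 := trigCoef_one_of_isPrimitive j (hG (2 * n) (by omega))
    have e2 := trigCoef_zero_of_isPrimitive j (hG (2 * n + 1) (by omega))
    rw [(h0 n (by omega)).1, (h0 n (by omega)).2] at e1
    have e3 := ih (by omega) fun i hi => h0 i (by omega)
    rw [show 2 * (n + 1) = 2 * n + 1 + 1 by ring, e2, pow_succ, pow_succ]
    linear_combination (j * Real.pi : ℂ) ^ 2 * e3 + (-1) ^ n * (j * Real.pi : ℂ) * e1

theorem tendsto_inner_trigVec (r : ℕ) (g : L2 ℂ 0 1) :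
    Tendsto (fun j : ℕ+ => inner ℂ (trigVec r j) g) cofinite (𝓝 0) := by
  have h := ((orthonormal_trigVec r).inner_products_summable g).tendsto_cofinite_zero
  rw [tendsto_zero_iff_norm_tendsto_zero]
  have h2 := h.sqrt
  simpa using h2

theorem HZero.tendsto_coef {s : ℕ} (φ : HZero s) :
    Tendsto (fun j : ℕ+ => (j : ℂ) ^ s * inner ℂ (eigVec j) φ.toL2) cofinite (𝓝 0) := by
  have h := (memℓp_gen_iff (by norm_num)).1 (lp.memℓp (HZero.coeffs s φ))
  have h1 := h.tendsto_cofinite_zero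
  simp only [ENNReal.toReal_ofNat, Real.rpow_ofNat] at h1
  rw [tendsto_zero_iff_norm_tendsto_zero]
  have h2 := h1.sqrt
  rw [Real.sqrt_zero] at h2
  exact h2.congr fun j => Real.sqrt_sq (norm_nonneg _)

theorem tendsto_cofinite_pnat {m : ℕ → ℕ+} (hm : ∀ n, n < (m n : ℕ)) :
    Tendsto m atTop cofinite := by
  rw [← Nat.cofinite_eq_atTop]
  rw [tendsto_def]
  intro s hs
  obtain ⟨N, hN⟩ := (hs : sᶜ.Finite).bddAbove
  rw [Nat.cofinite_eq_atTop, mem_atTop_sets]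
  refine ⟨N, fun n hn => ?_⟩
  by_contra hns
  have h1 : m n ≤ N := hN hns
  have h2 : (m n : ℕ) ≤ N := h1
  have := hm n
  omega

/-- The expression is constantly z - w along even j and z + w along odd j. -/
theorem eq_zero_of_tendsto_alternating {z w : ℂ}
    (h : Tendsto (fun j : ℕ+ => z - (-1) ^ (j : ℕ) * w) cofinite (𝓝 0)) : z = 0 ∧ w = 0 := by
  have h1 := h.comp (tendsto_cofinite_pnat (m := fun n => ⟨2 * n + 2, by omega⟩)
    (fun n => by show n < 2 * n + 2; omega))
  have h2 := h.comp (tendsto_cofinite_pnat (m := fun n => ⟨2 * n + 1, by omega⟩)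
    (fun n => by show n < 2 * n + 1; omega))
  have e1 : z - w = 0 := by
    refine tendsto_nhds_unique (tendsto_const_nhds (f := atTop (α := ℕ))) (h1.congr fun n => ?_)
    show z - (-1) ^ (2 * n + 2) * w = z - w
    simp [pow_add, pow_mul]
  have e2 : z + w = 0 := by
    refine tendsto_nhds_unique (tendsto_const_nhds (f := atTop (α := ℕ))) (h2.congr fun n => ?_)
    show z - (-1) ^ (2 * n + 1) * w = z + w
    simp [pow_add, pow_mul]
  constructor
  · linear_combination (e1 + e2) / 2
  · linear_combination (e2 - e1) / 2

theorem pnat_cast_ne_zero (j : ℕ+) : (j : ℂ) ≠ 0 := by exact_mod_cast j.ne_zero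

theorem one_le_norm_pnat_cast (j : ℕ+) : 1 ≤ ‖(j : ℂ)‖ := by
  rw [show ((j : ℂ)) = ((j : ℕ) : ℂ) from rfl, Complex.norm_natCast]
  exact_mod_cast one_le (a := j)

/-- Even derivatives of a Sobolev function vanish at the ends if its sine coefficients decay. -/
theorem IsRepJet.even_eq_zero {m s : ℕ} {w : Sobolev ℂ 0 1 m} {G : ℕ → ℝ → ℂ} (hG : IsRepJet w G)
    {φ : HZero s} (hφ : w.fn = φ.toL2) (n : ℕ) (hn : 2 * n + 1 ≤ m) (hns : 2 * n + 1 ≤ s) :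
    G (2 * n) 0 = 0 ∧ G (2 * n) 1 = 0 := by
  induction n using Nat.strong_induction_on with
  | _ n ih =>
  have hit := fun j => trigCoef_iterate j hG.jet (n := n) (by omega)
    fun i hi => ih i hi (by omega) (by omega)
  have e1 := fun j => trigCoef_one_of_isPrimitive j (hG.jet (2 * n) (by omega))
  have hc : ∀ j, inner ℂ (eigVec j) φ.toL2 = trigCoef 0 j (G 0) := fun j => by
    rw [← hφ]; exact inner_eigVec_eq_trigCoef j _ (hG.ae_eq 0 (by omega))
  have h1 := tendsto_inner_trigVec 1 (w.der ⟨2 * n + 1, by omega⟩)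
  simp_rw [fun j => inner_trigVec 1 j _ (hG.ae_eq (2 * n + 1) (by omega))] at h1
  have h2 : Tendsto (fun j : ℕ+ => (j : ℂ) ^ (2 * n + 1) * inner ℂ (eigVec j) φ.toL2)
      cofinite (𝓝 0) := by
    refine squeeze_zero_norm (fun j => ?_) (tendsto_zero_iff_norm_tendsto_zero.1 φ.tendsto_coef)
    rw [norm_mul, norm_mul, norm_pow, norm_pow]
    exact mul_le_mul_of_nonneg_right (pow_le_pow_right₀ (one_le_norm_pnat_cast j) hns)
      (norm_nonneg _)
  -- Up to the factor √2, the bracket is ±π^{2n+1} j^{2n+1} ⟨φ, φ_j⟩ minus a cosine coefficient of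
  -- the derivative of order 2n+1. The first tends to zero because 2n+1 ≤ s, the second by Bessel's
  -- inequality.
  have h3 : Tendsto (fun j : ℕ+ => G (2 * n) 0 - (-1) ^ (j : ℕ) * G (2 * n) 1)
      cofinite (𝓝 0) := by
    have h4 := ((h2.const_mul ((-1) ^ n * (Real.pi : ℂ) ^ (2 * n + 1))).sub h1).const_mul
      ((Real.sqrt 2 : ℂ)⁻¹)
    rw [mul_zero, sub_zero, mul_zero] at h4
    refine h4.congr fun j => ?_
    have hs2 : (Real.sqrt 2 : ℂ) ≠ 0 := by norm_num
    rw [inv_mul_eq_iff_eq_mul₀ hs2, hc]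
    have e := hit j
    have e' := e1 j
    have hn1 : ((-1 : ℂ) ^ n) * (-1) ^ n = 1 := by rw [← mul_pow]; simp
    linear_combination ((-1) ^ n * (j * Real.pi : ℂ)) * e + e'
      + (j * Real.pi : ℂ) * trigCoef 0 j (G (2 * n)) * hn1
  exact eq_zero_of_tendsto_alternating h3

end Trig

/-! ### The coefficient formula on H^{2p+3} ∩ H^{2p+1}_{(0)}. -/

section Inter

theorem InterSpace.fn_eq {m s : ℕ} (x : InterSpace m s) : x.1.1.fn = x.1.2.toL2 := x.2

/-- The Sobolev component of an element of `H^m ∩ H^s_{(0)}`. -/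
def InterSpace.sobolev {m s : ℕ} (x : InterSpace m s) : Sobolev ℂ 0 1 m := x.1.1

/-- The derivatives, as continuous linear maps on `H^m ∩ H^s_{(0)}`. -/
def InterSpace.derCLM (m s : ℕ) (i : Fin (m + 1)) : InterSpace m s →L[ℝ] L2 ℂ 0 1 where
  toFun x := x.sobolev.der i
  map_add' _ _ := rfl
  map_smul' _ _ := rfl
  cont := (Sobolev.continuous_der m i).comp (continuous_fst.comp continuous_subtype_val)

/-- The weighted sine coefficients on `H^{2p+3} ∩ H^{2p+1}_{(0)}`, in terms of two boundary values
and of the cosine coefficients of the last derivative. -/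
theorem InterSpace.exists_coef_eq (p : ℕ) :
    ∃ b₀ b₁ : InterSpace (2 * p + 3) (2 * p + 1) →L[ℝ] ℂ,
      ∀ (x : InterSpace (2 * p + 3) (2 * p + 1)) (j : ℕ+),
        (j * Real.pi : ℂ) ^ (2 * p + 3) * inner ℂ (eigVec j) x.toL2 =
          (-1) ^ (p + 1) * (inner ℂ (trigVec 1 j)
            (InterSpace.derCLM (2 * p + 3) (2 * p + 1) (Fin.last _) x)
            + (Real.sqrt 2 : ℂ) * (b₀ x - (-1) ^ (j : ℕ) * b₁ x)) := by
  let d1 := InterSpace.derCLM (2 * p + 3) (2 * p + 1) ⟨2 * p + 2, by omega⟩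
  let d2 := InterSpace.derCLM (2 * p + 3) (2 * p + 1) ⟨2 * p + 2 + 1, by omega⟩
  -- The functionals are the traces at 0 and at 1 of the derivative of order 2p+2, in the form given
  -- by `IsPrimitive.smul_left_end` and `IsPrimitive.smul_right_end`.
  refine ⟨(integralSMul ℂ (memLp_one_Ioo 0 1)).comp d1
      - (integralSMul ℂ (memLp_const_sub 0 1 1)).comp d2,
    (integralSMul ℂ (memLp_one_Ioo 0 1)).comp d1
      - (integralSMul ℂ (memLp_const_sub 0 1 0)).comp d2, fun x j => ?_⟩
  obtain ⟨G, hG⟩ := x.sobolev.exists_isRepJet zero_lt_one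
  have hv : d1 x =ᵐ[volume.restrict (Ioo (0:ℝ) 1)] G (2 * p + 2) := hG.ae_eq _ _
  have hw : d2 x =ᵐ[volume.restrict (Ioo (0:ℝ) 1)] G (2 * p + 2 + 1) := hG.ae_eq _ _
  have hp := hG.jet (2 * p + 2) (by omega)
  have e0 := hp.smul_left_end zero_le_one hv hw
  have e1 := hp.smul_right_end zero_le_one hv hw
  rw [sub_zero, one_smul] at e0 e1
  simp only [sub_apply, ContinuousLinearMap.comp_apply]
  rw [e0, e1]
  have hc : inner ℂ (eigVec j) x.toL2 = trigCoef 0 j (G 0) :=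
    inner_eigVec_eq_trigCoef j _ (hG.ae_eq 0 (by omega))
  have hb : inner ℂ (trigVec 1 j) (InterSpace.derCLM (2 * p + 3) (2 * p + 1) (Fin.last _) x) =
      trigCoef 1 j (G (2 * p + 2 + 1)) := inner_trigVec 1 j _ hw
  -- Membership in H^{2p+1}_{(0)} makes the even derivatives vanish at the ends up to order 2p only;
  -- order 2p+2 is not covered and supplies the boundary term through `hl`.
  have hit := trigCoef_iterate j hG.jet (n := p + 1) (by omega)
    fun i hi => hG.even_eq_zero x.fn_eq i (by omega) (by omega)
  have hl := trigCoef_one_of_isPrimitive j hp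
  rw [hc, hb, pow_succ, ← hl]
  rw [show 2 * (p + 1) = 2 * p + 2 by ring] at hit
  linear_combination (j * Real.pi : ℂ) * hit

end Inter

theorem ext_inner_eigVec {g h : L2 ℂ 0 1} (H : ∀ j, inner ℂ (eigVec j) g = inner ℂ (eigVec j) h) :
    g = h :=
  sub_eq_zero.1 (eq_zero_of_inner_eigVec _ fun j => by rw [inner_sub_right, H j, sub_self])

/-- The inclusion of `H^s_{(0)}` in `L²` as a continuous linear map. -/
def HZero.toL2CLM (s : ℕ) : HZero s →L[ℂ] L2 ℂ 0 1 :=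
  HZero.toL2.mkContinuous 1 fun φ => by simpa using HZero.norm_toL2_le φ

theorem HZero.toL2CLM_apply {s : ℕ} (φ : HZero s) : HZero.toL2CLM s φ = φ.toL2 := rfl

/-! ### A Sobolev function determines its weak derivatives. -/

section Unique

variable {E : Type*} [NormedAddCommGroup E] [NormedSpace ℝ E] {a b : ℝ}

theorem IsWeakDeriv.unique [CompleteSpace E] {g v w : L2 E a b} (hv : IsWeakDeriv g v)
    (hw : IsWeakDeriv g w) : v = w := by
  have hvi : Integrable v (volume.restrict (Ioo a b)) := (Lp.memLp v).integrable (by norm_num)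
  have hwi : Integrable w (volume.restrict (Ioo a b)) := (Lp.memLp w).integrable (by norm_num)
  have hae := isOpen_Ioo.ae_eq_zero_of_integral_contDiff_smul_eq_zero
    (U := Ioo a b) (f := fun x => v x - w x) (μ := volume.restrict (Ioo a b))
    ((hvi.sub hwi).locallyIntegrable.locallyIntegrableOn _) (by
      intro φ hφ hφc hφs
      have h1 := hv φ ⟨hφ, hφc, hφs⟩
      rw [hw φ ⟨hφ, hφc, hφs⟩, neg_inj] at h1
      simp only [smul_sub]
      rw [integral_sub (integrable_smul_L2 hφ.continuous hφc v)
        (integrable_smul_L2 hφ.continuous hφc w), h1, sub_self])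
  refine Lp.ext ?_
  filter_upwards [hae, self_mem_ae_restrict measurableSet_Ioo] with x hx hx1
  exact sub_eq_zero.1 (hx hx1)

theorem Sobolev.fn_injective [CompleteSpace E] (m : ℕ) :
    Function.Injective (Sobolev.fn : Sobolev E a b m → L2 E a b) := by
  intro v w h
  have key : ∀ (i : ℕ) (hi : i < m + 1), v.der ⟨i, hi⟩ = w.der ⟨i, hi⟩ := by
    intro i
    induction i with
    | zero => exact fun _ => h
    | succ i ih =>
      intro hi
      have h1 := v.isWeakDeriv i (by omega)
      rw [ih (by omega)] at h1
      exact h1.unique (w.isWeakDeriv i (by omega))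
  refine Subtype.ext ?_
  ext i : 1
  exact key i i.2

end Unique

theorem InterSpace.toL2_injective {m s : ℕ} :
    Function.Injective (InterSpace.toL2 : InterSpace m s → L2 ℂ 0 1) := by
  intro x y h
  refine Subtype.ext (Prod.ext (Sobolev.fn_injective m h) (HZero.toL2_injective ?_))
  rw [← x.fn_eq, ← y.fn_eq]
  exact h

/-! ### Sine series as Sobolev functions, and multiplication by μ. -/

theorem isWeakDeriv_trigVec (r : ℕ) (j : ℕ+) (c : ℂ) :
    IsWeakDeriv (c • trigVec r j) ((c * (j * Real.pi)) • trigVec (r + 1) j) := by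
  have hp : IsPrimitive 0 1 (fun x => c * (trigFun r j x : ℂ))
      (fun x => c * (j * Real.pi) * (trigFun (r + 1) j x : ℂ)) := by
    refine isPrimitive_of_hasDerivAt (fun x => ?_) (continuous_const.mul
      (Complex.continuous_ofReal.comp (continuous_trigFun (r + 1) j)))
    have := ((hasDerivAt_trigFun r j x).ofReal_comp).const_mul c
    refine this.congr_deriv ?_
    push_cast; ring
  refine hp.isWeakDeriv zero_le_one ?_ ?_
  · filter_upwards [Lp.coeFn_smul c (trigVec r j), trigVec_ae_eq r j] with x h1 h2
    rw [h1, Pi.smul_apply, h2, smul_eq_mul]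
  · filter_upwards [Lp.coeFn_smul (c * (j * Real.pi)) (trigVec (r + 1) j),
      trigVec_ae_eq (r + 1) j] with x h1 h2
    rw [h1, Pi.smul_apply, h2, smul_eq_mul]

theorem HZero.summable_coef_sq {s i : ℕ} (φ : HZero s) (hi : i ≤ s) :
    Summable fun j : ℕ+ => ‖inner ℂ (eigVec j) φ.toL2 * (j * Real.pi : ℂ) ^ i‖ ^ 2 := by
  have h := (memℓp_gen_iff (by norm_num)).1 (lp.memℓp (HZero.coeffs s φ))
  simp only [ENNReal.toReal_ofNat, Real.rpow_ofNat] at h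
  refine Summable.of_nonneg_of_le (fun j => by positivity) (fun j => ?_)
    (h.mul_left ((Real.pi ^ i) ^ 2))
  rw [← mul_pow]
  refine pow_le_pow_left₀ (norm_nonneg _) ?_ 2
  show _ ≤ Real.pi ^ i * ‖(j : ℂ) ^ s * inner ℂ (eigVec j) φ.toL2‖
  rw [norm_mul, norm_pow, norm_mul, norm_mul, norm_pow, Complex.norm_real,
    Real.norm_of_nonneg Real.pi_pos.le, mul_pow]
  have := pow_le_pow_right₀ (one_le_norm_pnat_cast j) hi
  have h2 : 0 ≤ Real.pi ^ i * ‖inner ℂ (eigVec j) φ.toL2‖ := by positivity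
  nlinarith [mul_le_mul_of_nonneg_left this h2]

/-- The sine series is differentiated term by term. Each derivative shifts the phase by π/2 and
multiplies by jπ; for fixed i the shifted functions are orthonormal, so the i-th series converges in
L² as long as i ≤ s. -/
theorem HZero.exists_sobolev {s : ℕ} (φ : HZero s) :
    ∃ w : Sobolev ℂ 0 1 s, w.fn = φ.toL2 := by
  set c : ℕ+ → ℂ := fun j => inner ℂ (eigVec j) φ.toL2 with hc
  have hsum : ∀ i : ℕ, i ≤ s →
      Summable fun j : ℕ+ => (c j * (j * Real.pi : ℂ) ^ i) • trigVec i j := by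
    intro i hi
    have := ((orthonormal_trigVec i).orthogonalFamily.summable_iff_norm_sq_summable
      (fun j : ℕ+ => c j * (j * Real.pi : ℂ) ^ i)).2 (φ.summable_coef_sq hi)
    simpa using this
  set v : ℕ → L2 ℂ 0 1 := fun i => ∑' j : ℕ+, (c j * (j * Real.pi : ℂ) ^ i) • trigVec i j with hv
  have hw : ∀ i < s, IsWeakDeriv (v i) (v (i + 1)) := by
    intro i hi q hq
    have m1 : MemLp (deriv q) 2 (volume.restrict (Ioo (0:ℝ) 1)) :=
      memLp_Ioo_of_continuousOn hq.deriv_props.1.continuousOn 2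
    have m2 : MemLp q 2 (volume.restrict (Ioo (0:ℝ) 1)) :=
      memLp_Ioo_of_continuousOn hq.1.continuous.continuousOn 2
    -- Both sides of the weak-derivative identity are continuous linear in the L² class, so the
    -- identity passes from the terms to the sum.
    have h1 := (hsum i hi.le).hasSum.mapL (integralSMul ℂ m1)
    have h2 := ((hsum (i + 1) hi).hasSum.mapL (integralSMul ℂ m2)).neg
    refine h1.unique (h2.congr_fun fun j => ?_)
    have := isWeakDeriv_trigVec i j (c j * (j * Real.pi : ℂ) ^ i) q hq
    rw [mul_assoc, ← pow_succ] at this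
    exact this
  refine ⟨⟨WithLp.toLp 2 fun i : Fin (s + 1) => v i, fun i => hw i i.2⟩, ?_⟩
  show v 0 = φ.toL2
  have h := eigBasis.hasSum_repr φ.toL2
  simp only [HilbertBasis.repr_apply_apply, eigBasis_apply] at h
  refine HasSum.unique (hsum 0 (Nat.zero_le _)).hasSum ?_
  simpa [trigVec_zero] using h

theorem MemLp.smul_continuousOn_Ioo {E : Type*} [NormedAddCommGroup E] [NormedSpace ℝ E] {a b : ℝ}
    {f : ℝ → ℝ} {g : ℝ → E} (hf : MemLp f 2 (volume.restrict (Ioo a b)))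
    (hg : ContinuousOn g (Icc a b)) : MemLp (fun x => f x • g x) 2 (volume.restrict (Ioo a b)) :=
  (memLp_Ioo_of_continuousOn hg ∞).smul (r := 2) hf

theorem MemLp.continuousOn_smul_Ioo {E : Type*} [NormedAddCommGroup E] [NormedSpace ℝ E] {a b : ℝ}
    {f : ℝ → ℝ} {g : ℝ → E} (hf : ContinuousOn f (Icc a b))
    (hg : MemLp g 2 (volume.restrict (Ioo a b))) :
    MemLp (fun x => f x • g x) 2 (volume.restrict (Ioo a b)) :=
  hg.smul (r := 2) (memLp_Ioo_of_continuousOn hf ∞)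

/-- As m > 0, the orders in a summand cannot both equal m: at least one factor is continuous. -/
theorem memLp_leibnizProd {E : Type*} [NormedAddCommGroup E] [NormedSpace ℝ E] {a b : ℝ} {m : ℕ}
    (hm : 0 < m) {F : ℕ → ℝ → ℝ} {G : ℕ → ℝ → E}
    (hF : ∀ i < m, ContinuousOn (F i) (Icc a b)) (hG : ∀ i < m, ContinuousOn (G i) (Icc a b))
    (hF' : MemLp (F m) 2 (volume.restrict (Ioo a b)))
    (hG' : MemLp (G m) 2 (volume.restrict (Ioo a b))) :
    MemLp (leibnizProd F G m) 2 (volume.restrict (Ioo a b)) := by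
  have h : ∀ ij ∈ Finset.HasAntidiagonal.antidiagonal m,
      MemLp (fun x => m.choose ij.1 • (F ij.1 x • G ij.2 x)) 2 (volume.restrict (Ioo a b)) := by
    intro ij hij
    have := Finset.HasAntidiagonal.mem_antidiagonal.1 hij
    simp only [← Nat.cast_smul_eq_nsmul ℝ]
    refine MemLp.const_smul ?_ _
    rcases lt_or_ge ij.1 m with h1 | h1
    · refine MemLp.continuousOn_smul_Ioo (hF _ h1) ?_
      rcases lt_or_ge ij.2 m with h2 | h2
      · exact memLp_Ioo_of_continuousOn (hG _ h2) 2
      · rwa [show ij.2 = m by omega]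
    · refine MemLp.smul_continuousOn_Ioo ?_ (hG _ (by omega))
      rwa [show ij.1 = m by omega]
  exact memLp_finsetSum _ h

/-- Multiplication by `μ` maps `H^{2p+3}_{(0)}` to `H^{2p+3} ∩ H^{2p+1}_{(0)}`. -/
theorem exists_mul_mem_interSpace {p m : ℕ} (hm : 2 * p + 3 ≤ m) (μ : Sobolev ℝ 0 1 m)
    (hμ : ∀ n (hn : n < p), VanishesAtEnds (μ.der ⟨2 * n + 1, by omega⟩)) (φ : HZero (2 * p + 3)) :
    ∃ x : InterSpace (2 * p + 3) (2 * p + 1),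
      x.toL2 =ᵐ[volume.restrict (Ioo (0:ℝ) 1)] fun y => μ.fn y • φ.toL2 y := by
  obtain ⟨w, hw⟩ := φ.exists_sobolev
  obtain ⟨G, hG⟩ := w.exists_isRepJet zero_lt_one
  obtain ⟨N, hN⟩ := μ.exists_isRepJet zero_lt_one
  have hL : IsJet 0 1 (2 * p + 3) (leibnizProd N G) :=
    IsJet.leibnizProd zero_le_one (fun i hi => hN.jet i (by omega)) hG.jet
  have hLm : MemLp (leibnizProd N G (2 * p + 3)) 2 (volume.restrict (Ioo (0:ℝ) 1)) :=
    memLp_leibnizProd (by omega) (fun i hi => hN.continuousOn zero_le_one (by omega))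
      (fun i hi => hG.continuousOn zero_le_one hi) (hN.memLp (by omega)) (hG.memLp (by omega))
  obtain ⟨v, hv⟩ := exists_sobolev_of_isJet zero_le_one hL hLm
  have hodd : ∀ n < p, N (2 * n + 1) 0 = 0 ∧ N (2 * n + 1) 1 = 0 := fun n hn =>
    (hμ n hn).eq_zero zero_lt_one (hN.continuousOn zero_le_one (by omega)) (hN.ae_eq _ _)
  have heven : ∀ n, n ≤ p → G (2 * n) 0 = 0 ∧ G (2 * n) 1 = 0 := fun n hn =>
    hG.even_eq_zero hw n (by omega) (by omega)
  -- An even order splits as even plus even, where the derivative of φ vanishes at the ends, or as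
  -- odd plus odd, where the derivative of μ has odd order at most 2p - 1 and vanishes there.
  have hterm : ∀ i < p + 1, ∀ ij ∈ Finset.HasAntidiagonal.antidiagonal (2 * i),
      (N ij.1 0 • G ij.2 0 = 0) ∧ (N ij.1 1 • G ij.2 1 = 0) := by
    intro i hi ij hij
    have := Finset.HasAntidiagonal.mem_antidiagonal.1 hij
    rcases Nat.even_or_odd' ij.2 with ⟨l, hl | hl⟩
    · have h := heven l (by omega)
      rw [hl, h.1, h.2]; simp
    · have h := hodd (i - l - 1) (by omega)
      rw [show ij.1 = 2 * (i - l - 1) + 1 by omega, h.1, h.2]; simp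
  have hL0 : ∀ i < p + 1, leibnizProd N G (2 * i) 0 = 0 ∧ leibnizProd N G (2 * i) 1 = 0 :=
    fun i hi => ⟨Finset.sum_eq_zero fun ij hij => by rw [(hterm i hi ij hij).1, smul_zero],
      Finset.sum_eq_zero fun ij hij => by rw [(hterm i hi ij hij).2, smul_zero]⟩
  have hcoef : ∀ j : ℕ+, (j * Real.pi : ℂ) ^ (2 * (p + 1)) * inner ℂ (eigVec j) v.fn =
      (-1) ^ (p + 1) * inner ℂ (trigVec 0 j) (v.der ⟨2 * (p + 1), by omega⟩) := by
    intro j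
    rw [inner_trigVec 0 j _ (hv.ae_eq _ _), inner_eigVec_eq_trigCoef j v.fn (hv.ae_eq 0 (by omega))]
    exact trigCoef_iterate j hL (by omega) hL0
  have hmem : v.fn ∈ hZeroSubmodule (2 * p + 1) := by
    show Memℓp _ 2
    rw [memℓp_gen_iff (by norm_num)]
    simp only [ENNReal.toReal_ofNat, Real.rpow_ofNat]
    refine Summable.of_nonneg_of_le (fun j => by positivity) (fun j => ?_)
      ((orthonormal_trigVec 0).inner_products_summable (v.der ⟨2 * (p + 1), by omega⟩))
    refine pow_le_pow_left₀ (norm_nonneg _) ?_ 2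
    have h1 := congrArg norm (hcoef j)
    rw [norm_mul, norm_mul, norm_pow, norm_pow, norm_neg, norm_one, one_pow, one_mul] at h1
    rw [← h1, norm_mul, norm_pow]
    refine mul_le_mul_of_nonneg_right ?_ (norm_nonneg _)
    rw [norm_mul, Complex.norm_real, Real.norm_of_nonneg Real.pi_pos.le]
    have h2 := one_le_norm_pnat_cast j
    have h3 : 1 ≤ Real.pi := by linarith [Real.pi_gt_three]
    calc ‖(j : ℂ)‖ ^ (2 * p + 1) ≤ ‖(j : ℂ)‖ ^ (2 * (p + 1)) :=
          pow_le_pow_right₀ h2 (by omega)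
      _ ≤ _ := pow_le_pow_left₀ (norm_nonneg _) (le_mul_of_one_le_right (norm_nonneg _) h3) _
  refine ⟨⟨(v, ⟨v.fn, hmem⟩), rfl⟩, ?_⟩
  show v.fn =ᵐ[_] _
  refine (hv.ae_eq 0 (by omega)).trans ?_
  filter_upwards [hN.ae_eq 0 (by omega), hG.ae_eq 0 (by omega)] with y h1 h2
  have h3 : μ.fn y = N 0 y := h1
  have h4 : w.fn y = G 0 y := h2
  rw [← hw, h3, h4]
  simp [leibnizProd]

/-- Multiplication by `μ` as a continuous linear map. -/
theorem exists_mulCLM {p m : ℕ} (hm : 2 * p + 3 ≤ m) (μ : Sobolev ℝ 0 1 m)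
    (hμ : ∀ n (hn : n < p), VanishesAtEnds (μ.der ⟨2 * n + 1, by omega⟩)) :
    ∃ M : HZero (2 * p + 3) →L[ℝ] InterSpace (2 * p + 3) (2 * p + 1), ∀ φ,
      (M φ).toL2 =ᵐ[volume.restrict (Ioo (0:ℝ) 1)] fun y => μ.fn y • φ.toL2 y := by
  choose f hf using exists_mul_mem_interSpace hm μ hμ
  let L : HZero (2 * p + 3) →ₗ[ℝ] InterSpace (2 * p + 3) (2 * p + 1) :=
    { toFun := f
      map_add' := fun φ ψ => by
        refine InterSpace.toL2_injective (Lp.ext ?_)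
        refine (hf (φ + ψ)).trans (EventuallyEq.symm ?_)
        refine (Lp.coeFn_add (f φ).toL2 (f ψ).toL2).trans ?_
        rw [map_add]
        filter_upwards [Lp.coeFn_add φ.toL2 ψ.toL2, hf φ, hf ψ] with y h1 h2 h3
        rw [h1, Pi.add_apply, Pi.add_apply, h2, h3, smul_add]
      map_smul' := fun c φ => by
        refine InterSpace.toL2_injective (Lp.ext ?_)
        refine (hf (c • φ)).trans (EventuallyEq.symm ?_)
        refine (Lp.coeFn_smul c (f φ).toL2).trans ?_
        rw [show (c • φ) = (c : ℂ) • φ from rfl, map_smul]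
        filter_upwards [Lp.coeFn_smul (c : ℂ) φ.toL2, hf φ] with y h1 h2
        rw [h1, Pi.smul_apply, Pi.smul_apply, h2, smul_comm]
        simp [mul_left_comm] }
  -- Boundedness comes from the closed graph theorem. A sine coefficient of μφ is the integral of φ
  -- against μφ_j, which is in L²; it is therefore continuous in φ and identifies the limit.
  have hmm : ∀ j : ℕ+, MemLp (fun y => μ.fn y • trigFun 0 j y) 2 (volume.restrict (Ioo (0:ℝ) 1)) :=
    fun j => MemLp.smul_continuousOn_Ioo (Lp.memLp _) (continuous_trigFun 0 j).continuousOn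
  have hin : ∀ φ j, inner ℂ (eigVec j) (L φ).toL2 =
      integralSMul ℂ (hmm j) (HZero.toL2CLM _ φ) := by
    intro φ j
    rw [show L φ = f φ from rfl, inner_eigVec_eq_trigCoef j _ (hf φ), trigCoef,
      ← integral_Ioo_eq_interval zero_le_one,
      integralSMul_apply]
    congr 1; ext y
    rw [HZero.toL2CLM_apply, smul_smul, mul_comm (trigFun 0 j y), smul_eq_mul]
  have hcl : ∀ (u : ℕ → HZero (2 * p + 3)) (x : HZero (2 * p + 3))
      (y : InterSpace (2 * p + 3) (2 * p + 1)),
      Tendsto u atTop (𝓝 x) → Tendsto (L ∘ u) atTop (𝓝 y) → y = L x := by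
    intro u x y hu hL
    refine InterSpace.toL2_injective (ext_inner_eigVec fun j => ?_)
    have h1 : Tendsto (fun n => inner ℂ (eigVec j) (L (u n)).toL2) atTop
        (𝓝 (inner ℂ (eigVec j) y.toL2)) :=
      (((innerSL ℂ (eigVec j)).continuous.comp
        (InterSpace.derCLM (2 * p + 3) (2 * p + 1) 0).continuous).tendsto y).comp hL
    have h2 : Tendsto (fun n => inner ℂ (eigVec j) (L (u n)).toL2) atTop
        (𝓝 (inner ℂ (eigVec j) (L x).toL2)) := by
      simp_rw [hin]
      exact (((integralSMul ℂ (hmm j)).continuous.comp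
        (HZero.toL2CLM (2 * p + 3)).continuous).tendsto x).comp hu
    exact tendsto_nhds_unique h1 h2
  exact ⟨ContinuousLinearMap.ofSeqClosedGraph hcl, hf⟩

/-! ### Bessel's inequality in time for the exponentials e^{iλ_jτ}. -/

section Bessel

theorem L2.norm_sq_eq_integral {E : Type*} [NormedAddCommGroup E] {a b : ℝ} (g : L2 E a b) :
    ‖g‖ ^ 2 = ∫ x in Ioo a b, ‖g x‖ ^ 2 := by
  rw [Lp.norm_def, (Lp.memLp g).eLpNorm_eq_integral_rpow_norm (by norm_num) (by norm_num)]
  have h : 0 ≤ ∫ x in Ioo a b, ‖g x‖ ^ 2 := integral_nonneg fun x => by positivity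
  simp only [ENNReal.toReal_ofNat, Real.rpow_ofNat]
  rw [ENNReal.toReal_ofReal (by positivity), ← Real.rpow_natCast, ← Real.rpow_mul h]
  norm_num

theorem integrable_norm_sq {E : Type*} [NormedAddCommGroup E] {a b : ℝ} {g : ℝ → E}
    (hg : MemLp g 2 (volume.restrict (Ioo a b))) :
    Integrable (fun x => ‖g x‖ ^ 2) (volume.restrict (Ioo a b)) :=
  hg.integrable_norm_pow (by norm_num)

theorem MemLp.mono_Ioo {E : Type*} [NormedAddCommGroup E] {a b c d : ℝ} {g : ℝ → E}
    (hg : MemLp g 2 (volume.restrict (Ioo a b))) (h1 : a ≤ c) (h2 : d ≤ b) :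
    MemLp g 2 (volume.restrict (Ioo c d)) :=
  hg.mono_measure (Measure.restrict_mono (Ioo_subset_Ioo h1 h2) le_rfl)

/-- Cauchy–Schwarz, from the integral of (‖g‖ - c)² ≥ 0 with c the mean of ‖g‖. -/
theorem sq_norm_integral_le {E : Type*} [NormedAddCommGroup E] [NormedSpace ℝ E] {a b : ℝ}
    (hab : a ≤ b) {g : ℝ → E} (hg : MemLp g 2 (volume.restrict (Ioo a b))) :
    ‖∫ x in a..b, g x‖ ^ 2 ≤ (b - a) * ∫ x in a..b, ‖g x‖ ^ 2 := by
  rcases hab.eq_or_lt with rfl | hlt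
  · simp
  have h2 := integrable_norm_sq hg
  have h1 : Integrable (fun x => ‖g x‖) (volume.restrict (Ioo a b)) :=
    (hg.integrable (by norm_num)).norm
  rw [← integral_Ioo_eq_interval hab, ← integral_Ioo_eq_interval hab]
  set A := ∫ x in Ioo a b, ‖g x‖ with hA
  have hle : ‖∫ x in Ioo a b, g x‖ ≤ A := norm_integral_le_integral_norm _
  have hpos : 0 < b - a := sub_pos.2 hlt
  set c := A / (b - a) with hc
  have h3 : 0 ≤ ∫ x in Ioo a b, (‖g x‖ ^ 2 - 2 * c * ‖g x‖ + c ^ 2) :=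
    integral_nonneg fun x => by
      show 0 ≤ ‖g x‖ ^ 2 - 2 * c * ‖g x‖ + c ^ 2
      nlinarith [sq_nonneg (‖g x‖ - c)]
  have h4 : Integrable (fun x => ‖g x‖ ^ 2 - 2 * c * ‖g x‖) (volume.restrict (Ioo a b)) :=
    h2.sub (h1.const_mul (2 * c))
  rw [integral_add h4 (integrable_const _), integral_sub h2 (h1.const_mul _), integral_const_mul,
    ← hA] at h3
  simp only [integral_const, measureReal_restrict_apply_univ, Real.volume_real_Ioo_of_le hab,
    smul_eq_mul] at h3
  have h5 : c * (b - a) = A := by rw [hc]; field_simp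
  have h6 : A ^ 2 ≤ (b - a) * ∫ x in Ioo a b, ‖g x‖ ^ 2 := by nlinarith
  exact (pow_le_pow_left₀ (norm_nonneg _) hle 2).trans h6

/-- The function `τ ↦ e^{iλ_jτ}`. -/
def timeExp (j : ℕ+) (τ : ℝ) : ℂ := Complex.exp (Complex.I * eigVal j * τ)

theorem continuous_timeExp (j : ℕ+) : Continuous (timeExp j) := by unfold timeExp; fun_prop

theorem norm_timeExp (j : ℕ+) (τ : ℝ) : ‖timeExp j τ‖ = 1 := by
  rw [timeExp, show Complex.I * eigVal j * τ = ((eigVal j * τ : ℝ) : ℂ) * Complex.I by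
    push_cast; ring, Complex.norm_exp_ofReal_mul_I]

theorem conj_timeExp (j : ℕ+) (τ : ℝ) :
    (starRingEnd ℂ) (timeExp j τ) = Complex.exp (-Complex.I * eigVal j * τ) := by
  rw [timeExp, ← Complex.exp_conj]
  simp

/-- Since λ_i - λ_j = π²(i² - j²), the length 2N/π is a period of every product for each N. The
integer N stays free so that the period can be made to cover a given time interval. -/
theorem integral_timeExp (N : ℕ) (i j : ℕ+) :
    ∫ τ in (0:ℝ)..(2 * N / Real.pi), timeExp i τ * (starRingEnd ℂ) (timeExp j τ) =
      if i = j then ((2 * N / Real.pi : ℝ) : ℂ) else 0 := by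
  split_ifs with h
  · subst h
    have : ∀ τ, timeExp i τ * (starRingEnd ℂ) (timeExp i τ) = 1 := fun τ => by
      rw [Complex.mul_conj, Complex.normSq_eq_norm_sq, norm_timeExp]; simp
    simp_rw [this]
    simp
  · have h1 : ∀ τ : ℝ, timeExp i τ * (starRingEnd ℂ) (timeExp j τ) =
        Complex.exp (Complex.I * (eigVal i - eigVal j) * τ) := fun τ => by
      rw [conj_timeExp, timeExp, ← Complex.exp_add]; congr 1; ring
    simp_rw [h1]
    have hne : (eigVal i : ℂ) - eigVal j ≠ 0 := by
      rw [← Complex.ofReal_sub]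
      refine Complex.ofReal_ne_zero.2 (sub_ne_zero.2 fun he => h ?_)
      have hi : (0:ℝ) ≤ i * Real.pi := by positivity
      have hj : (0:ℝ) ≤ j * Real.pi := by positivity
      have := (pow_left_inj₀ hi hj two_ne_zero).1 he
      have := mul_right_cancel₀ Real.pi_ne_zero this
      exact PNat.coe_inj.1 (by exact_mod_cast this)
    rw [integral_exp_mul_complex (mul_ne_zero Complex.I_ne_zero hne)]
    have h2 : Complex.I * (eigVal i - eigVal j) * ((2 * N / Real.pi : ℝ) : ℂ) =
        ((N * ((i : ℤ) ^ 2 - (j : ℤ) ^ 2) : ℤ) : ℂ) * (2 * Real.pi * Complex.I) := by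
      have : (Real.pi : ℂ) ≠ 0 := by exact_mod_cast Real.pi_ne_zero
      simp only [eigVal]
      push_cast
      field_simp
    rw [h2, Complex.exp_int_mul_two_pi_mul_I]
    simp

theorem memLp_conj_timeExp (j : ℕ+) (P : ℝ) :
    MemLp (fun τ => (starRingEnd ℂ) (timeExp j τ)) 2 (volume.restrict (Ioo 0 P)) :=
  memLp_Ioo_of_continuousOn (Complex.continuous_conj.comp (continuous_timeExp j)).continuousOn 2

theorem inner_toLp_conj_timeExp (j : ℕ+) {P : ℝ} (hP : 0 ≤ P) (g : L2 ℂ 0 P) {h : ℝ → ℂ}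
    (hg : g =ᵐ[volume.restrict (Ioo 0 P)] h) :
    inner ℂ ((memLp_conj_timeExp j P).toLp _) g = ∫ τ in (0:ℝ)..P, timeExp j τ * h τ := by
  rw [L2.inner_def, ← integral_Ioo_eq_interval hP]
  refine integral_congr_ae ?_
  filter_upwards [(memLp_conj_timeExp j P).coeFn_toLp, hg] with x hx hx2
  rw [hx, hx2, RCLike.inner_apply, Complex.conj_conj, mul_comm]

/-- The orthogonality of the functions `e^{iλ_jτ}` over a period. -/
theorem sum_sq_norm_integral_timeExp_le (T : ℝ) : ∃ C : ℝ, 0 ≤ C ∧ ∀ s t : ℝ, 0 ≤ s → s ≤ t →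
    t ≤ T → ∀ h : ℝ → ℂ, MemLp h 2 (volume.restrict (Ioo s t)) → ∀ S : Finset ℕ+,
      ∑ j ∈ S, ‖∫ τ in s..t, timeExp j τ * h τ‖ ^ 2 ≤ C * ∫ τ in s..t, ‖h τ‖ ^ 2 := by
  -- A period P ≥ T is fixed once and for all. Functions on (s,t) are extended by zero to (0,P), so
  -- the Bessel constant P does not depend on s and t.
  obtain ⟨N, hN⟩ := exists_nat_gt (max 0 (T * Real.pi / 2))
  have hN0 : 0 < N := by exact_mod_cast (le_max_left _ _).trans_lt hN
  set P : ℝ := 2 * N / Real.pi with hPdef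
  have hP : 0 < P := by positivity
  have hTP : T ≤ P := by
    rw [hPdef, le_div_iff₀ Real.pi_pos]
    linarith [(le_max_right 0 (T * Real.pi / 2)).trans hN.le]
  refine ⟨P, hP.le, fun s t hs hst ht h hh S => ?_⟩
  have hsub : Ioo s t ⊆ Ioo 0 P := Ioo_subset_Ioo hs (ht.trans hTP)
  set e : ℕ+ → L2 ℂ 0 P := fun j => (memLp_conj_timeExp j P).toLp _ with he
  have hee : ∀ i j, inner ℂ (e i) (e j) = if i = j then (P : ℂ) else 0 := fun i j => by
    rw [inner_toLp_conj_timeExp i hP.le _ (memLp_conj_timeExp j P).coeFn_toLp]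
    exact integral_timeExp N i j
  have hsq : Real.sqrt P * Real.sqrt P = P := Real.mul_self_sqrt hP.le
  have hsq0 : (Real.sqrt P : ℂ) ≠ 0 := by exact_mod_cast (Real.sqrt_pos.2 hP).ne'
  have hort : Orthonormal ℂ fun j => ((Real.sqrt P : ℂ)⁻¹) • e j := by
    rw [orthonormal_iff_ite]
    intro i j
    rw [inner_smul_left, inner_smul_right, hee, map_inv₀, Complex.conj_ofReal]
    split_ifs
    · have hsqC : (Real.sqrt P : ℂ) * Real.sqrt P = P := by rw [← Complex.ofReal_mul, hsq]
      rw [← hsqC]; field_simp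
    · simp
  have hm : MemLp ((Ioo s t).indicator h) 2 (volume.restrict (Ioo 0 P)) := by
    rw [memLp_indicator_iff_restrict measurableSet_Ioo, Measure.restrict_restrict_of_subset hsub]
    exact hh
  set g : L2 ℂ 0 P := hm.toLp _ with hg
  have hin : ∀ j, inner ℂ (e j) g = ∫ τ in s..t, timeExp j τ * h τ := fun j => by
    rw [inner_toLp_conj_timeExp j hP.le g hm.coeFn_toLp, ← integral_Ioo_eq_interval hP.le,
      ← integral_Ioo_eq_interval hst]
    have : (fun τ => timeExp j τ * (Ioo s t).indicator h τ) =
        (Ioo s t).indicator fun τ => timeExp j τ * h τ := by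
      ext τ; simp [indicator]
    rw [this, integral_indicator measurableSet_Ioo, Measure.restrict_restrict_of_subset hsub]
  have hgn : ‖g‖ ^ 2 = ∫ τ in s..t, ‖h τ‖ ^ 2 := by
    rw [L2.norm_sq_eq_integral, ← integral_Ioo_eq_interval hst,
      integral_congr_ae (g := (Ioo s t).indicator fun τ => ‖h τ‖ ^ 2)]
    · rw [integral_indicator measurableSet_Ioo, Measure.restrict_restrict_of_subset hsub]
    · filter_upwards [hm.coeFn_toLp] with x hx
      rw [hx]
      by_cases hxm : x ∈ Ioo s t <;> simp [hxm]
  have hB := hort.sum_inner_products_le g (s := S)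
  rw [hgn] at hB
  have h3 : ∀ j, ‖inner ℂ (((Real.sqrt P : ℂ)⁻¹) • e j) g‖ ^ 2 =
      P⁻¹ * ‖∫ τ in s..t, timeExp j τ * h τ‖ ^ 2 := fun j => by
    rw [inner_smul_left, hin, norm_mul, mul_pow, map_inv₀, Complex.conj_ofReal, norm_inv,
      Complex.norm_real, Real.norm_of_nonneg (Real.sqrt_nonneg _), inv_pow, Real.sq_sqrt hP.le]
  simp_rw [h3] at hB
  rw [← Finset.mul_sum, inv_mul_le_iff₀ hP] at hB
  exact hB

theorem MemLp.timeExp_mul {s t : ℝ} (j : ℕ+) {h : ℝ → ℂ}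
    (hh : MemLp h 2 (volume.restrict (Ioo s t))) :
    MemLp (fun τ => timeExp j τ * h τ) 2 (volume.restrict (Ioo s t)) :=
  hh.mul (r := 2) (memLp_Ioo_of_continuousOn (continuous_timeExp j).continuousOn ∞)

theorem MemLp.intervalIntegrable_Ioo {E : Type*} [NormedAddCommGroup E] {s t : ℝ} (hst : s ≤ t)
    {h : ℝ → E} (hh : MemLp h 2 (volume.restrict (Ioo s t))) : IntervalIntegrable h volume s t :=
  intervalIntegrable_of_integrable_Ioo hst (hh.integrable (by norm_num))

end Bessel

/-! ### The smoothing effect of the Duhamel integral. -/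

section Smoothing

/-- The coefficient `⟨x, φ_j⟩` as a continuous linear functional on `H^m ∩ H^s_{(0)}`. -/
def InterSpace.coefCLM (m s : ℕ) (j : ℕ+) : InterSpace m s →L[ℝ] ℂ :=
  ((innerSL ℂ (eigVec j)).restrictScalars ℝ).comp (InterSpace.derCLM m s 0)

theorem InterSpace.coefCLM_apply {m s : ℕ} (j : ℕ+) (x : InterSpace m s) :
    InterSpace.coefCLM m s j x = inner ℂ (eigVec j) x.toL2 := rfl

theorem sq_norm_add_le (x y z : ℂ) :
    ‖x + (y - z)‖ ^ 2 ≤ 3 * (‖x‖ ^ 2 + ‖y‖ ^ 2 + ‖z‖ ^ 2) := by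
  have h : ‖x + (y - z)‖ ≤ ‖x‖ + (‖y‖ + ‖z‖) :=
    (norm_add_le _ _).trans (add_le_add_right (norm_sub_le _ _) _)
  nlinarith [norm_nonneg (x + (y - z)), sq_nonneg (‖x‖ - ‖y‖), sq_nonneg (‖x‖ - ‖z‖),
    sq_nonneg (‖y‖ - ‖z‖), norm_nonneg x, norm_nonneg y, norm_nonneg z]

theorem integral_norm_clm_sq_le {X : Type*} [NormedAddCommGroup X] [NormedSpace ℝ X] {s t : ℝ}
    {E : Type*} [NormedAddCommGroup E] [NormedSpace ℝ E] (hst : s ≤ t) (L : X →L[ℝ] E) {F : ℝ → X}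
    (hF : MemLp F 2 (volume.restrict (Ioo s t))) :
    ∫ τ in s..t, ‖L (F τ)‖ ^ 2 ≤ ‖L‖ ^ 2 * ∫ τ in s..t, ‖F τ‖ ^ 2 := by
  have h1 : MemLp (fun τ => L (F τ)) 2 (volume.restrict (Ioo s t)) := L.comp_memLp' hF
  rw [← intervalIntegral.integral_const_mul]
  refine intervalIntegral.integral_mono_on hst
    (intervalIntegrable_of_integrable_Ioo hst (integrable_norm_sq h1))
    ((intervalIntegrable_of_integrable_Ioo hst (integrable_norm_sq hF)).const_mul _) fun τ _ => ?_
  rw [← mul_pow]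
  exact pow_le_pow_left₀ (norm_nonneg _) (L.le_opNorm _) 2

/-- The smoothing estimate for the Duhamel integrals, in terms of coefficients. -/
theorem sum_sq_norm_duhamel_le (p : ℕ) {T : ℝ} (hT : 0 ≤ T) : ∃ C : ℝ, 0 ≤ C ∧
    ∀ s t : ℝ, 0 ≤ s → s ≤ t → t ≤ T →
    ∀ F : ℝ → InterSpace (2 * p + 3) (2 * p + 1), MemLp F 2 (volume.restrict (Ioo s t)) →
    ∀ S : Finset ℕ+, ∑ j ∈ S, ‖(j : ℂ) ^ (2 * p + 3) *
      ∫ τ in s..t, timeExp j τ * inner ℂ (eigVec j) (F τ).toL2‖ ^ 2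
        ≤ C * ∫ τ in s..t, ‖F τ‖ ^ 2 := by
  obtain ⟨b₀, b₁, hb⟩ := InterSpace.exists_coef_eq p
  obtain ⟨K, hK, hB⟩ := sum_sq_norm_integral_timeExp_le T
  set D := InterSpace.derCLM (2 * p + 3) (2 * p + 1) (Fin.last _) with hD
  -- The 3 comes from squaring a sum of three terms, T from Cauchy–Schwarz in time on the cosine
  -- part, K from Bessel's inequality in time on each trace, and 2 from the square of √2.
  refine ⟨3 * (T * ‖D‖ ^ 2 + 2 * K * ‖b₀‖ ^ 2 + 2 * K * ‖b₁‖ ^ 2), by positivity,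
    fun s t hs hst ht F hF S => ?_⟩
  set Q := ∫ τ in s..t, ‖F τ‖ ^ 2 with hQ
  have hQ0 : 0 ≤ Q := intervalIntegral.integral_nonneg hst fun τ _ => by positivity
  let β : ℕ+ → InterSpace (2 * p + 3) (2 * p + 1) →L[ℝ] ℂ := fun j =>
    ((innerSL ℂ (trigVec 1 j)).restrictScalars ℝ).comp D
  have hLm : ∀ L : InterSpace (2 * p + 3) (2 * p + 1) →L[ℝ] ℂ,
      MemLp (fun τ => L (F τ)) 2 (volume.restrict (Ioo s t)) := fun L => L.comp_memLp' hF
  have hLi : ∀ (L : InterSpace (2 * p + 3) (2 * p + 1) →L[ℝ] ℂ) (j : ℕ+),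
      IntervalIntegrable (fun τ => timeExp j τ * L (F τ)) volume s t := fun L j =>
    MemLp.intervalIntegrable_Ioo hst (MemLp.timeExp_mul j (hLm L))
  have hsplit : ∀ j : ℕ+, (Real.pi : ℂ) ^ (2 * p + 3) * ((j : ℂ) ^ (2 * p + 3) *
      ∫ τ in s..t, timeExp j τ * inner ℂ (eigVec j) (F τ).toL2) =
      (-1) ^ (p + 1) * ((∫ τ in s..t, timeExp j τ * β j (F τ)) +
        ((Real.sqrt 2 : ℂ) * (∫ τ in s..t, timeExp j τ * b₀ (F τ))
          - (Real.sqrt 2 : ℂ) * (-1) ^ (j : ℕ) * ∫ τ in s..t, timeExp j τ * b₁ (F τ))) := by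
    intro j
    have h1 : ∀ τ, (j * Real.pi : ℂ) ^ (2 * p + 3) *
        (timeExp j τ * inner ℂ (eigVec j) (F τ).toL2) =
        (-1) ^ (p + 1) * (timeExp j τ * β j (F τ)
          + ((Real.sqrt 2 : ℂ) * (timeExp j τ * b₀ (F τ))
          - (Real.sqrt 2 : ℂ) * (-1) ^ (j : ℕ) * (timeExp j τ * b₁ (F τ)))) := fun τ => by
      have := hb (F τ) j
      have hβ : β j (F τ) = inner ℂ (trigVec 1 j) (D (F τ)) := rfl
      rw [hβ]
      linear_combination timeExp j τ * this
    have h2 : (j * Real.pi : ℂ) ^ (2 * p + 3) *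
        ∫ τ in s..t, timeExp j τ * inner ℂ (eigVec j) (F τ).toL2 =
        ∫ τ in s..t, (j * Real.pi : ℂ) ^ (2 * p + 3) *
        (timeExp j τ * inner ℂ (eigVec j) (F τ).toL2) :=
      (intervalIntegral.integral_const_mul _ _).symm
    rw [← mul_assoc, ← mul_pow, mul_comm (Real.pi : ℂ), h2]
    simp_rw [h1]
    rw [intervalIntegral.integral_const_mul, intervalIntegral.integral_add (hLi _ j)
      (((hLi b₀ j).const_mul _).sub ((hLi b₁ j).const_mul _)),
      intervalIntegral.integral_sub ((hLi b₀ j).const_mul _) ((hLi b₁ j).const_mul _),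
      intervalIntegral.integral_const_mul, intervalIntegral.integral_const_mul]
  have hs2 : ‖(Real.sqrt 2 : ℂ)‖ ^ 2 = 2 := by
    rw [Complex.norm_real, Real.norm_of_nonneg (Real.sqrt_nonneg 2), Real.sq_sqrt (by norm_num)]
  have hterm : ∀ j : ℕ+, ‖(j : ℂ) ^ (2 * p + 3) *
      ∫ τ in s..t, timeExp j τ * inner ℂ (eigVec j) (F τ).toL2‖ ^ 2 ≤
      3 * (‖∫ τ in s..t, timeExp j τ * β j (F τ)‖ ^ 2
        + 2 * ‖∫ τ in s..t, timeExp j τ * b₀ (F τ)‖ ^ 2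
        + 2 * ‖∫ τ in s..t, timeExp j τ * b₁ (F τ)‖ ^ 2) := by
    intro j
    set z := (j : ℂ) ^ (2 * p + 3) *
      ∫ τ in s..t, timeExp j τ * inner ℂ (eigVec j) (F τ).toL2 with hz
    have hzs := hsplit j
    rw [← hz] at hzs
    clear_value z
    have h1 : ‖z‖ ≤ ‖(Real.pi : ℂ) ^ (2 * p + 3) * z‖ := by
      rw [norm_mul, norm_pow, Complex.norm_real, Real.norm_of_nonneg Real.pi_pos.le]
      exact le_mul_of_one_le_left (norm_nonneg _)
        (one_le_pow₀ (by linarith [Real.pi_gt_three]))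
    refine (pow_le_pow_left₀ (norm_nonneg _) h1 2).trans ?_
    rw [hzs, norm_mul, norm_pow, norm_neg, norm_one, one_pow, one_mul]
    refine (sq_norm_add_le _ _ _).trans (le_of_eq ?_)
    simp only [norm_mul, mul_pow, hs2, norm_pow, norm_neg, norm_one, one_pow, mul_one]
  -- Cosine part: the sum over j goes inside the time integral, and Bessel's inequality in x applies
  -- at each τ.
  have hA : ∑ j ∈ S, ‖∫ τ in s..t, timeExp j τ * β j (F τ)‖ ^ 2 ≤ T * ‖D‖ ^ 2 * Q := by
    have h1 : ∀ j ∈ S, ‖∫ τ in s..t, timeExp j τ * β j (F τ)‖ ^ 2 ≤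
        T * ∫ τ in s..t, ‖β j (F τ)‖ ^ 2 := by
      intro j _
      refine (sq_norm_integral_le hst (MemLp.timeExp_mul j (hLm (β j)))).trans ?_
      simp only [norm_mul, norm_timeExp, one_mul]
      exact mul_le_mul_of_nonneg_right (by linarith)
        (intervalIntegral.integral_nonneg hst fun τ _ => by positivity)
    refine (Finset.sum_le_sum h1).trans ?_
    rw [← Finset.mul_sum, mul_assoc]
    refine mul_le_mul_of_nonneg_left ?_ hT
    have hβi : ∀ j ∈ S, IntervalIntegrable (fun τ => ‖β j (F τ)‖ ^ 2) volume s t := fun j _ =>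
      intervalIntegrable_of_integrable_Ioo hst (integrable_norm_sq (hLm (β j)))
    rw [← intervalIntegral.integral_finsetSum hβi]
    have hDm : MemLp (fun τ => D (F τ)) 2 (volume.restrict (Ioo s t)) := D.comp_memLp' hF
    have hβs : IntervalIntegrable (fun τ => ∑ j ∈ S, ‖β j (F τ)‖ ^ 2) volume s t := by
      have := IntervalIntegrable.sum S hβi
      rwa [Finset.sum_fn] at this
    refine (intervalIntegral.integral_mono_on hst hβs
      (intervalIntegrable_of_integrable_Ioo hst (integrable_norm_sq hDm)) fun τ _ => ?_).trans
      (integral_norm_clm_sq_le hst D hF)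
    exact (orthonormal_trigVec 1).sum_inner_products_le (D (F τ))
  -- A trace does not depend on j, so its integrals against the exponentials are Fourier
  -- coefficients in time of a single function.
  have hbb : ∀ b : InterSpace (2 * p + 3) (2 * p + 1) →L[ℝ] ℂ,
      ∑ j ∈ S, ‖∫ τ in s..t, timeExp j τ * b (F τ)‖ ^ 2 ≤ K * ‖b‖ ^ 2 * Q := fun b => by
    refine (hB s t hs hst ht _ (hLm b) S).trans ?_
    rw [mul_assoc]
    exact mul_le_mul_of_nonneg_left (integral_norm_clm_sq_le hst b hF) hK
  refine (Finset.sum_le_sum fun j _ => hterm j).trans ?_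
  rw [← Finset.mul_sum, Finset.sum_add_distrib, Finset.sum_add_distrib, ← Finset.mul_sum,
    ← Finset.mul_sum]
  nlinarith [hbb b₀, hbb b₁, hA]

end Smoothing

/-! ### The group e^{-iAt} on H^s_{(0)}, described by coefficients. -/

section Evolution

theorem HZero.hasSum_norm_sq {s : ℕ} (φ : HZero s) :
    HasSum (fun j : ℕ+ => ‖(j : ℂ) ^ s * inner ℂ (eigVec j) φ.toL2‖ ^ 2) (‖φ‖ ^ 2) := by
  have h := lp.hasSum_norm (p := 2) (by norm_num) (HZero.coeffs s φ)
  simp only [ENNReal.toReal_ofNat, Real.rpow_ofNat] at h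
  exact h

theorem HZero.norm_sq_le {s : ℕ} (φ : HZero s) {K : ℝ}
    (h : ∀ S : Finset ℕ+, ∑ j ∈ S, ‖(j : ℂ) ^ s * inner ℂ (eigVec j) φ.toL2‖ ^ 2 ≤ K) :
    ‖φ‖ ^ 2 ≤ K :=
  le_of_tendsto φ.hasSum_norm_sq (Eventually.of_forall h)

theorem HZero.ext_coef {s : ℕ} {φ ψ : HZero s}
    (h : ∀ j, inner ℂ (eigVec j) φ.toL2 = inner ℂ (eigVec j) ψ.toL2) : φ = ψ :=
  HZero.toL2_injective (ext_inner_eigVec h)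

theorem HZero.exists_coef (s : ℕ) (c : ℕ+ → ℂ) {K : ℝ}
    (h : ∀ S : Finset ℕ+, ∑ j ∈ S, ‖(j : ℂ) ^ s * c j‖ ^ 2 ≤ K) :
    ∃ φ : HZero s, ∀ j, inner ℂ (eigVec j) φ.toL2 = c j := by
  have hm : Memℓp (fun j : ℕ+ => (j : ℂ) ^ s * c j) 2 :=
    memℓp_gen' (C := K) fun S => by simpa using h S
  obtain ⟨φ, hφ⟩ := HZero.coeffs_surjective s ⟨_, hm⟩
  refine ⟨φ, fun j => ?_⟩
  have h1 : (j : ℂ) ^ s * inner ℂ (eigVec j) φ.toL2 = (j : ℂ) ^ s * c j :=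
    congrArg (fun v : lp (fun _ : ℕ+ => ℂ) 2 => v j) hφ
  exact mul_left_cancel₀ (pow_ne_zero _ (pnat_cast_ne_zero j)) h1

theorem HZero.sum_norm_sq_le {s : ℕ} (φ : HZero s) (S : Finset ℕ+) :
    ∑ j ∈ S, ‖(j : ℂ) ^ s * inner ℂ (eigVec j) φ.toL2‖ ^ 2 ≤ ‖φ‖ ^ 2 :=
  sum_le_hasSum S (fun j _ => by positivity) φ.hasSum_norm_sq

theorem HZero.exists_evolve {s : ℕ} (t : ℝ) (φ : HZero s) :
    ∃ ψ : HZero s, ∀ j,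
      inner ℂ (eigVec j) ψ.toL2 = timeExp j (-t) * inner ℂ (eigVec j) φ.toL2 :=
  HZero.exists_coef s _ (K := ‖φ‖ ^ 2) fun S => by
    refine le_trans (le_of_eq (Finset.sum_congr rfl fun j _ => ?_)) (φ.sum_norm_sq_le S)
    rw [mul_left_comm, norm_mul, norm_timeExp, one_mul]

/-- The group `e^{-iAt}` on `H^s_{(0)}`. -/
def HZero.evolve {s : ℕ} (t : ℝ) (φ : HZero s) : HZero s := (HZero.exists_evolve t φ).choose

theorem HZero.coef_evolve {s : ℕ} (t : ℝ) (φ : HZero s) (j : ℕ+) :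
    inner ℂ (eigVec j) (HZero.evolve t φ).toL2 = timeExp j (-t) * inner ℂ (eigVec j) φ.toL2 :=
  (HZero.exists_evolve t φ).choose_spec j

theorem HZero.norm_evolve {s : ℕ} (t : ℝ) (φ : HZero s) : ‖HZero.evolve t φ‖ = ‖φ‖ := by
  have h := (HZero.evolve t φ).hasSum_norm_sq
  simp only [HZero.coef_evolve, mul_left_comm _ (timeExp _ (-t)), norm_mul, norm_timeExp,
    one_mul] at h
  have h2 := φ.hasSum_norm_sq
  simp only [norm_mul] at h2
  have := h.unique h2
  exact (pow_left_inj₀ (norm_nonneg _) (norm_nonneg _) two_ne_zero).1 this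

theorem HZero.coef_sub {s : ℕ} (φ ψ : HZero s) (j : ℕ+) :
    inner ℂ (eigVec j) (φ - ψ).toL2 =
      inner ℂ (eigVec j) φ.toL2 - inner ℂ (eigVec j) ψ.toL2 := by
  rw [map_sub, inner_sub_right]

theorem HZero.evolve_sub {s : ℕ} (t : ℝ) (φ ψ : HZero s) :
    HZero.evolve t (φ - ψ) = HZero.evolve t φ - HZero.evolve t ψ :=
  HZero.ext_coef fun j => by
    rw [HZero.coef_sub, HZero.coef_evolve, HZero.coef_evolve, HZero.coef_evolve, HZero.coef_sub,
      mul_sub]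

/-- Dominated convergence in the coefficient series: the factors |e^{-iλ_jt} - e^{-iλ_jt₀}| tend to
0 for each j and are at most 2. -/
theorem HZero.continuous_evolve_left {s : ℕ} (φ : HZero s) :
    Continuous fun t => HZero.evolve t φ := by
  rw [continuous_iff_continuousAt]
  intro t₀
  rw [ContinuousAt, tendsto_iff_norm_sub_tendsto_zero]
  have h1 : ∀ t, ∑' j : ℕ+, (‖timeExp j (-t) - timeExp j (-t₀)‖
      * ‖(j : ℂ) ^ s * inner ℂ (eigVec j) φ.toL2‖) ^ 2
      = ‖HZero.evolve t φ - HZero.evolve t₀ φ‖ ^ 2 := by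
    intro t
    rw [← (HZero.evolve t φ - HZero.evolve t₀ φ).hasSum_norm_sq.tsum_eq]
    refine tsum_congr fun j => ?_
    rw [HZero.coef_sub, HZero.coef_evolve, HZero.coef_evolve, ← sub_mul, mul_left_comm, ← norm_mul]
  have h2 : Tendsto (fun t => ∑' j : ℕ+, (‖timeExp j (-t) - timeExp j (-t₀)‖
      * ‖(j : ℂ) ^ s * inner ℂ (eigVec j) φ.toL2‖) ^ 2) (𝓝 t₀) (𝓝 (∑' _ : ℕ+, (0:ℝ))) := by
    refine tendsto_tsum_of_dominated_convergence (φ.hasSum_norm_sq.summable.mul_left 4)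
      (fun j => ?_) (Eventually.of_forall fun t j => ?_)
    · have hc : Continuous fun t => (‖timeExp j (-t) - timeExp j (-t₀)‖
          * ‖(j : ℂ) ^ s * inner ℂ (eigVec j) φ.toL2‖) ^ 2 :=
        (((((continuous_timeExp j).comp continuous_neg).sub continuous_const).norm).mul
          continuous_const).pow 2
      simpa using hc.tendsto t₀
    · rw [Real.norm_of_nonneg (by positivity), mul_pow]
      refine mul_le_mul_of_nonneg_right ?_ (by positivity)
      have : ‖timeExp j (-t) - timeExp j (-t₀)‖ ≤ 2 := by
        refine (norm_sub_le _ _).trans ?_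
        rw [norm_timeExp, norm_timeExp]; norm_num
      nlinarith [norm_nonneg (timeExp j (-t) - timeExp j (-t₀))]
  rw [tsum_zero] at h2
  simp_rw [h1] at h2
  have h3 := h2.sqrt
  simpa [Real.sqrt_sq] using h3

/-- The group is isometric, so the variation of θ costs nothing and strong continuity at the fixed
vector θ(t₀) is enough. -/
theorem HZero.continuous_evolve {s : ℕ} {θ : ℝ → HZero s} (hθ : Continuous θ) :
    Continuous fun t => HZero.evolve t (θ t) := by
  rw [continuous_iff_continuousAt]
  intro t₀
  rw [ContinuousAt, tendsto_iff_norm_sub_tendsto_zero]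
  have h1 := (tendsto_iff_norm_sub_tendsto_zero.1 (hθ.tendsto t₀)).add
    (tendsto_iff_norm_sub_tendsto_zero.1 ((HZero.continuous_evolve_left (θ t₀)).tendsto t₀))
  rw [add_zero] at h1
  refine squeeze_zero (fun _ => norm_nonneg _) (fun t => ?_) h1
  rw [← HZero.norm_evolve t (θ t - θ t₀), HZero.evolve_sub]
  exact norm_sub_le_norm_sub_add_norm_sub _ _ _

theorem inner_schrodingerGroup (t : ℝ) (φ : L2 ℂ 0 1) (j : ℕ+) :
    inner ℂ (eigVec j) (schrodingerGroup t φ) = timeExp j (-t) * inner ℂ (eigVec j) φ := by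
  have h := (hasSum_schrodingerGroup t φ).mapL (innerSL ℂ (eigVec j))
  have h2 := hasSum_ite_eq j (timeExp j (-t) * inner ℂ (eigVec j) φ)
  refine h.unique (h2.congr_fun fun i => ?_)
  rw [innerSL_apply_apply, inner_smul_right, orthonormal_iff_ite.1 orthonormal_eigVec j i]
  by_cases hij : i = j
  · subst hij
    simp only [if_true, mul_one, timeExp]
    congr 2
    push_cast; ring
  · rw [if_neg (Ne.symm hij), if_neg hij, mul_zero]

theorem timeExp_neg_mul (j : ℕ+) (t τ : ℝ) :
    timeExp j (-t) * timeExp j τ = timeExp j (-(t - τ)) := by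
  simp only [timeExp]
  rw [← Complex.exp_add]
  congr 1
  push_cast; ring

end Evolution

/-! ### Duhamel terms as continuous functions with values in H^{2p+3}_{(0)}. -/

section Duhamel

/-- The Duhamel term: `θ(t) = i ∫₀ᵗ e^{-iA(t-τ)} F(τ) dτ`, as a continuous function with values in
`H^{2p+3}_{(0)}`. -/
structure IsDuhamel {p : ℕ} (T : ℝ) (F : ℝ → InterSpace (2 * p + 3) (2 * p + 1))
    (θ : ℝ → HZero (2 * p + 3)) : Prop where
  continuous : Continuous θ
  coef : ∀ t ∈ Icc 0 T, ∀ j, inner ℂ (eigVec j) (θ t).toL2 =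
    Complex.I * ∫ τ in (0:ℝ)..t, timeExp j (-(t - τ)) * inner ℂ (eigVec j) (F τ).toL2

/-- With e^{-iAt} factored out, there remains d(t) = ∫₀ᵗ e^{iAτ} F(τ) dτ, defined through its
coefficients because F(τ) itself need not lie in H^{2p+3}_{(0)}. The smoothing estimate on [s,t]
gives ‖d(t) - d(s)‖² ≤ C ∫_s^t ‖F‖², hence the continuity of d and the bound. -/
theorem exists_isDuhamel (p : ℕ) {T : ℝ} (hT : 0 ≤ T) : ∃ C : ℝ, 0 ≤ C ∧
    ∀ F : ℝ → InterSpace (2 * p + 3) (2 * p + 1), MemLp F 2 (volume.restrict (Ioo 0 T)) →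
      ∃ θ, IsDuhamel T F θ ∧ ∀ t ∈ Icc 0 T, ‖θ t‖ ^ 2 ≤ C * ∫ τ in (0:ℝ)..t, ‖F τ‖ ^ 2 := by
  obtain ⟨C, hC, hS⟩ := sum_sq_norm_duhamel_le p hT
  refine ⟨C, hC, fun F hF => ?_⟩
  have hmem : ∀ s t, 0 ≤ s → t ≤ T → MemLp F 2 (volume.restrict (Ioo s t)) :=
    fun s t h1 h2 => MemLp.mono_Ioo hF h1 h2
  have hii : ∀ j : ℕ+, IntervalIntegrable
      (fun τ => timeExp j τ * inner ℂ (eigVec j) (F τ).toL2) volume 0 T := fun j =>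
    MemLp.intervalIntegrable_Ioo hT (MemLp.timeExp_mul j
      ((InterSpace.coefCLM (2 * p + 3) (2 * p + 1) j).comp_memLp' hF))
  have h0 : (0:ℝ) ∈ Icc 0 T := ⟨le_rfl, hT⟩
  have hex : ∀ t : Icc 0 T, ∃ φ : HZero (2 * p + 3), ∀ j, inner ℂ (eigVec j) φ.toL2 =
      ∫ τ in (0:ℝ)..t, timeExp j τ * inner ℂ (eigVec j) (F τ).toL2 := fun t =>
    HZero.exists_coef _ _ fun S => hS 0 t le_rfl t.2.1 t.2.2 F (hmem 0 t le_rfl t.2.2) S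
  choose d hd using hex
  set ρ : ℝ → ℝ := fun t => 0 + ∫ τ in (0:ℝ)..t, ‖F τ‖ ^ 2 with hρ
  have hρp : IsPrimitive 0 T ρ (fun τ => ‖F τ‖ ^ 2) :=
    IsPrimitive.of_integral 0 (intervalIntegrable_of_integrable_Ioo hT (integrable_norm_sq hF))
  have hdiff : ∀ s t : Icc 0 T, s ≤ t → ‖d t - d s‖ ^ 2 ≤ C * (ρ t - ρ s) := by
    intro s t hst
    rw [hρp.sub_eq s.2 t.2]
    refine HZero.norm_sq_le _ fun S => ?_
    refine le_trans (le_of_eq (Finset.sum_congr rfl fun j _ => ?_))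
      (hS s t s.2.1 hst t.2.2 F (hmem s t s.2.1 t.2.2) S)
    rw [HZero.coef_sub, hd, hd, intervalIntegral.integral_interval_sub_left
      (intervalIntegrable_mono_Icc (hii j) h0 t.2) (intervalIntegrable_mono_Icc (hii j) h0 s.2)]
  have hdiff' : ∀ s t : Icc 0 T, ‖d t - d s‖ ≤ Real.sqrt (C * |ρ t - ρ s|) := by
    intro s t
    refine Real.le_sqrt_of_sq_le ?_
    rcases le_total s t with h | h
    · exact (hdiff s t h).trans (mul_le_mul_of_nonneg_left (le_abs_self _) hC)
    · rw [norm_sub_rev, abs_sub_comm]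
      exact (hdiff t s h).trans (mul_le_mul_of_nonneg_left (le_abs_self _) hC)
  have hρc : Continuous fun t : Icc 0 T => ρ t :=
    continuousOn_iff_continuous_domRestrict.1 (hρp.continuousOn hT)
  have hdc : Continuous d := by
    rw [continuous_iff_continuousAt]
    intro t₀
    rw [ContinuousAt, tendsto_iff_norm_sub_tendsto_zero]
    have h1 : Continuous fun t : Icc 0 T => Real.sqrt (C * |ρ t - ρ t₀|) :=
      Real.continuous_sqrt.comp (continuous_const.mul (hρc.sub continuous_const).abs)
    have h2 := h1.tendsto t₀
    simp only [sub_self, abs_zero, mul_zero, Real.sqrt_zero] at h2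
    exact squeeze_zero (fun _ => norm_nonneg _) (fun t => hdiff' t₀ t) h2
  -- The projection onto [0,T] extends d by constants, so that the Duhamel term is continuous on all
  -- of ℝ.
  refine ⟨fun t => Complex.I • HZero.evolve t (d (projIcc 0 T hT t)), ⟨?_, ?_⟩, ?_⟩
  · exact (HZero.continuous_evolve (hdc.comp continuous_projIcc)).const_smul Complex.I
  · intro t ht j
    rw [map_smul, inner_smul_right, HZero.coef_evolve, projIcc_of_mem hT ht, hd,
      ← intervalIntegral.integral_const_mul]
    congr 1
    refine intervalIntegral.integral_congr fun τ _ => ?_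
    show _ = timeExp j (-(t - τ)) * inner ℂ (eigVec j) (F τ).toL2
    rw [← mul_assoc, timeExp_neg_mul]
  · intro t ht
    rw [norm_smul, Complex.norm_I, one_mul, HZero.norm_evolve, projIcc_of_mem hT ht]
    have h1 := hdiff ⟨0, h0⟩ ⟨t, ht⟩ ht.1
    have h2 : d ⟨0, h0⟩ = 0 := HZero.ext_coef fun j => by simp [hd]
    rw [h2, sub_zero] at h1
    simpa [hρ] using h1

theorem IsDuhamel.eqOn {p : ℕ} {T : ℝ} {F F' : ℝ → InterSpace (2 * p + 3) (2 * p + 1)}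
    {θ θ' : ℝ → HZero (2 * p + 3)} (h : IsDuhamel T F θ) (h' : IsDuhamel T F' θ')
    (hF : F =ᵐ[volume.restrict (Ioo 0 T)] F') : EqOn θ θ' (Icc 0 T) := by
  intro t ht
  refine HZero.ext_coef fun j => ?_
  rw [h.coef t ht, h'.coef t ht, ← integral_Ioo_eq_interval ht.1, ← integral_Ioo_eq_interval ht.1]
  congr 1
  refine integral_congr_ae ?_
  filter_upwards [ae_restrict_of_ae_restrict_of_subset (Ioo_subset_Ioo le_rfl ht.2) hF] with τ hτ
  rw [hτ]

/-- This replaces linearity of the Duhamel map, which is later obtained by choice and need not be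
linear outside [0,T]. -/
theorem IsDuhamel.sub {p : ℕ} {T : ℝ}
    {F F' : ℝ → InterSpace (2 * p + 3) (2 * p + 1)}
    (hF : MemLp F 2 (volume.restrict (Ioo 0 T))) (hF' : MemLp F' 2 (volume.restrict (Ioo 0 T)))
    {θ θ' : ℝ → HZero (2 * p + 3)} (h : IsDuhamel T F θ) (h' : IsDuhamel T F' θ') :
    IsDuhamel T (fun τ => F τ - F' τ) (fun t => θ t - θ' t) := by
  refine ⟨h.continuous.sub h'.continuous, fun t ht j => ?_⟩
  have hii : ∀ {F : ℝ → InterSpace (2 * p + 3) (2 * p + 1)},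
      MemLp F 2 (volume.restrict (Ioo 0 T)) → IntervalIntegrable
      (fun τ => timeExp j (-(t - τ)) * inner ℂ (eigVec j) (F τ).toL2) volume 0 t := fun hF => by
    have h1 : IntervalIntegrable (fun τ => inner ℂ (eigVec j) (_ : L2 ℂ 0 1)) volume 0 t :=
      MemLp.intervalIntegrable_Ioo ht.1
      ((InterSpace.coefCLM (2 * p + 3) (2 * p + 1) j).comp_memLp' (MemLp.mono_Ioo hF le_rfl ht.2))
    exact h1.continuousOn_mul (((continuous_timeExp j).comp (by fun_prop)).continuousOn)
  rw [HZero.coef_sub, h.coef t ht, h'.coef t ht, ← mul_sub,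
    ← intervalIntegral.integral_sub (hii hF) (hii hF')]
  congr 1
  refine intervalIntegral.integral_congr fun τ _ => ?_
  have : inner ℂ (eigVec j) (F τ - F' τ).toL2 =
      inner ℂ (eigVec j) (F τ).toL2 - inner ℂ (eigVec j) (F' τ).toL2 :=
    map_sub (InterSpace.coefCLM (2 * p + 3) (2 * p + 1) j) _ _
  simp only [this, mul_sub]

end Duhamel

/-! ### Fixed points of Volterra maps with an integrable weight. -/

section Volterra

/-- With w = ∫ m, the function m e^{2w} is almost everywhere half the derivative of the monotone
function e^{2w}, and the integral of that derivative is at most the increment. The factor 1/2 is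
then bounded by (3/4)². -/
theorem integral_mul_exp_primitive_le {T : ℝ} {m : ℝ → ℝ} (hm : IntervalIntegrable m volume 0 T)
    (hm0 : ∀ t, 0 ≤ m t) (D : ℝ) {t : ℝ} (ht : t ∈ Icc 0 T) :
    ∫ τ in (0:ℝ)..t, m τ * (D * Real.exp (∫ σ in (0:ℝ)..τ, m σ)) ^ 2 ≤
      (3 / 4 * (D * Real.exp (∫ σ in (0:ℝ)..t, m σ))) ^ 2 := by
  have h0 : (0:ℝ) ∈ Icc 0 T := ⟨le_rfl, ht.1.trans ht.2⟩
  have hmt := intervalIntegrable_mono_Icc hm h0 ht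
  set w : ℝ → ℝ := fun τ => ∫ σ in (0:ℝ)..τ, m σ with hw
  have hp : IsPrimitive 0 t w m := by
    simpa [hw] using IsPrimitive.of_integral (0:ℝ) hmt
  have hmono : MonotoneOn (fun τ => Real.exp (2 * w τ)) (uIcc 0 t) := by
    rw [uIcc_of_le ht.1]
    intro x hx y hy hxy
    refine Real.exp_le_exp.2 ?_
    have h1 := hp.sub_eq hx hy
    have h2 : 0 ≤ ∫ σ in x..y, m σ := intervalIntegral.integral_nonneg hxy fun σ _ => hm0 σ
    linarith
  have hI := hmono.intervalIntegral_deriv_mem_uIcc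
  have hle : Real.exp (2 * w 0) ≤ Real.exp (2 * w t) := hmono left_mem_uIcc right_mem_uIcc ht.1
  rw [uIcc_of_le (sub_nonneg.2 hle)] at hI
  have hd : ∫ τ in (0:ℝ)..t, deriv (fun τ => Real.exp (2 * w τ)) τ =
      ∫ τ in (0:ℝ)..t, 2 * (m τ * Real.exp (w τ) ^ 2) := by
    refine intervalIntegral.integral_congr_ae ?_
    filter_upwards [hp.ae_hasDerivAt ht.1] with τ hτ hmem
    rw [uIoc_of_le ht.1] at hmem
    rw [((hτ (Ioc_subset_Icc_self hmem)).const_mul 2).exp.deriv, two_mul (w τ), Real.exp_add]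
    ring
  rw [hd, intervalIntegral.integral_const_mul] at hI
  have e1 : ∫ τ in (0:ℝ)..t, m τ * (D * Real.exp (w τ)) ^ 2 =
      D ^ 2 * ∫ τ in (0:ℝ)..t, m τ * Real.exp (w τ) ^ 2 := by
    rw [← intervalIntegral.integral_const_mul]
    congr 1; ext τ; ring
  rw [e1]
  have e2 : Real.exp (2 * w t) = Real.exp (w t) ^ 2 := by
    rw [two_mul, Real.exp_add]; ring
  have h3 : ∫ τ in (0:ℝ)..t, m τ * Real.exp (w τ) ^ 2 ≤ Real.exp (w t) ^ 2 / 2 := by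
    have := hI.2
    rw [e2] at this
    have := Real.exp_pos (2 * w 0)
    linarith
  nlinarith [mul_le_mul_of_nonneg_left h3 (sq_nonneg D),
    mul_nonneg (sq_nonneg D) (sq_nonneg (Real.exp (w t)))]

variable {Y : Type*} [NormedAddCommGroup Y]

/-- A map on continuous functions whose increments over `[0,t]` are controlled in a Volterra sense
by the integrable weight `m`. -/
structure IsVolterra (T : ℝ) (m : ℝ → ℝ) (Φ : (ℝ → Y) → ℝ → Y) : Prop where
  integrable : IntervalIntegrable m volume 0 T
  nonneg : ∀ t, 0 ≤ m t
  continuous : ∀ g, Continuous g → Continuous (Φ g)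
  norm_sub_sq_le : ∀ g h, Continuous g → Continuous h → ∀ ρ : ℝ → ℝ,
    ContinuousOn ρ (Icc 0 T) → MonotoneOn ρ (Icc 0 T) → (∀ t ∈ Icc 0 T, ‖g t - h t‖ ≤ ρ t) →
    ∀ t ∈ Icc 0 T, ‖Φ g t - Φ h t‖ ^ 2 ≤ ∫ τ in (0:ℝ)..t, m τ * ρ τ ^ 2

variable {T : ℝ} {m : ℝ → ℝ} {Φ : (ℝ → Y) → ℝ → Y}

/-- Contraction by 3/4 for the norm sup_t e^{-∫₀ᵗ m} ‖·‖: the comparison function D e^{∫ m} is an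
admissible monotone ρ. -/
theorem IsVolterra.norm_sub_le (hV : IsVolterra T m Φ) (hT : 0 ≤ T) {g h : ℝ → Y}
    (hg : Continuous g) (hh : Continuous h) {D : ℝ} (hD : 0 ≤ D)
    (H : ∀ t ∈ Icc 0 T, ‖g t - h t‖ ≤ D * Real.exp (∫ σ in (0:ℝ)..t, m σ)) :
    ∀ t ∈ Icc 0 T, ‖Φ g t - Φ h t‖ ≤ 3 / 4 * (D * Real.exp (∫ σ in (0:ℝ)..t, m σ)) := by
  intro t ht
  have hp : IsPrimitive 0 T (fun τ => ∫ σ in (0:ℝ)..τ, m σ) m := by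
    simpa using IsPrimitive.of_integral (0:ℝ) hV.integrable
  have hc : ContinuousOn (fun τ => D * Real.exp (∫ σ in (0:ℝ)..τ, m σ)) (Icc 0 T) :=
    continuousOn_const.mul (hp.continuousOn hT).rexp
  have hmono : MonotoneOn (fun τ => D * Real.exp (∫ σ in (0:ℝ)..τ, m σ)) (Icc 0 T) := by
    intro x hx y hy hxy
    refine mul_le_mul_of_nonneg_left (Real.exp_le_exp.2 ?_) hD
    have h1 := hp.sub_eq hx hy
    have h2 : 0 ≤ ∫ σ in x..y, m σ :=
      intervalIntegral.integral_nonneg hxy fun σ _ => hV.nonneg σ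
    simp only at h1
    linarith
  refine le_of_sq_le_sq ?_ (by positivity)
  exact (hV.norm_sub_sq_le g h hg hh _ hc hmono H t ht).trans
    (integral_mul_exp_primitive_le hV.integrable hV.nonneg D ht)

/-- D is the weighted supremum of ‖g‖, attained at t₀ by compactness. -/
theorem IsVolterra.exists_weight (hV : IsVolterra T m Φ) (hT : 0 ≤ T) {g : ℝ → Y}
    (hg : Continuous g) : ∃ t₀ ∈ Icc 0 T, ∃ D, 0 ≤ D ∧
      ‖g t₀‖ = D * Real.exp (∫ σ in (0:ℝ)..t₀, m σ) ∧
      ∀ t ∈ Icc 0 T, ‖g t‖ ≤ D * Real.exp (∫ σ in (0:ℝ)..t, m σ) := by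
  have hp : IsPrimitive 0 T (fun τ => ∫ σ in (0:ℝ)..τ, m σ) m := by
    simpa using IsPrimitive.of_integral (0:ℝ) hV.integrable
  have hc : ContinuousOn (fun τ => Real.exp (-∫ σ in (0:ℝ)..τ, m σ) * ‖g τ‖) (Icc 0 T) :=
    (hp.continuousOn hT).neg.rexp.mul hg.norm.continuousOn
  obtain ⟨t₀, ht₀, hmax⟩ := isCompact_Icc.exists_isMaxOn ⟨0, le_rfl, hT⟩ hc
  refine ⟨t₀, ht₀, Real.exp (-∫ σ in (0:ℝ)..t₀, m σ) * ‖g t₀‖, by positivity, ?_, fun t ht => ?_⟩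
  · rw [mul_right_comm, ← Real.exp_add]; simp
  · have h1 : Real.exp (-∫ σ in (0:ℝ)..t, m σ) * ‖g t‖ ≤ _ := hmax ht
    have h2 := mul_le_mul_of_nonneg_right h1 (Real.exp_pos (∫ σ in (0:ℝ)..t, m σ)).le
    rwa [mul_right_comm, ← Real.exp_add, neg_add_cancel, Real.exp_zero, one_mul] at h2

theorem IsVolterra.integral_nonneg (hV : IsVolterra T m Φ) {t : ℝ} (ht : t ∈ Icc 0 T) :
    0 ≤ ∫ σ in (0:ℝ)..t, m σ :=
  intervalIntegral.integral_nonneg ht.1 fun σ _ => hV.nonneg σ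

theorem IsVolterra.integral_le (hV : IsVolterra T m Φ) {t : ℝ} (ht : t ∈ Icc 0 T) :
    ∫ σ in (0:ℝ)..t, m σ ≤ ∫ σ in (0:ℝ)..T, m σ := by
  have hp : IsPrimitive 0 T (fun τ => ∫ σ in (0:ℝ)..τ, m σ) m := by
    simpa using IsPrimitive.of_integral (0:ℝ) hV.integrable
  have h1 := hp.sub_eq ht ⟨ht.1.trans ht.2, le_rfl⟩
  have h2 : 0 ≤ ∫ σ in t..T, m σ :=
    intervalIntegral.integral_nonneg ht.2 fun σ _ => hV.nonneg σ
  simp only at h1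
  linarith

/-- Where the weighted supremum D is attained, contraction gives D e^w ≤ (3/4) D e^w + B with e^w ≥
1, so D ≤ 4B. -/
theorem IsVolterra.norm_le (hV : IsVolterra T m Φ) (hT : 0 ≤ T) {g : ℝ → Y} (hg : Continuous g)
    (hfix : ∀ t ∈ Icc 0 T, g t = Φ g t) {B : ℝ} (hB : ∀ t ∈ Icc 0 T, ‖Φ 0 t‖ ≤ B) :
    ∀ t ∈ Icc 0 T, ‖g t‖ ≤ 4 * B * Real.exp (∫ σ in (0:ℝ)..T, m σ) := by
  intro t ht
  obtain ⟨t₀, ht₀, D, hD, h1, h2⟩ := hV.exists_weight hT hg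
  have h3 := hV.norm_sub_le hT hg (h := 0) continuous_const hD (by simpa using h2) t₀ ht₀
  have h4 : ‖g t₀‖ ≤ ‖Φ g t₀ - Φ 0 t₀‖ + ‖Φ 0 t₀‖ := by
    conv_lhs => rw [hfix t₀ ht₀]
    simpa using norm_add_le (Φ g t₀ - Φ 0 t₀) (Φ 0 t₀)
  have h5 := hB t₀ ht₀
  have h6 : 1 ≤ Real.exp (∫ σ in (0:ℝ)..t₀, m σ) := Real.one_le_exp (hV.integral_nonneg ht₀)
  have h7 : D ≤ 4 * B := by nlinarith
  have h8 := hV.integral_le ht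
  exact (h2 t ht).trans (mul_le_mul h7 (Real.exp_le_exp.2 h8) (Real.exp_pos _).le (hD.trans h7))

theorem IsVolterra.eqOn (hV : IsVolterra T m Φ) (hT : 0 ≤ T) {g h : ℝ → Y} (hg : Continuous g)
    (hh : Continuous h) (hgf : ∀ t ∈ Icc 0 T, g t = Φ g t) (hhf : ∀ t ∈ Icc 0 T, h t = Φ h t) :
    EqOn g h (Icc 0 T) := by
  intro t ht
  obtain ⟨t₀, ht₀, D, hD, h1, h2⟩ := hV.exists_weight hT (hg.sub hh)
  have h3 := hV.norm_sub_le hT hg hh hD h2 t₀ ht₀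
  rw [← hgf t₀ ht₀, ← hhf t₀ ht₀] at h3
  have h6 := Real.exp_pos (∫ σ in (0:ℝ)..t₀, m σ)
  have h1' : ‖g t₀ - h t₀‖ = D * Real.exp (∫ σ in (0:ℝ)..t₀, m σ) := h1
  have h7 : D = 0 := by
    refine le_antisymm ?_ hD
    by_contra hlt
    have := mul_pos (not_le.1 hlt) h6
    linarith
  have h8 : ‖g t - h t‖ ≤ D * _ := h2 t ht
  rw [h7, zero_mul] at h8
  exact sub_eq_zero.1 (norm_le_zero_iff.1 h8)

/-- Banach's theorem for h ↦ e^{-w} Φ(e^w h): the conjugation turns the weighted norm into the sup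
norm of C([0,T], Y). -/
theorem IsVolterra.exists_fixed [NormedSpace ℝ Y] [CompleteSpace Y] (hV : IsVolterra T m Φ) (hT : 0 ≤ T) :
    ∃ g, Continuous g ∧ ∀ t ∈ Icc 0 T, g t = Φ g t := by
  have hp : IsPrimitive 0 T (fun τ => ∫ σ in (0:ℝ)..τ, m σ) m := by
    simpa using IsPrimitive.of_integral (0:ℝ) hV.integrable
  set w : ℝ → ℝ := fun τ => ∫ σ in (0:ℝ)..τ, m σ with hw
  have hwc : Continuous fun t : Icc 0 T => w t :=
    continuousOn_iff_continuous_domRestrict.1 (hp.continuousOn hT)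
  let ext : C(Icc (0:ℝ) T, Y) → ℝ → Y := fun h t =>
    Real.exp (w (projIcc 0 T hT t)) • h (projIcc 0 T hT t)
  have hext : ∀ h, Continuous (ext h) := fun h =>
    ((hwc.comp continuous_projIcc).rexp).smul (h.continuous.comp continuous_projIcc)
  have hextv : ∀ h (t : Icc 0 T), ext h t = Real.exp (w t) • h t := fun h t => by
    simp only [ext, projIcc_val]
  let Ψ : C(Icc (0:ℝ) T, Y) → C(Icc (0:ℝ) T, Y) := fun h =>
    ⟨fun t => Real.exp (-w t) • Φ (ext h) t,
      hwc.neg.rexp.smul ((hV.continuous _ (hext h)).comp continuous_subtype_val)⟩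
  have hcontr : ContractingWith (3 / 4 : NNReal) Ψ := by
    refine ⟨by rw [← NNReal.coe_lt_coe]; norm_num, LipschitzWith.of_dist_le_mul fun g h => ?_⟩
    rw [ContinuousMap.dist_le (by positivity)]
    intro t
    have h1 : ∀ s ∈ Icc 0 T, ‖ext g s - ext h s‖ ≤ dist g h * Real.exp (w s) := by
      intro s hs
      rw [hextv g ⟨s, hs⟩, hextv h ⟨s, hs⟩, ← smul_sub, norm_smul, Real.norm_of_nonneg
        (Real.exp_pos _).le, mul_comm, ← dist_eq_norm]
      exact mul_le_mul_of_nonneg_right (ContinuousMap.dist_apply_le_dist _) (Real.exp_pos _).le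
    have h2 := hV.norm_sub_le hT (hext g) (hext h) dist_nonneg h1 t t.2
    show dist (Real.exp (-w t) • Φ (ext g) t) (Real.exp (-w t) • Φ (ext h) t) ≤ _
    rw [dist_eq_norm, ← smul_sub, norm_smul, Real.norm_of_nonneg (Real.exp_pos _).le]
    refine (mul_le_mul_of_nonneg_left h2 (Real.exp_pos _).le).trans (le_of_eq ?_)
    have h3 : Real.exp (-w t) * Real.exp (w t) = 1 := by rw [← Real.exp_add]; simp
    push_cast
    linear_combination (3 / 4 * dist g h) * h3
  set h := ContractingWith.fixedPoint Ψ hcontr with hh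
  have hfix : Ψ h = h := hcontr.fixedPoint_isFixedPt
  refine ⟨ext h, hext h, fun t ht => ?_⟩
  have h4 : Real.exp (-w t) • Φ (ext h) t = h ⟨t, ht⟩ :=
    congrArg (fun q : C(Icc (0:ℝ) T, Y) => q ⟨t, ht⟩) hfix
  rw [hextv h ⟨t, ht⟩, ← h4, smul_smul, ← Real.exp_add]
  simp

end Volterra

/-! ### Recovering a function from its last time derivative. -/

section IteratedPrimitive

variable {Y : Type*} [NormedAddCommGroup Y] [NormedSpace ℝ Y] {T : ℝ}

/-- The iterated primitives of `g` from `0`, with initial values `c`. -/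
def iterPrim (c : ℕ → Y) (g : ℝ → Y) : ℕ → ℝ → Y
  | 0 => g
  | q + 1 => fun t => c (q + 1) + ∫ τ in (0:ℝ)..t, iterPrim c g q τ

theorem continuous_iterPrim [CompleteSpace Y] (c : ℕ → Y) {g : ℝ → Y} (hg : Continuous g) (q : ℕ) :
    Continuous (iterPrim c g q) := by
  induction q with
  | zero => exact hg
  | succ q ih =>
    exact continuous_const.add
      (intervalIntegral.continuous_primitive (fun a b => ih.intervalIntegrable a b) 0)

theorem hasDerivAt_iterPrim [CompleteSpace Y] (c : ℕ → Y) {g : ℝ → Y} (hg : Continuous g) (q : ℕ)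
    (t : ℝ) : HasDerivAt (iterPrim c g (q + 1)) (iterPrim c g q t) t := by
  have h := continuous_iterPrim c hg q
  exact (intervalIntegral.integral_hasDerivAt_right (h.intervalIntegrable _ _)
    (h.stronglyMeasurableAtFilter _ _) h.continuousAt).const_add _

theorem deriv_iterPrim [CompleteSpace Y] (c : ℕ → Y) {g : ℝ → Y} (hg : Continuous g) (q : ℕ) :
    deriv (iterPrim c g (q + 1)) = iterPrim c g q :=
  funext fun t => (hasDerivAt_iterPrim c hg q t).deriv

theorem contDiff_iterPrim [CompleteSpace Y] (c : ℕ → Y) {g : ℝ → Y} (hg : Continuous g) (q : ℕ) :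
    ContDiff ℝ q (iterPrim c g q) := by
  induction q with
  | zero => exact contDiff_zero.2 hg
  | succ q ih =>
    push_cast
    rw [contDiff_succ_iff_deriv]
    refine ⟨fun t => (hasDerivAt_iterPrim c hg q t).differentiableAt, fun h => ?_, ?_⟩
    · simp at h
    · rwa [deriv_iterPrim c hg]

theorem iteratedDeriv_iterPrim [CompleteSpace Y] (c : ℕ → Y) {g : ℝ → Y} (hg : Continuous g)
    (n q : ℕ) : iteratedDeriv n (iterPrim c g (q + n)) = iterPrim c g q := by
  induction n with
  | zero => simp
  | succ n ih => rw [iteratedDeriv_succ', ← add_assoc, deriv_iterPrim c hg, ih]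

theorem iteratedDerivWithin_iterPrim [CompleteSpace Y] (hT : 0 < T) (c : ℕ → Y) {g : ℝ → Y}
    (hg : Continuous g) {n k : ℕ} (hn : n ≤ k) {t : ℝ} (ht : t ∈ Icc 0 T) :
    iteratedDerivWithin n (iterPrim c g k) (Icc 0 T) t = iterPrim c g (k - n) t := by
  rw [iteratedDerivWithin_eq_iteratedDeriv (uniqueDiffOn_Icc hT)
    ((contDiff_iterPrim c hg k).of_le (by exact_mod_cast hn)).contDiffAt ht]
  conv_lhs => rw [show k = (k - n) + n by omega]
  rw [iteratedDeriv_iterPrim c hg]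

/-- Since ρ is monotone, the bound at time t dominates the integrand on all of [0,t], and a
primitive costs at most a factor T. This is why Volterra maps are tested against monotone ρ. -/
theorem norm_iterPrim_sub_le [CompleteSpace Y] (hT : 0 ≤ T) (c : ℕ → Y) {g h : ℝ → Y}
    (hg : Continuous g) (hh : Continuous h) {ρ : ℝ → ℝ} (hρ : MonotoneOn ρ (Icc 0 T))
    (H : ∀ t ∈ Icc 0 T, ‖g t - h t‖ ≤ ρ t) (q : ℕ) :
    ∀ t ∈ Icc 0 T, ‖iterPrim c g q t - iterPrim c h q t‖ ≤ (1 + T) ^ q * ρ t := by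
  induction q with
  | zero => simpa [iterPrim] using H
  | succ q ih =>
    intro t ht
    have hρ0 : 0 ≤ ρ t := (norm_nonneg _).trans (H t ht)
    simp only [iterPrim]
    rw [add_sub_add_left_eq_sub, ← intervalIntegral.integral_sub
      ((continuous_iterPrim c hg q).intervalIntegrable _ _)
      ((continuous_iterPrim c hh q).intervalIntegrable _ _)]
    have h1 : ∀ τ ∈ uIoc 0 t, ‖iterPrim c g q τ - iterPrim c h q τ‖ ≤ (1 + T) ^ q * ρ t := by
      intro τ hτ
      rw [uIoc_of_le ht.1] at hτ
      have hτm : τ ∈ Icc 0 T := ⟨hτ.1.le, hτ.2.trans ht.2⟩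
      exact (ih τ hτm).trans (mul_le_mul_of_nonneg_left (hρ hτm ht hτ.2) (by positivity))
    refine (intervalIntegral.norm_integral_le_of_norm_le_const h1).trans ?_
    rw [sub_zero, abs_of_nonneg ht.1, pow_succ, mul_right_comm]
    refine mul_le_mul_of_nonneg_right (mul_le_mul_of_nonneg_left ?_ (by positivity)) hρ0
    linarith [ht.2]

theorem norm_iterPrim_zero_le (hT : 0 ≤ T) {c : ℕ → Y} {A : ℝ} (hc : ∀ q, ‖c q‖ ≤ A) (q : ℕ) :
    ∀ t ∈ Icc 0 T, ‖iterPrim c 0 q t‖ ≤ (1 + T) ^ q * A := by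
  have hA : 0 ≤ A := (norm_nonneg _).trans (hc 0)
  induction q with
  | zero => simpa [iterPrim] using fun _ _ _ => hA
  | succ q ih =>
    intro t ht
    simp only [iterPrim]
    have h1 : ∀ τ ∈ uIoc 0 t, ‖iterPrim c 0 q τ‖ ≤ (1 + T) ^ q * A := by
      intro τ hτ
      rw [uIoc_of_le ht.1] at hτ
      exact ih τ ⟨hτ.1.le, hτ.2.trans ht.2⟩
    have h2 := intervalIntegral.norm_integral_le_of_norm_le_const h1
    rw [sub_zero, abs_of_nonneg ht.1] at h2
    have h3 : 1 ≤ (1 + T) ^ q := one_le_pow₀ (by linarith)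
    have h4 : A ≤ (1 + T) ^ q * A := le_mul_of_one_le_left hA h3
    have h5 : (1 + T) ^ q * A * t ≤ (1 + T) ^ q * A * T :=
      mul_le_mul_of_nonneg_left ht.2 (by positivity)
    refine (norm_add_le _ _).trans ((add_le_add (hc (q + 1)) h2).trans ?_)
    rw [pow_succ]
    nlinarith

theorem norm_iterPrim_le [CompleteSpace Y] (hT : 0 ≤ T) {c : ℕ → Y} {A G : ℝ} (hc : ∀ q, ‖c q‖ ≤ A)
    {g : ℝ → Y} (hg : Continuous g) (hG : ∀ t ∈ Icc 0 T, ‖g t‖ ≤ G) (q : ℕ) :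
    ∀ t ∈ Icc 0 T, ‖iterPrim c g q t‖ ≤ (1 + T) ^ q * (A + G) := by
  intro t ht
  have h1 := norm_iterPrim_sub_le hT c hg (h := 0) continuous_const
    (ρ := fun _ => G) (fun _ _ _ _ _ => le_rfl) (by simpa using hG) q t ht
  have h2 := norm_iterPrim_zero_le hT hc q t ht
  have h3 := norm_add_le (iterPrim c g q t - iterPrim c 0 q t) (iterPrim c 0 q t)
  rw [sub_add_cancel] at h3
  linarith

theorem isJet_iterPrim [CompleteSpace Y] (c : ℕ → Y) {g : ℝ → Y} (hg : Continuous g) (k : ℕ) :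
    IsJet 0 T k fun n => iterPrim c g (k - n) := by
  intro n hn
  have : k - n = (k - (n + 1)) + 1 := by omega
  simp only
  rw [this]
  exact isPrimitive_of_hasDerivAt (hasDerivAt_iterPrim c hg _) (continuous_iterPrim c hg _)

end IteratedPrimitive

/-! ### The differentiated source term and its weight. -/

section Source

variable {T : ℝ} {X Y : Type*} [NormedAddCommGroup X] [NormedSpace ℝ X]
  [NormedAddCommGroup Y] [NormedSpace ℝ Y]

/-- The `κ`-th derivative of the source `u μ ψ + f`, in terms of the derivatives `U` of `u` and `W`
of `f`, where `ψ` is the `κ`-th iterated primitive of `g`. -/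
def sourceFun (U : ℕ → ℝ → ℝ) (M : Y →L[ℝ] X) (W : ℕ → ℝ → X) (c : ℕ → Y) (κ : ℕ) (g : ℝ → Y)
    (τ : ℝ) : X :=
  leibnizProd U (fun n τ => M (iterPrim c g (κ - n) τ)) κ τ + W κ τ

/-- The weight controlling the dependence of `sourceFun` on `g`. -/
def sourceWeight (T : ℝ) (U : ℕ → ℝ → ℝ) (κ : ℕ) (τ : ℝ) : ℝ :=
  ∑ ij ∈ Finset.HasAntidiagonal.antidiagonal κ, κ.choose ij.1 * (1 + T) ^ ij.1 * |U ij.1 τ|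

theorem memLp_sourceWeight {U : ℕ → ℝ → ℝ} {κ : ℕ}
    (hU : ∀ l ≤ κ, MemLp (U l) 2 (volume.restrict (Ioo 0 T))) :
    MemLp (sourceWeight T U κ) 2 (volume.restrict (Ioo 0 T)) := by
  refine memLp_finsetSum _ fun ij hij => ?_
  have := Finset.HasAntidiagonal.mem_antidiagonal.1 hij
  exact (hU ij.1 (by omega)).norm.const_mul _

theorem memLp_sourceFun [CompleteSpace Y] {U : ℕ → ℝ → ℝ} (M : Y →L[ℝ] X) {W : ℕ → ℝ → X}
    (c : ℕ → Y) {κ : ℕ} (hU : ∀ l ≤ κ, MemLp (U l) 2 (volume.restrict (Ioo 0 T)))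
    (hW : MemLp (W κ) 2 (volume.restrict (Ioo 0 T))) {g : ℝ → Y} (hg : Continuous g) :
    MemLp (sourceFun U M W c κ g) 2 (volume.restrict (Ioo 0 T)) := by
  refine MemLp.add (memLp_finsetSum _ fun ij hij => ?_) hW
  have := Finset.HasAntidiagonal.mem_antidiagonal.1 hij
  simp only [← Nat.cast_smul_eq_nsmul ℝ]
  exact (MemLp.smul_continuousOn_Ioo (hU ij.1 (by omega))
    (M.continuous.comp (continuous_iterPrim c hg _)).continuousOn).const_smul _

/-- Differentiating U exactly l times leaves κ - l derivatives for ψ, which is the l-fold primitive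
of the top one: hence the factor (1+T)^l beside |U l| in the weight. -/
theorem norm_leibnizProd_le (U : ℕ → ℝ → ℝ) (M : Y →L[ℝ] X) (κ : ℕ) (J : ℕ → ℝ → Y)
    {r τ : ℝ} (hJ : ∀ l, ‖J l τ‖ ≤ (1 + T) ^ l * r) :
    ‖leibnizProd U (fun n τ => M (J (κ - n) τ)) κ τ‖ ≤ ‖M‖ * r * sourceWeight T U κ τ := by
  rw [leibnizProd, sourceWeight, Finset.mul_sum]
  refine norm_sum_le_of_le _ fun ij hij => ?_
  have := Finset.HasAntidiagonal.mem_antidiagonal.1 hij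
  rw [show κ - ij.2 = ij.1 by omega, ← Nat.cast_smul_eq_nsmul ℝ, norm_smul, norm_smul,
    Real.norm_natCast, Real.norm_eq_abs]
  have h1 := (M.le_opNorm (J ij.1 τ)).trans (mul_le_mul_of_nonneg_left (hJ ij.1) (norm_nonneg M))
  have h2 := mul_le_mul_of_nonneg_left h1
    (show 0 ≤ (κ.choose ij.1 : ℝ) * |U ij.1 τ| by positivity)
  linarith

theorem norm_sourceFun_sub_le [CompleteSpace Y] (hT : 0 ≤ T) (U : ℕ → ℝ → ℝ) (M : Y →L[ℝ] X)
    (W : ℕ → ℝ → X) (c : ℕ → Y) (κ : ℕ) {g h : ℝ → Y} (hg : Continuous g) (hh : Continuous h)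
    {ρ : ℝ → ℝ} (hρ : MonotoneOn ρ (Icc 0 T)) (H : ∀ t ∈ Icc 0 T, ‖g t - h t‖ ≤ ρ t) {τ : ℝ}
    (hτ : τ ∈ Icc 0 T) :
    ‖sourceFun U M W c κ g τ - sourceFun U M W c κ h τ‖ ≤ ‖M‖ * ρ τ * sourceWeight T U κ τ := by
  have e : sourceFun U M W c κ g τ - sourceFun U M W c κ h τ =
      leibnizProd U (fun n τ => M (iterPrim c g (κ - n) τ - iterPrim c h (κ - n) τ)) κ τ := by
    simp only [sourceFun, leibnizProd, add_sub_add_right_eq_sub, ← Finset.sum_sub_distrib, map_sub,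
      smul_sub]
  rw [e]
  exact norm_leibnizProd_le U M κ (fun l τ => iterPrim c g l τ - iterPrim c h l τ)
    fun l => norm_iterPrim_sub_le hT c hg hh hρ H l τ hτ

theorem norm_sourceFun_zero_le (hT : 0 ≤ T) (U : ℕ → ℝ → ℝ) (M : Y →L[ℝ] X) (W : ℕ → ℝ → X)
    {c : ℕ → Y} (κ : ℕ) {A : ℝ} (hc : ∀ q, ‖c q‖ ≤ A) {τ : ℝ} (hτ : τ ∈ Icc 0 T) :
    ‖sourceFun U M W c κ 0 τ‖ ≤ ‖M‖ * A * sourceWeight T U κ τ + ‖W κ τ‖ :=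
  (norm_add_le _ _).trans (add_le_add_left (norm_leibnizProd_le U M κ (iterPrim c 0)
    fun l => norm_iterPrim_zero_le hT hc l τ hτ) _)

/-- Poincaré's inequality, with U vanishing at the left end. -/
theorem integral_sq_le_of_isPrimitive (hT : 0 ≤ T) {U U' : ℝ → ℝ} (h : IsPrimitive 0 T U U')
    (h0 : U 0 = 0) (hU' : MemLp U' 2 (volume.restrict (Ioo 0 T))) :
    ∫ τ in (0:ℝ)..T, |U τ| ^ 2 ≤ T ^ 2 * ∫ τ in (0:ℝ)..T, |U' τ| ^ 2 := by
  have hi := intervalIntegrable_of_integrable_Ioo hT (integrable_norm_sq hU')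
  have hi2 : IntervalIntegrable (fun τ => |U τ| ^ 2) volume 0 T := by
    refine ContinuousOn.intervalIntegrable ?_
    rw [uIcc_of_le hT]
    exact ((h.continuousOn hT).abs).pow 2
  have h1 : ∀ τ ∈ Icc 0 T, |U τ| ^ 2 ≤ T * ∫ σ in (0:ℝ)..T, |U' σ| ^ 2 := by
    intro τ hτ
    rw [h.eq τ hτ, h0, zero_add]
    refine (sq_norm_integral_le hτ.1 (MemLp.mono_Ioo hU' le_rfl hτ.2)).trans ?_
    rw [sub_zero]
    refine mul_le_mul hτ.2 ?_ (intervalIntegral.integral_nonneg hτ.1 fun _ _ => by positivity) hT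
    exact intervalIntegral.integral_mono_interval le_rfl hτ.1 hτ.2
      (Eventually.of_forall fun _ => by positivity) hi
  refine (intervalIntegral.integral_mono_on hT hi2 (by simp) h1).trans (le_of_eq ?_)
  rw [intervalIntegral.integral_const, smul_eq_mul]
  ring

/-- Poincaré's inequality is iterated down from order κ, so that only the last derivative, whose
norm is the one bounded by R, remains. Cauchy–Schwarz over the κ+1 summands gives the factor κ+1. -/
theorem exists_integral_sourceWeight_sq_le (hT : 0 ≤ T) (κ : ℕ) : ∃ K : ℝ, 0 ≤ K ∧
    ∀ U : ℕ → ℝ → ℝ, IsJet 0 T κ U → (∀ l < κ, U l 0 = 0) →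
      (∀ l ≤ κ, MemLp (U l) 2 (volume.restrict (Ioo 0 T))) →
      ∫ τ in (0:ℝ)..T, sourceWeight T U κ τ ^ 2 ≤ K * ∫ τ in (0:ℝ)..T, |U κ τ| ^ 2 := by
  refine ⟨(κ + 1) * ∑ ij ∈ Finset.HasAntidiagonal.antidiagonal κ,
    ((κ.choose ij.1 * (1 + T) ^ ij.1) ^ 2 * (1 + T ^ 2) ^ κ), by positivity,
    fun U hJ h0 hU => ?_⟩
  set N := ∫ τ in (0:ℝ)..T, |U κ τ| ^ 2 with hN
  have hN0 : 0 ≤ N := intervalIntegral.integral_nonneg hT fun _ _ => by positivity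
  have hUl : ∀ q ≤ κ, ∫ τ in (0:ℝ)..T, |U (κ - q) τ| ^ 2 ≤ (1 + T ^ 2) ^ q * N := by
    intro q hq
    induction q with
    | zero => simp [hN]
    | succ q ih =>
      have h1 := integral_sq_le_of_isPrimitive hT (hJ (κ - (q + 1)) (by omega)) (h0 _ (by omega))
        (hU _ (by omega))
      rw [show κ - (q + 1) + 1 = κ - q by omega] at h1
      have h2 := ih (by omega)
      have h3 : 0 ≤ (1 + T ^ 2) ^ q * N := by positivity
      rw [pow_succ]
      nlinarith [mul_le_mul_of_nonneg_left h2 (sq_nonneg T)]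
  have hint : ∀ ij ∈ Finset.HasAntidiagonal.antidiagonal κ, IntervalIntegrable
      (fun τ => (κ.choose ij.1 * (1 + T) ^ ij.1 : ℝ) ^ 2 * |U ij.1 τ| ^ 2) volume 0 T := by
    intro ij hij
    have := Finset.HasAntidiagonal.mem_antidiagonal.1 hij
    exact (intervalIntegrable_of_integrable_Ioo hT
      (integrable_norm_sq (hU ij.1 (by omega)))).const_mul _
  have hpt : ∀ τ, sourceWeight T U κ τ ^ 2 ≤ (κ + 1) *
      ∑ ij ∈ Finset.HasAntidiagonal.antidiagonal κ,
        (κ.choose ij.1 * (1 + T) ^ ij.1 : ℝ) ^ 2 * |U ij.1 τ| ^ 2 := by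
    intro τ
    refine sq_sum_le_card_mul_sum_sq.trans (le_of_eq ?_)
    rw [Finset.Nat.card_antidiagonal]
    push_cast
    simp only [mul_pow]
  have hsumi : IntervalIntegrable (fun τ => ∑ ij ∈ Finset.HasAntidiagonal.antidiagonal κ,
      (κ.choose ij.1 * (1 + T) ^ ij.1 : ℝ) ^ 2 * |U ij.1 τ| ^ 2) volume 0 T := by
    have := IntervalIntegrable.sum _ hint
    rwa [Finset.sum_fn] at this
  have hwi : IntervalIntegrable (fun τ => sourceWeight T U κ τ ^ 2) volume 0 T := by
    have := intervalIntegrable_of_integrable_Ioo hT (integrable_norm_sq (memLp_sourceWeight hU))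
    simpa using this
  refine (intervalIntegral.integral_mono_on hT hwi (hsumi.const_mul _) fun τ _ => hpt τ).trans ?_
  rw [intervalIntegral.integral_const_mul, intervalIntegral.integral_finsetSum hint, mul_assoc]
  refine mul_le_mul_of_nonneg_left ?_ (by positivity)
  rw [Finset.sum_mul]
  refine Finset.sum_le_sum fun ij hij => ?_
  have hm := Finset.HasAntidiagonal.mem_antidiagonal.1 hij
  rw [intervalIntegral.integral_const_mul, mul_assoc]
  refine mul_le_mul_of_nonneg_left ?_ (by positivity)
  have := hUl ij.2 (by omega)
  rw [show κ - ij.2 = ij.1 by omega] at this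
  refine this.trans (mul_le_mul_of_nonneg_right (pow_le_pow_right₀ ?_ (by omega)) hN0)
  nlinarith [sq_nonneg T]

end Source

/-! ### The fixed-point map and its Volterra estimates. -/

section Fixed

variable {p : ℕ} {T : ℝ}

/-- `Θ` gives the Duhamel terms over `[0,T]`, with constant `C` in the smoothing estimate. -/
structure IsDuhamelMap (p : ℕ) (T C : ℝ)
    (Θ : (ℝ → InterSpace (2 * p + 3) (2 * p + 1)) → ℝ → HZero (2 * p + 3)) : Prop where
  nonneg : 0 ≤ C
  isDuhamel : ∀ F, MemLp F 2 (volume.restrict (Ioo 0 T)) → IsDuhamel T F (Θ F)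
  norm_sq_le : ∀ F, MemLp F 2 (volume.restrict (Ioo 0 T)) → ∀ t ∈ Icc 0 T,
    ‖Θ F t‖ ^ 2 ≤ C * ∫ τ in (0:ℝ)..t, ‖F τ‖ ^ 2

theorem exists_isDuhamelMap (p : ℕ) {T : ℝ} (hT : 0 ≤ T) : ∃ C Θ, IsDuhamelMap p T C Θ := by
  obtain ⟨C, hC, h⟩ := exists_isDuhamel p hT
  choose! Θ h1 h2 using h
  exact ⟨C, Θ, hC, h1, h2⟩

/-- The map whose fixed points are the `κ`-th derivatives of the solutions. -/
def duhamelMap (Θ : (ℝ → InterSpace (2 * p + 3) (2 * p + 1)) → ℝ → HZero (2 * p + 3))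
    (U : ℕ → ℝ → ℝ) (M : HZero (2 * p + 3) →L[ℝ] InterSpace (2 * p + 3) (2 * p + 1))
    (W : ℕ → ℝ → InterSpace (2 * p + 3) (2 * p + 1)) (c : ℕ → HZero (2 * p + 3)) (κ : ℕ)
    (g : ℝ → HZero (2 * p + 3)) (t : ℝ) : HZero (2 * p + 3) :=
  HZero.evolve t (c 0) + Θ (sourceFun U M W c κ g) t

variable {C : ℝ} {Θ : (ℝ → InterSpace (2 * p + 3) (2 * p + 1)) → ℝ → HZero (2 * p + 3)}
  {U : ℕ → ℝ → ℝ} {W : ℕ → ℝ → InterSpace (2 * p + 3) (2 * p + 1)} {κ : ℕ}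

/-- In a difference of two values the initial datum and f cancel. What is left is the Duhamel term
of the difference of the sources, which is at most ‖M‖ ρ `sourceWeight`, and the smoothing estimate
squares this. -/
theorem IsDuhamelMap.isVolterra (hΘ : IsDuhamelMap p T C Θ) (hT : 0 ≤ T)
    (hU : ∀ l ≤ κ, MemLp (U l) 2 (volume.restrict (Ioo 0 T)))
    (hW : MemLp (W κ) 2 (volume.restrict (Ioo 0 T)))
    (M : HZero (2 * p + 3) →L[ℝ] InterSpace (2 * p + 3) (2 * p + 1)) (c : ℕ → HZero (2 * p + 3)) :
    IsVolterra T (fun τ => C * ‖M‖ ^ 2 * sourceWeight T U κ τ ^ 2)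
      (duhamelMap Θ U M W c κ) := by
  have hm : IntervalIntegrable (fun τ => C * ‖M‖ ^ 2 * sourceWeight T U κ τ ^ 2) volume 0 T := by
    have := intervalIntegrable_of_integrable_Ioo hT (integrable_norm_sq (memLp_sourceWeight hU))
    simp only [Real.norm_eq_abs, sq_abs] at this
    exact this.const_mul _
  have hC := hΘ.nonneg
  refine ⟨hm, fun t => by positivity, fun g hg => ?_, fun g h hg hh ρ hρc hρ H t ht => ?_⟩
  · exact (HZero.continuous_evolve_left (c 0)).add
      (hΘ.isDuhamel _ (memLp_sourceFun M c hU hW hg)).continuous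
  · have hFg := memLp_sourceFun M c hU hW hg
    have hFh := memLp_sourceFun M c hU hW hh
    have h1 := (hΘ.isDuhamel _ hFg).sub hFg hFh (hΘ.isDuhamel _ hFh)
    -- The values of Θ are picked by choice; subtractivity on [0,T] follows from the uniqueness of
    -- Duhamel terms there.
    have h2 := h1.eqOn (hΘ.isDuhamel _ (hFg.sub hFh)) EventuallyEq.rfl ht
    have h3 : duhamelMap Θ U M W c κ g t - duhamelMap Θ U M W c κ h t =
        Θ (sourceFun U M W c κ g - sourceFun U M W c κ h) t := by
      rw [← h2]
      simp only [duhamelMap]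
      abel
    rw [h3]
    refine (hΘ.norm_sq_le _ (hFg.sub hFh) t ht).trans ?_
    rw [← intervalIntegral.integral_const_mul]
    have h0 : (0:ℝ) ∈ Icc 0 T := ⟨le_rfl, hT⟩
    have hsub : Icc 0 t ⊆ Icc 0 T := Icc_subset_Icc le_rfl ht.2
    refine intervalIntegral.integral_mono_on ht.1
      ((intervalIntegrable_of_integrable_Ioo ht.1
        (integrable_norm_sq (MemLp.mono_Ioo (hFg.sub hFh) le_rfl ht.2))).const_mul _)
      ((intervalIntegrable_mono_Icc hm h0 ht).mul_continuousOn ?_) fun τ hτ => ?_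
    · rw [uIcc_of_le ht.1]
      exact (hρc.mono hsub).pow 2
    · have h4 := norm_sourceFun_sub_le hT U M W c κ hg hh hρ H (hsub hτ)
      rw [mul_assoc, mul_assoc, ← mul_pow, ← mul_pow]
      refine mul_le_mul_of_nonneg_left (pow_le_pow_left₀ (norm_nonneg _) (h4.trans ?_) 2) hC
      linarith

theorem IsDuhamelMap.norm_duhamelMap_zero_le (hΘ : IsDuhamelMap p T C Θ) (hT : 0 ≤ T)
    (hU : ∀ l ≤ κ, MemLp (U l) 2 (volume.restrict (Ioo 0 T)))
    (hW : MemLp (W κ) 2 (volume.restrict (Ioo 0 T)))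
    (M : HZero (2 * p + 3) →L[ℝ] InterSpace (2 * p + 3) (2 * p + 1)) {c : ℕ → HZero (2 * p + 3)}
    {A Q B : ℝ} (hc : ∀ q, ‖c q‖ ≤ A) (hQ : ∫ τ in (0:ℝ)..T, sourceWeight T U κ τ ^ 2 ≤ Q)
    (hB : 0 ≤ B) (hWB : ∫ τ in (0:ℝ)..T, ‖W κ τ‖ ^ 2 ≤ B ^ 2) :
    ∀ t ∈ Icc 0 T, ‖duhamelMap Θ U M W c κ 0 t‖ ≤
      2 * (1 + 2 * C * (‖M‖ ^ 2 * Q + 1)) * (A + B) := by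
  intro t ht
  have hA : 0 ≤ A := (norm_nonneg _).trans (hc 0)
  have hC := hΘ.nonneg
  have hQ0 : 0 ≤ Q :=
    (intervalIntegral.integral_nonneg hT fun _ _ => by positivity).trans hQ
  have hF := memLp_sourceFun M c hU hW (g := 0) continuous_const
  have hFi := intervalIntegrable_of_integrable_Ioo hT (integrable_norm_sq hF)
  have hwi : IntervalIntegrable (fun τ => sourceWeight T U κ τ ^ 2) volume 0 T := by
    have := intervalIntegrable_of_integrable_Ioo hT (integrable_norm_sq (memLp_sourceWeight hU))
    simpa using this
  have hWi := intervalIntegrable_of_integrable_Ioo hT (integrable_norm_sq hW)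
  have h1 : ∫ τ in (0:ℝ)..t, ‖sourceFun U M W c κ 0 τ‖ ^ 2 ≤
      2 * (‖M‖ ^ 2 * Q + 1) * (A + B) ^ 2 := by
    refine (intervalIntegral.integral_mono_interval le_rfl ht.1 ht.2
      (Eventually.of_forall fun _ => by positivity) hFi).trans ?_
    have h2 : ∫ τ in (0:ℝ)..T, ‖sourceFun U M W c κ 0 τ‖ ^ 2 ≤
        ∫ τ in (0:ℝ)..T, (2 * (‖M‖ * A) ^ 2 * sourceWeight T U κ τ ^ 2 + 2 * ‖W κ τ‖ ^ 2) := by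
      refine intervalIntegral.integral_mono_on hT hFi
        ((hwi.const_mul _).add (hWi.const_mul _)) fun τ hτ => ?_
      have h3 := norm_sourceFun_zero_le hT U M W κ hc hτ
      have h4 := pow_le_pow_left₀ (norm_nonneg _) h3 2
      nlinarith [sq_nonneg (‖M‖ * A * sourceWeight T U κ τ - ‖W κ τ‖)]
    rw [intervalIntegral.integral_add (hwi.const_mul _) (hWi.const_mul _),
      intervalIntegral.integral_const_mul, intervalIntegral.integral_const_mul] at h2
    have h5 := mul_le_mul_of_nonneg_left hQ (show 0 ≤ 2 * (‖M‖ * A) ^ 2 by positivity)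
    have h6 : A ^ 2 ≤ (A + B) ^ 2 := pow_le_pow_left₀ hA (by linarith) 2
    have h7 : B ^ 2 ≤ (A + B) ^ 2 := pow_le_pow_left₀ hB (by linarith) 2
    have h8 := mul_le_mul_of_nonneg_left h6 (show 0 ≤ 2 * (‖M‖ ^ 2 * Q) by positivity)
    nlinarith
  -- Because κ' ≥ 1, the constant 2C(‖M‖²Q + 1) is at most κ'², which saves a square root.
  set κ' := 1 + 2 * C * (‖M‖ ^ 2 * Q + 1) with hκ'
  have hκ1 : 1 ≤ κ' := by
    have : 0 ≤ 2 * C * (‖M‖ ^ 2 * Q + 1) := by positivity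
    linarith
  have h9 : ‖Θ (sourceFun U M W c κ 0) t‖ ≤ κ' * (A + B) := by
    refine le_of_sq_le_sq ?_ (by positivity)
    refine (hΘ.norm_sq_le _ hF t ht).trans ((mul_le_mul_of_nonneg_left h1 hC).trans ?_)
    rw [mul_pow, ← mul_assoc]
    refine mul_le_mul_of_nonneg_right ?_ (sq_nonneg _)
    nlinarith
  refine (norm_add_le _ _).trans ?_
  rw [HZero.norm_evolve]
  have h10 := hc 0
  nlinarith

end Fixed

/-! ### Time differentiation of the Duhamel formula, one coefficient at a time. -/

section Coefficients

variable {T : ℝ}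

theorem hasDerivAt_timeExp (j : ℕ+) (t : ℝ) :
    HasDerivAt (timeExp j) (Complex.I * eigVal j * timeExp j t) t := by
  have h1 : HasDerivAt (fun t : ℝ => Complex.I * eigVal j * (t : ℂ)) (Complex.I * eigVal j) t := by
    simpa using (Complex.ofRealCLM.hasDerivAt (x := t)).const_mul (Complex.I * eigVal j)
  exact h1.cexp.congr_deriv (mul_comm _ _)

theorem hasDerivAt_timeExp_neg (j : ℕ+) (t : ℝ) :
    HasDerivAt (fun t => timeExp j (-t)) (-Complex.I * eigVal j * timeExp j (-t)) t := by
  have := (hasDerivAt_timeExp j (-t)).scomp t (hasDerivAt_neg t)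
  refine this.congr_deriv ?_
  simp

theorem integral_timeExp_sub (j : ℕ+) (S : ℝ → ℂ) (t : ℝ) :
    ∫ τ in (0:ℝ)..t, timeExp j (-(t - τ)) * S τ =
      timeExp j (-t) * ∫ τ in (0:ℝ)..t, timeExp j τ * S τ := by
  rw [← intervalIntegral.integral_const_mul]
  refine intervalIntegral.integral_congr fun τ _ => ?_
  show timeExp j (-(t - τ)) * S τ = timeExp j (-t) * (timeExp j τ * S τ)
  rw [← mul_assoc, timeExp_neg_mul]

theorem IsPrimitive.mono_right {E : Type*} [NormedAddCommGroup E] [NormedSpace ℝ E] {a b c : ℝ}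
    {G g : ℝ → E} (h : IsPrimitive a b G g) (hc : c ∈ Icc a b) : IsPrimitive a c G g :=
  ⟨intervalIntegrable_mono_Icc h.integrable ⟨le_rfl, hc.1.trans hc.2⟩ hc,
    fun x hx => h.eq x ⟨hx.1, hx.2.trans hc.2⟩⟩

/-- Differentiation in time of the Duhamel formula for one coefficient. -/
theorem isPrimitive_duhamel_coef (hT : 0 ≤ T) (j : ℕ+) {S S' : ℝ → ℂ} (h : IsPrimitive 0 T S S')
    (h0 : S 0 = 0) (z : ℂ) :
    IsPrimitive 0 T
      (fun t => timeExp j (-t) * z + Complex.I * ∫ τ in (0:ℝ)..t, timeExp j (-(t - τ)) * S τ)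
      (fun t => timeExp j (-t) * (-Complex.I * eigVal j * z)
        + Complex.I * ∫ τ in (0:ℝ)..t, timeExp j (-(t - τ)) * S' τ) := by
  have hE : IsPrimitive 0 T (timeExp j) (fun t => Complex.I * eigVal j * timeExp j t) :=
    isPrimitive_of_hasDerivAt (hasDerivAt_timeExp j) (continuous_const.mul (continuous_timeExp j))
  have hE' : IsPrimitive 0 T (fun t => timeExp j (-t))
      (fun t => -Complex.I * eigVal j * timeExp j (-t)) :=
    isPrimitive_of_hasDerivAt (hasDerivAt_timeExp_neg j)
      (continuous_const.mul ((continuous_timeExp j).comp continuous_neg))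
  have hSi : IntervalIntegrable (fun τ => timeExp j τ * S τ) volume 0 T := by
    refine ContinuousOn.intervalIntegrable ?_
    rw [uIcc_of_le hT]
    exact (continuous_timeExp j).continuousOn.mul (h.continuousOn hT)
  have hz : IsPrimitive 0 T (fun t => z + ∫ τ in (0:ℝ)..t, Complex.I * (timeExp j τ * S τ))
      (fun τ => Complex.I * (timeExp j τ * S τ)) := IsPrimitive.of_integral z (hSi.const_mul _)
  have hp := hE'.smul hT hz
  refine (hp.congr_ae hT ?_).congr hT fun t _ => ?_
  · filter_upwards [self_mem_ae_restrict measurableSet_Ioo] with t ht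
    have htm : t ∈ Icc 0 T := Ioo_subset_Icc_self ht
    -- Integration by parts in τ moves the factor iλ_j from the exponential to a derivative on S.
    -- The boundary term at τ = 0 drops since S(0) = 0, and the one at τ = t cancels the derivative
    -- of the upper limit.
    have e := (hE.mono_right htm).integral_smul_eq ht.1.le (h.mono_right htm)
    simp only [smul_eq_mul, h0, mul_zero, sub_zero] at e
    have e2 : ∫ τ in (0:ℝ)..t, Complex.I * eigVal j * timeExp j τ * S τ =
        Complex.I * eigVal j * ∫ τ in (0:ℝ)..t, timeExp j τ * S τ := by
      rw [← intervalIntegral.integral_const_mul]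
      congr 1; ext τ; ring
    rw [e2] at e
    rw [integral_timeExp_sub, e, intervalIntegral.integral_const_mul]
    simp only [smul_eq_mul]
    ring
  · show _ = timeExp j (-t) • (z + ∫ τ in (0:ℝ)..t, Complex.I * (timeExp j τ * S τ))
    rw [integral_timeExp_sub, intervalIntegral.integral_const_mul, smul_eq_mul]
    ring

/-- The coefficient `⟨φ, φ_j⟩` as a continuous linear functional on `H^s_{(0)}`. -/
def HZero.coefCLM (s : ℕ) (j : ℕ+) : HZero s →L[ℝ] ℂ :=
  ((innerSL ℂ (eigVec j)).restrictScalars ℝ).comp ((HZero.toL2CLM s).restrictScalars ℝ)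

theorem HZero.coefCLM_apply {s : ℕ} (j : ℕ+) (φ : HZero s) :
    HZero.coefCLM s j φ = inner ℂ (eigVec j) φ.toL2 := rfl

/-- The elements `(-iA)^n ψ₀` for `n ≤ k`. -/
theorem HZero.exists_iterate_generator (p k : ℕ) (ψ₀ : HZero (2 * (p + k) + 3)) :
    ∃ a : ℕ → HZero (2 * p + 3), (∀ n ≤ k, ∀ j, inner ℂ (eigVec j) (a n).toL2 =
      (-Complex.I * eigVal j) ^ n * inner ℂ (eigVec j) ψ₀.toL2) ∧
      ∀ n, ‖a n‖ ≤ Real.pi ^ (2 * k) * ‖ψ₀‖ := by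
  have hpi : 1 ≤ Real.pi := by linarith [Real.pi_gt_three]
  have hb : ∀ n ≤ k, ∀ S : Finset ℕ+, ∑ j ∈ S, ‖(j : ℂ) ^ (2 * p + 3) *
      ((-Complex.I * eigVal j) ^ n * inner ℂ (eigVec j) ψ₀.toL2)‖ ^ 2 ≤
      (Real.pi ^ (2 * k) * ‖ψ₀‖) ^ 2 := by
    intro n hn S
    rw [mul_pow]
    refine le_trans ?_ (mul_le_mul_of_nonneg_left (ψ₀.sum_norm_sq_le S) (by positivity))
    rw [Finset.mul_sum]
    refine Finset.sum_le_sum fun j _ => ?_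
    rw [← mul_pow]
    refine pow_le_pow_left₀ (norm_nonneg _) ?_ 2
    have e : ‖(-Complex.I * eigVal j : ℂ)‖ = ‖(j : ℂ)‖ ^ 2 * Real.pi ^ 2 := by
      rw [norm_mul, norm_neg, Complex.norm_I, one_mul, Complex.norm_real, eigVal,
        Real.norm_of_nonneg (by positivity), mul_pow,
        show ((j : ℂ)) = ((j : ℕ) : ℂ) from rfl, Complex.norm_natCast]
    rw [norm_mul, norm_mul, norm_mul, norm_pow, norm_pow, norm_pow, e, mul_pow, ← pow_mul,
      ← pow_mul]
    have h1 := one_le_norm_pnat_cast j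
    -- Applying A n times costs 2n orders of regularity, and 2p+3+2n ≤ 2(p+k)+3.
    have h2 : ‖(j : ℂ)‖ ^ (2 * p + 3) * ‖(j : ℂ)‖ ^ (2 * n) ≤ ‖(j : ℂ)‖ ^ (2 * (p + k) + 3) := by
      rw [← pow_add]; exact pow_le_pow_right₀ h1 (by omega)
    have h3 : Real.pi ^ (2 * n) ≤ Real.pi ^ (2 * k) := pow_le_pow_right₀ hpi (by omega)
    have h4 := mul_le_mul h2 h3 (by positivity) (by positivity)
    have h5 := mul_le_mul_of_nonneg_right h4 (norm_nonneg (inner ℂ (eigVec j) ψ₀.toL2))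
    linarith
  have hex : ∀ n, ∃ φ : HZero (2 * p + 3), (n ≤ k → ∀ j, inner ℂ (eigVec j) φ.toL2 =
      (-Complex.I * eigVal j) ^ n * inner ℂ (eigVec j) ψ₀.toL2) ∧
      ‖φ‖ ≤ Real.pi ^ (2 * k) * ‖ψ₀‖ := by
    intro n
    by_cases hn : n ≤ k
    · obtain ⟨φ, hφ⟩ := HZero.exists_coef (2 * p + 3) _ (hb n hn)
      refine ⟨φ, fun _ => hφ, le_of_sq_le_sq (φ.norm_sq_le fun S => ?_) (by positivity)⟩
      simp_rw [hφ]
      exact hb n hn S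
    -- The value 0 beyond order k keeps the norm bound valid for every n.
    · exact ⟨0, fun h => absurd h hn, by rw [norm_zero]; positivity⟩
  choose a ha hn using hex
  exact ⟨a, ha, hn⟩

variable {p κ : ℕ} {C : ℝ}
  {Θ : (ℝ → InterSpace (2 * p + 3) (2 * p + 1)) → ℝ → HZero (2 * p + 3)}
  {U : ℕ → ℝ → ℝ} {W : ℕ → ℝ → InterSpace (2 * p + 3) (2 * p + 1)}
  {M : HZero (2 * p + 3) →L[ℝ] InterSpace (2 * p + 3) (2 * p + 1)} {c : ℕ → HZero (2 * p + 3)}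

theorem isPrimitive_source (hT : 0 ≤ T) (hU : IsJet 0 T κ U) (hW : IsJet 0 T κ W)
    {g : ℝ → HZero (2 * p + 3)} (hg : Continuous g) {n : ℕ} (hn : n < κ) :
    IsPrimitive 0 T
      (fun τ => leibnizProd U (fun n τ => M (iterPrim c g (κ - n) τ)) n τ + W n τ)
      (fun τ => leibnizProd U (fun n τ => M (iterPrim c g (κ - n) τ)) (n + 1) τ + W (n + 1) τ) := by
  have hJ : IsJet 0 T κ fun n τ => M (iterPrim c g (κ - n) τ) := fun i hi =>
    (isJet_iterPrim c hg κ i hi).clm_comp M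
  exact (hU.leibnizProd hT hJ n hn).add (hW n hn)

/-- The iterated primitives of a fixed point satisfy Duhamel formulas. -/
theorem coef_iterPrim_eq (hΘ : IsDuhamelMap p T C Θ) (hT : 0 ≤ T)
    (hU : ∀ l ≤ κ, MemLp (U l) 2 (volume.restrict (Ioo 0 T)))
    (hWm : MemLp (W κ) 2 (volume.restrict (Ioo 0 T)))
    (hUJ : IsJet 0 T κ U) (hU0 : ∀ l < κ, U l 0 = 0) (hWJ : IsJet 0 T κ W)
    (hW0 : ∀ l < κ, W l 0 = 0) {g : ℝ → HZero (2 * p + 3)} (hg : Continuous g)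
    (hfix : ∀ t ∈ Icc 0 T, g t = duhamelMap Θ U M W c κ g t) (j : ℕ+) {z : ℂ}
    (hc : ∀ q ≤ κ, inner ℂ (eigVec j) (c q).toL2 = (-Complex.I * eigVal j) ^ (κ - q) * z)
    (q : ℕ) (hq : q ≤ κ) : ∀ t ∈ Icc 0 T, inner ℂ (eigVec j) (iterPrim c g q t).toL2 =
      timeExp j (-t) * ((-Complex.I * eigVal j) ^ (κ - q) * z) +
      Complex.I * ∫ τ in (0:ℝ)..t, timeExp j (-(t - τ)) * InterSpace.coefCLM _ _ j
        (leibnizProd U (fun n τ => M (iterPrim c g (κ - n) τ)) (κ - q) τ + W (κ - q) τ) := by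
  -- Induction on the number of primitives taken. At level q+1 both sides are primitives of the two
  -- sides at level q, which agree by induction, and their values at t = 0 are equal. The source of
  -- order κ-(q+1) vanishes at 0 since U and W do below order κ.
  induction q with
  | zero =>
    intro t ht
    have hF := memLp_sourceFun M c hU hWm hg
    show inner ℂ (eigVec j) (g t).toL2 = _
    rw [hfix t ht, duhamelMap, map_add, inner_add_right, HZero.coef_evolve, hc 0 (Nat.zero_le _),
      (hΘ.isDuhamel _ hF).coef t ht]
    rfl
  | succ q ih =>
    intro t ht
    obtain ⟨n, hn⟩ : ∃ n, n = κ - (q + 1) := ⟨_, rfl⟩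
    have hn1 : κ - q = n + 1 := by omega
    have ih' := ih (by omega)
    rw [hn1] at ih'
    rw [← hn]
    have hs := (isPrimitive_source (M := M) (c := c) hT hUJ hWJ hg
      (show n < κ by omega)).clm_comp (InterSpace.coefCLM (2 * p + 3) (2 * p + 1) j)
    have hs0 : leibnizProd U (fun n τ => M (iterPrim c g (κ - n) τ)) n 0 + W n 0 = 0 := by
      rw [hW0 n (by omega), add_zero]
      refine Finset.sum_eq_zero fun ij hij => ?_
      have := Finset.HasAntidiagonal.mem_antidiagonal.1 hij
      rw [hU0 ij.1 (by omega), zero_smul, smul_zero]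
    have hD := isPrimitive_duhamel_coef hT j hs (by simp only [hs0, map_zero])
      ((-Complex.I * eigVal j) ^ n * z)
    have hI : IsPrimitive 0 T (iterPrim c g (q + 1)) (iterPrim c g q) :=
      isPrimitive_of_hasDerivAt (hasDerivAt_iterPrim c hg q) (continuous_iterPrim c hg q)
    have hIc := hI.clm_comp (HZero.coefCLM (2 * p + 3) j)
    have e1 := hIc.eq t ht
    have e2 := hD.eq t ht
    simp only [HZero.coefCLM_apply] at e1
    rw [e1, e2]
    congr 1
    · have : iterPrim c g (q + 1) 0 = c (q + 1) := by simp [iterPrim]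
      rw [this, hc (q + 1) hq, ← hn]
      simp [timeExp]
    · refine intervalIntegral.integral_congr fun τ hτ => ?_
      rw [uIcc_of_le ht.1] at hτ
      exact (ih' τ ⟨hτ.1, hτ.2.trans ht.2⟩).trans (by ring)

end Coefficients

/-! ### The L² group under the Bochner integral. -/

section Group

theorem hasSum_sq_norm_inner_eigVec (φ : L2 ℂ 0 1) :
    HasSum (fun j : ℕ+ => ‖inner ℂ (eigVec j) φ‖ ^ 2) (‖φ‖ ^ 2) := by
  have h := lp.hasSum_norm (p := 2) (by norm_num) (eigBasis.repr φ)
  simp only [ENNReal.toReal_ofNat, Real.rpow_ofNat, LinearIsometryEquiv.norm_map,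
    HilbertBasis.repr_apply_apply, eigBasis_apply] at h
  exact h

theorem norm_schrodingerGroup (t : ℝ) (φ : L2 ℂ 0 1) : ‖schrodingerGroup t φ‖ = ‖φ‖ := by
  have h := hasSum_sq_norm_inner_eigVec (schrodingerGroup t φ)
  simp only [inner_schrodingerGroup, norm_mul, norm_timeExp, one_mul] at h
  have := h.unique (hasSum_sq_norm_inner_eigVec φ)
  exact (pow_left_inj₀ (norm_nonneg _) (norm_nonneg _) two_ne_zero).1 this

/-- The integrand is a pointwise limit of its measurable partial sums, and the group preserves the
norm. -/
theorem integrable_schrodingerGroup {ν : Measure ℝ} (t : ℝ) {F : ℝ → L2 ℂ 0 1}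
    (hF : Integrable F ν) : Integrable (fun τ => schrodingerGroup (t - τ) (F τ)) ν := by
  refine hF.mono ?_ (Eventually.of_forall fun τ => (norm_schrodingerGroup _ _).le)
  have h : ∀ τ, HasSum (fun j : ℕ+ =>
      (Complex.exp (-Complex.I * eigVal j * (t - τ : ℝ)) * inner ℂ (eigVec j) (F τ)) • eigVec j)
      (schrodingerGroup (t - τ) (F τ)) := fun τ => hasSum_schrodingerGroup (t - τ) (F τ)
  refine aestronglyMeasurable_of_tendsto_ae (u := atTop)
    (f := fun (S : Finset ℕ+) τ => ∑ j ∈ S,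
      (Complex.exp (-Complex.I * eigVal j * (t - τ : ℝ)) * inner ℂ (eigVec j) (F τ)) • eigVec j)
    (fun S => ?_) (Eventually.of_forall fun τ => h τ)
  refine Finset.aestronglyMeasurable_fun_sum _ fun j _ => ?_
  refine AEStronglyMeasurable.smul_const (AEStronglyMeasurable.mul ?_ ?_) _
  · exact Continuous.aestronglyMeasurable (by fun_prop)
  · exact ((innerSL ℂ (eigVec j)).continuous).comp_aestronglyMeasurable hF.aestronglyMeasurable

theorem inner_integral_schrodingerGroup (j : ℕ+) {t : ℝ} {F : ℝ → L2 ℂ 0 1}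
    (hF : IntervalIntegrable F volume 0 t) :
    inner ℂ (eigVec j) (∫ τ in (0:ℝ)..t, schrodingerGroup (t - τ) (F τ)) =
      ∫ τ in (0:ℝ)..t, timeExp j (-(t - τ)) * inner ℂ (eigVec j) (F τ) := by
  have hi : IntervalIntegrable (fun τ => schrodingerGroup (t - τ) (F τ)) volume 0 t :=
    intervalIntegrable_iff.2 (integrable_schrodingerGroup t (intervalIntegrable_iff.1 hF))
  have h := ((innerSL ℂ (eigVec j)).restrictScalars ℝ).intervalIntegral_comp_comm hi
  have h' : ∫ τ in (0:ℝ)..t, inner ℂ (eigVec j) (schrodingerGroup (t - τ) (F τ)) =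
      inner ℂ (eigVec j) (∫ τ in (0:ℝ)..t, schrodingerGroup (t - τ) (F τ)) := h
  rw [← h']
  simp only [inner_schrodingerGroup]

end Group

/-! ### Mild solutions: correspondence with fixed points, uniqueness, existence and bound. -/

section Mild

variable {T : ℝ} {p k m s : ℕ} {μ : Sobolev ℝ 0 1 m} {u : Sobolev ℝ 0 T k}
  {f : Sobolev (InterSpace (2 * p + 3) (2 * p + 1)) 0 T k} {C : ℝ}
  {Θ : (ℝ → InterSpace (2 * p + 3) (2 * p + 1)) → ℝ → HZero (2 * p + 3)}
  {U : ℕ → ℝ → ℝ} {W : ℕ → ℝ → InterSpace (2 * p + 3) (2 * p + 1)}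
  {M : HZero (2 * p + 3) →L[ℝ] InterSpace (2 * p + 3) (2 * p + 1)}

theorem ae_toL2_smul_mul_add (hU : IsRepJet u U) (hW : IsRepJet f W)
    (hM : ∀ φ, (M φ).toL2 =ᵐ[volume.restrict (Ioo (0:ℝ) 1)] fun y => μ.fn y • φ.toL2 y) :
    ∀ᵐ τ ∂(volume.restrict (Ioo 0 T)), ∀ φ : HZero (2 * p + 3),
      (U 0 τ • M φ + W 0 τ).toL2 =ᵐ[volume.restrict (Ioo (0:ℝ) 1)] fun x =>
        (u.fn τ : ℂ) * (μ.fn x : ℂ) * φ.toL2 x + (f.fn τ).toL2 x := by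
  filter_upwards [hU.ae_eq 0 (by omega), hW.ae_eq 0 (by omega)] with τ h1 h2 φ
  have h1' : u.fn τ = U 0 τ := h1
  have h2' : f.fn τ = W 0 τ := h2
  have h3 : (U 0 τ • M φ + W 0 τ).toL2 = U 0 τ • (M φ).toL2 + (W 0 τ).toL2 := by
    have := (InterSpace.derCLM (2 * p + 3) (2 * p + 1) 0).map_add (U 0 τ • M φ) (W 0 τ)
    rw [map_smul] at this
    exact this
  rw [h3, h1', h2']
  filter_upwards [Lp.coeFn_add (U 0 τ • (M φ).toL2) (W 0 τ).toL2,
    Lp.coeFn_smul (U 0 τ) (M φ).toL2, hM φ] with x e1 e2 e3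
  rw [e1, Pi.add_apply, e2, Pi.smul_apply, e3]
  simp only [Complex.real_smul]
  ring

theorem intervalIntegrable_toL2 {F : ℝ → InterSpace (2 * p + 3) (2 * p + 1)} (hT : 0 ≤ T)
    (hF : MemLp F 2 (volume.restrict (Ioo 0 T))) :
    IntervalIntegrable (fun τ => (F τ).toL2) volume 0 T :=
  MemLp.intervalIntegrable_Ioo hT
    ((InterSpace.derCLM (2 * p + 3) (2 * p + 1) 0).comp_memLp' hF)

theorem sourceFun_zero (c : ℕ → HZero (2 * p + 3)) (g : ℝ → HZero (2 * p + 3)) (τ : ℝ) :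
    sourceFun U M W c 0 g τ = U 0 τ • M (g τ) + W 0 τ := by
  simp [sourceFun, leibnizProd, iterPrim]

/-- A mild solution is a fixed point of the undifferentiated Duhamel map. -/
theorem IsMildSolution.eq_duhamelMap (hT : 0 ≤ T) (hΘ : IsDuhamelMap p T C Θ)
    (hU : IsRepJet u U) (hW : IsRepJet f W)
    (hM : ∀ φ, (M φ).toL2 =ᵐ[volume.restrict (Ioo (0:ℝ) 1)] fun y => μ.fn y • φ.toL2 y)
    {ψ₀ : HZero s} {a : HZero (2 * p + 3)}
    (ha : ∀ j, inner ℂ (eigVec j) a.toL2 = inner ℂ (eigVec j) ψ₀.toL2)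
    {ψ : ℝ → HZero (2 * p + 3)} (h : IsMildSolution T p k μ u f ψ₀ ψ) :
    Continuous (fun t => ψ (projIcc 0 T hT t)) ∧ ∀ t ∈ Icc 0 T, ψ (projIcc 0 T hT t) =
      duhamelMap Θ U M W (fun _ => a) 0 (fun t => ψ (projIcc 0 T hT t)) t := by
  -- A mild solution is only controlled on [0,T]; clamping the time gives a function continuous on ℝ
  -- with the same values there.
  have hc : Continuous (fun t => ψ (projIcc 0 T hT t)) :=
    (continuousOn_iff_continuous_domRestrict.1 h.contDiffOn.continuousOn).comp continuous_projIcc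
  refine ⟨hc, fun t ht => HZero.ext_coef fun j => ?_⟩
  have hF : MemLp (sourceFun U M W (fun _ => a) 0 (fun t => ψ (projIcc 0 T hT t))) 2
      (volume.restrict (Ioo 0 T)) :=
    memLp_sourceFun M _ (fun l hl => hU.memLp (by omega)) (hW.memLp (by omega)) hc
  obtain ⟨F, hFi, hFe, hD⟩ := h.duhamel
  have hFt := intervalIntegrable_mono_Icc hFi ⟨le_rfl, hT⟩ ht
  rw [duhamelMap, map_add, inner_add_right, HZero.coef_evolve, ha, (hΘ.isDuhamel _ hF).coef t ht,
    projIcc_of_mem hT ht, hD t ht, inner_add_right, inner_smul_right, inner_schrodingerGroup,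
    inner_integral_schrodingerGroup j hFt]
  congr 2
  rw [← integral_Ioo_eq_interval ht.1, ← integral_Ioo_eq_interval ht.1]
  refine integral_congr_ae ?_
  filter_upwards [ae_restrict_of_ae_restrict_of_subset (Ioo_subset_Ioo le_rfl ht.2) hFe,
    ae_restrict_of_ae_restrict_of_subset (Ioo_subset_Ioo le_rfl ht.2)
      (ae_toL2_smul_mul_add hU hW hM), self_mem_ae_restrict measurableSet_Ioo] with τ h1 h2 h3
  congr 2
  rw [sourceFun_zero, projIcc_of_mem hT ⟨h3.1.le, h3.2.le.trans ht.2⟩]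
  exact Lp.ext (h1.trans (h2 _).symm)

/-- The iterated primitive of a fixed point is a mild solution. -/
theorem isMildSolution_iterPrim (hT : 0 ≤ T) (hΘ : IsDuhamelMap p T C Θ)
    (hu : ∀ l < k, U l 0 = 0) (hf : ∀ l < k, W l 0 = 0) (hU : IsRepJet u U) (hW : IsRepJet f W)
    (hM : ∀ φ, (M φ).toL2 =ᵐ[volume.restrict (Ioo (0:ℝ) 1)] fun y => μ.fn y • φ.toL2 y)
    {ψ₀ : HZero s} {c : ℕ → HZero (2 * p + 3)}
    (hc : ∀ q ≤ k, ∀ j, inner ℂ (eigVec j) (c q).toL2 =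
      (-Complex.I * eigVal j) ^ (k - q) * inner ℂ (eigVec j) ψ₀.toL2)
    {g : ℝ → HZero (2 * p + 3)} (hg : Continuous g)
    (hfix : ∀ t ∈ Icc 0 T, g t = duhamelMap Θ U M W c k g t) :
    IsMildSolution T p k μ u f ψ₀ (iterPrim c g k) := by
  have hψ := continuous_iterPrim c hg k
  have hF : MemLp (fun τ => U 0 τ • M (iterPrim c g k τ) + W 0 τ) 2
      (volume.restrict (Ioo 0 T)) :=
    MemLp.add (MemLp.smul_continuousOn_Ioo (hU.memLp (by omega))
      (M.continuous.comp hψ).continuousOn) (hW.memLp (by omega))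
  refine ⟨(contDiff_iterPrim c hg k).contDiffOn,
    fun τ => (U 0 τ • M (iterPrim c g k τ) + W 0 τ).toL2, intervalIntegrable_toL2 hT hF, ?_,
    fun t ht => ext_inner_eigVec fun j => ?_⟩
  · filter_upwards [ae_toL2_smul_mul_add hU hW hM] with τ hτ using hτ _
  · rw [inner_add_right, inner_smul_right, inner_schrodingerGroup,
      inner_integral_schrodingerGroup j
        (intervalIntegrable_mono_Icc (intervalIntegrable_toL2 hT hF) ⟨le_rfl, hT⟩ ht),
      coef_iterPrim_eq hΘ hT (fun l hl => hU.memLp (by omega)) (hW.memLp (by omega)) hU.jet hu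
        hW.jet hf hg hfix j (fun q hq => hc q hq j) k le_rfl t ht]
    congr 1
    · simp
    · congr 1
      refine intervalIntegral.integral_congr fun τ _ => ?_
      simp [leibnizProd, InterSpace.coefCLM_apply]

/-- Both solutions are continuous fixed points of the Volterra map with κ = 0, the undifferentiated
equation, so neither the time regularity of ψ beyond continuity nor the vanishing of u and f at t =
0 plays a role. -/
theorem IsMildSolution.eqOn (hT : 0 < T) (hm : 2 * p + 3 ≤ m)
    (hμ : ∀ n (hn : n < p), VanishesAtEnds (μ.der ⟨2 * n + 1, by omega⟩))
    {ψ₀ : HZero (2 * (p + k) + 3)} {ψ ψ' : ℝ → HZero (2 * p + 3)}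
    (h : IsMildSolution T p k μ u f ψ₀ ψ) (h' : IsMildSolution T p k μ u f ψ₀ ψ') :
    EqOn ψ ψ' (Icc 0 T) := by
  obtain ⟨M, hM⟩ := exists_mulCLM hm μ hμ
  obtain ⟨C, Θ, hΘ⟩ := exists_isDuhamelMap p hT.le
  obtain ⟨U, hU⟩ := u.exists_isRepJet hT
  obtain ⟨W, hW⟩ := f.exists_isRepJet hT
  obtain ⟨a, ha, -⟩ := HZero.exists_iterate_generator p k ψ₀
  have ha0 : ∀ j, inner ℂ (eigVec j) (a 0).toL2 = inner ℂ (eigVec j) ψ₀.toL2 := fun j => by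
    rw [ha 0 (Nat.zero_le _), pow_zero, one_mul]
  obtain ⟨c1, e1⟩ := h.eq_duhamelMap hT.le hΘ hU hW hM ha0
  obtain ⟨c2, e2⟩ := h'.eq_duhamelMap hT.le hΘ hU hW hM ha0
  have hUm : ∀ l ≤ 0, MemLp (U l) 2 (volume.restrict (Ioo 0 T)) := fun l hl => hU.memLp (by omega)
  have hWm : MemLp (W 0) 2 (volume.restrict (Ioo 0 T)) := hW.memLp (by omega)
  have hV := hΘ.isVolterra hT.le hUm hWm M fun _ => a 0
  intro t ht
  have := hV.eqOn hT.le c1 c2 e1 e2 ht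
  simpa only [projIcc_of_mem hT.le ht] using this

theorem Sobolev.norm_der_le {E : Type*} [NormedAddCommGroup E] [NormedSpace ℝ E] {a b : ℝ} {n : ℕ}
    (w : Sobolev E a b n) (i : Fin (n + 1)) : ‖w.der i‖ ≤ ‖w‖ :=
  PiLp.norm_apply_le w.1 i

theorem IsRepJet.integral_norm_sq {E : Type*} [NormedAddCommGroup E] [NormedSpace ℝ E] {a b : ℝ}
    (hab : a ≤ b) {n : ℕ} {w : Sobolev E a b n} {G : ℕ → ℝ → E} (h : IsRepJet w G) :
    ∫ x in a..b, ‖G n x‖ ^ 2 = ‖w.der (Fin.last n)‖ ^ 2 := by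
  rw [L2.norm_sq_eq_integral, ← integral_Ioo_eq_interval hab]
  refine integral_congr_ae ?_
  filter_upwards [h.ae_eq n (by omega)] with x hx
  rw [← hx]
  rfl

/-- Existence of mild solutions, with a bound that is uniform on bounded sets of potentials. -/
theorem exists_isMildSolution (hT : 0 < T) (hm : 2 * p + 3 ≤ m)
    (hμ : ∀ n (hn : n < p), VanishesAtEnds (μ.der ⟨2 * n + 1, by omega⟩)) :
    ∃ L : ℝ → ℝ, (∀ R, 0 < L R) ∧ ∀ u ∈ sobolevZero ℝ 0 T k, ∀ ψ₀ : HZero (2 * (p + k) + 3),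
      ∀ f ∈ sobolevZero (InterSpace (2 * p + 3) (2 * p + 1)) 0 T k,
        ∃ ψ : ℝ → HZero (2 * p + 3), IsMildSolution T p k μ u f ψ₀ ψ ∧
          ∀ R, sobolevZeroNorm u < R →
            ckNorm T k ψ ≤ ENNReal.ofReal (L R * (‖ψ₀‖ + ‖f‖)) := by
  obtain ⟨M, hM⟩ := exists_mulCLM hm μ hμ
  obtain ⟨C, Θ, hΘ⟩ := exists_isDuhamelMap p hT.le
  obtain ⟨K, hK, hKU⟩ := exists_integral_sourceWeight_sq_le hT.le k
  have hC := hΘ.nonneg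
  -- The factor (1+T)^k pays for the k primitives and π^{2k} for the initial values (-iA)^n ψ₀. The
  -- 4 and the exponential come from `IsVolterra.norm_le`, with K R² bounding the integral of
  -- `sourceWeight` squared.
  refine ⟨fun R => (1 + T) ^ k * (Real.pi ^ (2 * k) * (1 + 4 * (2 * (1 + 2 * C *
    (‖M‖ ^ 2 * (K * R ^ 2) + 1))) * Real.exp (C * ‖M‖ ^ 2 * (K * R ^ 2)))),
    fun R => by positivity, fun u hu ψ₀ f hf => ?_⟩
  obtain ⟨U, hU⟩ := u.exists_isRepJet hT
  obtain ⟨W, hW⟩ := f.exists_isRepJet hT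
  obtain ⟨a, ha, haA⟩ := HZero.exists_iterate_generator p k ψ₀
  have hUm : ∀ l ≤ k, MemLp (U l) 2 (volume.restrict (Ioo 0 T)) :=
    fun l hl => hU.memLp (by omega)
  have hWm : MemLp (W k) 2 (volume.restrict (Ioo 0 T)) := hW.memLp (by omega)
  have hU0 : ∀ l < k, U l 0 = 0 := fun l hl => hU.left_end_eq_zero hT hu hl
  -- The q-fold primitive of g is the derivative of ψ of order k - q, so its initial value is
  -- (-iA)^{k-q} ψ₀; the entry q = 0 is the initial datum of g itself.
  have hV := hΘ.isVolterra hT.le hUm hWm M fun q => a (k - q)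
  obtain ⟨g, hg, hfix⟩ := hV.exists_fixed hT.le
  refine ⟨iterPrim (fun q => a (k - q)) g k, isMildSolution_iterPrim hT.le hΘ hU0
    (fun l hl => hW.left_end_eq_zero hT hf hl) hU hW hM
    (fun q _ j => ha (k - q) (Nat.sub_le _ _) j) hg hfix, fun R hR => ?_⟩
  have hQ : ∫ τ in (0:ℝ)..T, sourceWeight T U k τ ^ 2 ≤ K * R ^ 2 := by
    refine (hKU U hU.jet hU0 hUm).trans (mul_le_mul_of_nonneg_left ?_ hK)
    have := hU.integral_norm_sq hT.le
    simp only [Real.norm_eq_abs] at this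
    rw [this]
    exact pow_le_pow_left₀ (norm_nonneg _) hR.le 2
  have hWB : ∫ τ in (0:ℝ)..T, ‖W k τ‖ ^ 2 ≤ ‖f‖ ^ 2 := by
    rw [hW.integral_norm_sq hT.le]
    exact pow_le_pow_left₀ (norm_nonneg _) (f.norm_der_le _) 2
  have hcA : ∀ q, ‖a (k - q)‖ ≤ Real.pi ^ (2 * k) * ‖ψ₀‖ := fun q => haA _
  have hB := hΘ.norm_duhamelMap_zero_le hT.le hUm hWm M hcA hQ (norm_nonneg f) hWB
  have hgb := hV.norm_le hT.le hg hfix hB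
  set κ' := 2 * (1 + 2 * C * (‖M‖ ^ 2 * (K * R ^ 2) + 1)) with hκ'
  have hκ0 : 0 ≤ κ' := by positivity
  set e := Real.exp (C * ‖M‖ ^ 2 * (K * R ^ 2)) with he
  have hexp : Real.exp (∫ τ in (0:ℝ)..T, C * ‖M‖ ^ 2 * sourceWeight T U k τ ^ 2) ≤ e := by
    rw [intervalIntegral.integral_const_mul]
    exact Real.exp_le_exp.2 (mul_le_mul_of_nonneg_left hQ (by positivity))
  have hpi : 1 ≤ Real.pi ^ (2 * k) := one_le_pow₀ (by linarith [Real.pi_gt_three])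
  set S := ‖ψ₀‖ + ‖f‖ with hS
  have hAB : Real.pi ^ (2 * k) * ‖ψ₀‖ + ‖f‖ ≤ Real.pi ^ (2 * k) * S := by
    have h := le_mul_of_one_le_left (norm_nonneg f) hpi
    linarith [mul_add (Real.pi ^ (2 * k)) ‖ψ₀‖ ‖f‖]
  have hA : Real.pi ^ (2 * k) * ‖ψ₀‖ ≤ Real.pi ^ (2 * k) * S :=
    le_trans (le_add_of_nonneg_right (norm_nonneg f)) hAB
  have hgG : ∀ t ∈ Icc 0 T, ‖g t‖ ≤ 4 * κ' * e * (Real.pi ^ (2 * k) * S) := by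
    intro t ht
    refine (hgb t ht).trans ?_
    calc 4 * (κ' * (Real.pi ^ (2 * k) * ‖ψ₀‖ + ‖f‖)) *
          Real.exp (∫ τ in (0:ℝ)..T, C * ‖M‖ ^ 2 * sourceWeight T U k τ ^ 2)
        ≤ 4 * (κ' * (Real.pi ^ (2 * k) * S)) * e := by gcongr
      _ = _ := by ring
  have hcS : ∀ q, ‖a (k - q)‖ ≤ Real.pi ^ (2 * k) * S := fun q => (hcA q).trans hA
  refine iSup₂_le fun n hn => iSup₂_le fun t ht => ?_
  rw [iteratedDerivWithin_iterPrim hT _ hg hn ht, ← ofReal_norm]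
  refine ENNReal.ofReal_le_ofReal ?_
  refine (norm_iterPrim_le hT.le hcS hg hgG (k - n) t ht).trans ?_
  have h1 : (1 + T) ^ (k - n) ≤ (1 + T) ^ k := pow_le_pow_right₀ (by linarith) (Nat.sub_le _ _)
  refine (mul_le_mul_of_nonneg_right h1 (by positivity)).trans (le_of_eq ?_)
  ring

end Mild

end BilinearSchrodinger
end

theorem theorem2p1 (T : ℝ) (hT : 0 < T) (p k : ℕ)
    (μ : Sobolev ℝ 0 1 (2 * (p + k) + 3))
    (hμ : ∀ n (hn : n < p), VanishesAtEnds (μ.der ⟨2 * n + 1, by omega⟩)) :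
    (∀ u ∈ sobolevZero ℝ 0 T k, ∀ ψ₀ : HZero (2 * (p + k) + 3),
      ∀ f ∈ sobolevZero (InterSpace (2 * p + 3) (2 * p + 1)) 0 T k,
        ∃ ψ : ℝ → HZero (2 * p + 3), IsMildSolution T p k μ u f ψ₀ ψ ∧
          ∀ ψ' : ℝ → HZero (2 * p + 3), IsMildSolution T p k μ u f ψ₀ ψ' →
            Set.EqOn ψ' ψ (Set.Icc 0 T)) ∧
    ∀ R : ℝ, 0 < R → ∃ C : ℝ, 0 < C ∧ ∀ u ∈ sobolevZero ℝ 0 T k, sobolevZeroNorm u < R →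
      ∀ ψ₀ : HZero (2 * (p + k) + 3),
      ∀ f ∈ sobolevZero (InterSpace (2 * p + 3) (2 * p + 1)) 0 T k,
        ∀ ψ : ℝ → HZero (2 * p + 3), IsMildSolution T p k μ u f ψ₀ ψ →
          ckNorm T k ψ ≤ ENNReal.ofReal (C * (‖ψ₀‖ + ‖f‖)) := by
  have hm : 2 * p + 3 ≤ 2 * (p + k) + 3 := by omega
  obtain ⟨L, hL, hex⟩ := exists_isMildSolution (k := k) hT hm hμ
  refine ⟨fun u hu ψ₀ f hf => ?_, fun R _ => ⟨L R, hL R, fun u hu huR ψ₀ f hf ψ hψ => ?_⟩⟩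
  · obtain ⟨ψ, hψ, -⟩ := hex u hu ψ₀ f hf
    exact ⟨ψ, hψ, fun ψ' hψ' => hψ'.eqOn hT hm hμ hψ⟩
  · obtain ⟨φ, hφ, hb⟩ := hex u hu ψ₀ f hf
    -- The norm only sees values on [0,T], where any mild solution coincides with the constructed
    -- one, so the bound transfers.
    refine le_trans (le_of_eq ?_) (hb R huR)
    refine iSup_congr fun n => iSup_congr fun _ => iSup_congr fun t => iSup_congr fun ht => ?_
    rw [iteratedDerivWithin_congr (hψ.eqOn hT hm hμ hφ) ht]
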